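/- Let $\alpha\in\mathbb R$, let $g\in C^1([\alpha,\infty))$ satisfy $g(\alpha)=\alpha$ and $g'<0$, and put $b:=\lim_{t\to\infty}g(t)\in[-\infty,\alpha)$. Let $\mathcal W_g$ be the class of oriented $C^2$ surfaces in $\mathbb R^3$ whose principal curvatures $\kappa_1\ge\kappa_2$ satisfy $\kappa_1\ge\alpha$ and $\kappa_2=g(\kappa_1)$ at every point. Let $f:(b,\infty)\to(b,\infty)$ be given by $f=g$ on $[\alpha,\infty)$ and $f=g^{-1}$ on $(b,\alpha]$, put $\rho:=f(0)$ (when $b<0$), and let $\mathcal G(\lambda)=\lambda\exp\mathcal F(\lambda)$, where $\mathcal F$ is any primitive of $1/(f(\lambda)-\lambda)$ on $(b,\infty)\setminus\{\alpha\}$. A rotational surface is the surface obtained by rotating about the $z$-axis a planar curve $s\mapsto(x(s),0,z(s))$, $x\ge 0$, parametrized by arc length on an interval, with the unit normal $N$ which along the curve is the rotation of its tangent vector by $\pi/2$, $N=(-z',0,x')$. It may meet the axis only at end points of the interval, and only where it is a regular $C^2$ surface. Two such surfaces are identified if their profile curves differ by a vertical translation and a shift of the parameter. The following rotational surfaces in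 $\mathcal W_g$ are considered. * A *special unduloid* $\mathcal O_\tau$ (resp. *special nodoid* $\mathcal N_\tau$): complete, with profile curve defined on $\mathbb R$, of non-constant distance to the axis, invariant under a non-trivial vertical translation, with minimum distance $\tau>0$ to the axis, and embedded with $z'\neq 0$ everywhere (resp. not embedded, with $z'=0$ somewhere). * *Pinched* and *singular* surfaces: the profile curve is defined on $(-a,a)$, is symmetric with respect to $z=0$ ($x$ is even, $z$ is odd), extends continuously and injectively to $[-a,a]$, and the second fundamental form blows up as $s\to\pm a$. The surface is *pinched* if $x(\pm a)=0$ (a sphere with two isolated singularities) with limit angles $\{\nu,-\nu\}$, that is, $\langle N,e_3\rangle$ tends to $\nu$ as $s\to-a$ and to $-\nu$ as $s\to a$. It is *singular* if $x(\pm a)=d>0$ (an annulus bounded by two singular circles). It is a *special unduloid* if $z'\ne0$ on $(-a,a)$ and the Gauss curvature is negative near the ends, and a *special nodoid* if $z'=0$ somewhere. The notations are $\mathcal O^P_\nu,\mathcal N^P_\nu$ (pinched) and $\mathcal O^S_d,\mathcal N^S_d$ (singular). **Theorem.** Assume $\alpha\neq0$ and $b<0$. Then any rotational surface in $\mathcal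 W_g$ is an open piece of one of the following surfaces: 1. a sphere of principal curvatures $\alpha$; 2. a cylinder of principal curvatures $\{0,f(0)\}$; 3. a special unduloid $\mathcal O_\tau$, with $0<\tau<1/\rho$ if $\alpha>0$, and $-1/b<\tau<-1/\rho$ if $\alpha<0$ (with $-1/b=0$ if $b=-\infty$); 4. a special nodoid $\mathcal N_\tau$, with $\tau>-1/b$ if $\alpha>0$, and $\tau>0$ if $\alpha<0$; 5. a pinched special unduloid $\mathcal O^P_\nu$; 6. a pinched special nodoid $\mathcal N^P_\nu$; 7. a singular special unduloid $\mathcal O^S_d$; 8. a singular special nodoid $\mathcal N^S_d$. Moreover: * a surface $\mathcal O^P_\nu$ exists in $\mathcal W_g$ if and only if $\nu\in[0,1)$ and either $\alpha>0$ and $\lim_{\lambda\to\infty}\mathcal G(\lambda)$ is finite, or $\alpha<0$, $b=-\infty$ and $\lim_{\lambda\to-\infty}\mathcal G(\lambda)$ is finite; * a surface $\mathcal N^P_\nu$ exists in $\mathcal W_g$ if and only if $\nu\in[0,1)$ and either $\alpha<0$ and $\lim_{\lambda\to\infty}\mathcal G(\lambda)$ is finite, or $\alpha>0$, $b=-\infty$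 and $\lim_{\lambda\to-\infty}\mathcal G(\lambda)$ is finite; * a surface $\mathcal O^S_d$ exists in $\mathcal W_g$ if and only if $\alpha<0$, $b\neq-\infty$ and $0<d\le1/|b|$; * a surface $\mathcal N^S_d$ exists in $\mathcal W_g$ if and only if $\alpha>0$, $b\neq-\infty$ and $0<d\le1/|b|$. -/

import Mathlib

open Set Filter Topology

noncomputable section

/-- Euclidean three-space. -/
abbrev E3 : Type := EuclideanSpace ℝ (Fin 3)

/-! ### Elliptic Weingarten classes -/

/-- `g` is `C¹` on `[α, ∞)` with `g' < 0` there (one-sided derivative at `α`), and `g α = α`.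
It defines the relation `κ₂ = g κ₁` between the principal curvatures `κ₁ ≥ κ₂`. -/
structure IsEllipticWeingartenFunction (g : ℝ → ℝ) (α : ℝ) : Prop where
  map_umbilical : g α = α
  contDiffOn : ContDiffOn ℝ 1 g (Ici α)
  deriv_neg : ∀ t ∈ Ici α, derivWithin g (Ici α) t < 0

/-- The function `f` with `f = g` on `[α, ∞)` and `f = g⁻¹` on `(b, α]`, where `b = g(∞)`. -/
def weingartenF (g : ℝ → ℝ) (α : ℝ) (t : ℝ) : ℝ :=
  open Classical in if α ≤ t then g t else Function.invFunOn g (Ici α) t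

/-- `F` is a primitive of `1 / (f(t) - t)` on `(b, ∞) \ {α}`. -/
def IsWeingartenPrimitive (g : ℝ → ℝ) (α : ℝ) (b : EReal) (F : ℝ → ℝ) : Prop :=
  ∀ t : ℝ, b < (t : EReal) → t ≠ α → HasDerivAt F (1 / (weingartenF g α t - t)) t

/-- The function `𝒢(t) = t * exp (F t)` attached to a primitive `F`. -/
def weingartenG (F : ℝ → ℝ) (t : ℝ) : ℝ := t * Real.exp (F t)

/-! ### Principal curvatures of an oriented parametrized surface -/

/-- `k₁, k₂` are the principal curvatures at `q` of the parametrized surface `X` with unit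
normal field `N`: there is a basis `v₁, v₂` of the parameter plane with `dN vᵢ = - kᵢ dX vᵢ`,
that is, the shape operator `-dN` is diagonal in that basis, with eigenvalues `k₁, k₂`. -/
def HasPrincipalCurvatures (X N : ℝ × ℝ → E3) (q : ℝ × ℝ) (k₁ k₂ : ℝ) : Prop :=
  DifferentiableAt ℝ X q ∧ DifferentiableAt ℝ N q ∧
  ∃ v₁ v₂ : ℝ × ℝ, LinearIndependent ℝ ![v₁, v₂] ∧
    fderiv ℝ N q v₁ = -(k₁ • fderiv ℝ X q v₁) ∧
    fderiv ℝ N q v₂ = -(k₂ • fderiv ℝ X q v₂)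

/-- The principal curvatures `κ₁ ≥ κ₂` at `q` satisfy `κ₁ ∈ [α, ∞)` and `κ₂ = g κ₁`. -/
def SatisfiesWeingartenAt (g : ℝ → ℝ) (α : ℝ) (X N : ℝ × ℝ → E3) (q : ℝ × ℝ) : Prop :=
  ∃ κ₁ κ₂ : ℝ, HasPrincipalCurvatures X N q κ₁ κ₂ ∧ κ₂ ≤ κ₁ ∧ α ≤ κ₁ ∧ κ₂ = g κ₁

/-- The graph of `U` over the horizontal plane. -/
def graphParam (U : ℝ × ℝ → ℝ) (p : ℝ × ℝ) : E3 := !₂[p.1, p.2, U p]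

/-- The upward unit normal of the graph of `U`. -/
def graphNormal (U : ℝ × ℝ → ℝ) (p : ℝ × ℝ) : E3 :=
  (√(1 + (fderiv ℝ U p (1, 0)) ^ 2 + (fderiv ℝ U p (0, 1)) ^ 2))⁻¹ •
    !₂[-(fderiv ℝ U p (1, 0)), -(fderiv ℝ U p (0, 1)), 1]

/-! ### Rotational surfaces -/

/-- A planar curve `s ↦ (x s, z s)` with parameter set `I`, to be rotated about the `z`-axis. -/
structure ProfileCurve where
  I : Set ℝ
  x : ℝ → ℝ
  z : ℝ → ℝ

namespace ProfileCurve

/-- The surface obtained by rotating the profile curve about the `z`-axis. -/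
def param (γ : ProfileCurve) (q : ℝ × ℝ) : E3 :=
  !₂[γ.x q.1 * Real.cos q.2, γ.x q.1 * Real.sin q.2, γ.z q.1]

/-- The unit normal which along the (arc-length parametrized) profile curve is `J γ'`,
`J` the rotation by `π / 2` in the half-plane of the curve. -/
def normal (γ : ProfileCurve) (q : ℝ × ℝ) : E3 :=
  !₂[-(deriv γ.z q.1) * Real.cos q.2, -(deriv γ.z q.1) * Real.sin q.2, deriv γ.x q.1]

/-- At `s₀` the profile curve meets the axis, and there the rotated surface is a regular `C²`
surface (necessarily a graph over the horizontal plane), oriented by the continuation `σ` times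
the upward normal of the normal chosen above, which satisfies the Weingarten relation. -/
def HasRegularPole (g : ℝ → ℝ) (α : ℝ) (γ : ProfileCurve) (s₀ : ℝ) : Prop :=
  γ.x s₀ = 0 ∧ ∃ (U : ℝ × ℝ → ℝ) (σ : ℝ), (σ = 1 ∨ σ = -1) ∧ ContDiffAt ℝ 2 U 0 ∧
    (∀ᶠ s in 𝓝[γ.I] s₀, ∀ θ : ℝ, U (γ.x s * Real.cos θ, γ.x s * Real.sin θ) = γ.z s) ∧
    (∀ᶠ s in 𝓝[interior γ.I] s₀, 0 < σ * deriv γ.x s) ∧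
    SatisfiesWeingartenAt g α (graphParam U) (fun p => σ • graphNormal U p) 0

/-- The (connected, `C²`, immersed) rotational surface generated by `γ` belongs to the
Weingarten class of `g`. The curve is parametrized by arc length on an interval, it lies in
`x > 0` except possibly for end points contained in `I`, which are regular points of the
surface on the axis. -/
structure IsRotationalWeingarten (g : ℝ → ℝ) (α : ℝ) (γ : ProfileCurve) : Prop where
  ordConnected : γ.I.OrdConnected
  nonempty_interior : (interior γ.I).Nonempty
  continuousOn_x : ContinuousOn γ.x γ.I
  continuousOn_z : ContinuousOn γ.z γ.I
  contDiffOn_x : ContDiffOn ℝ 2 γ.x (interior γ.I)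
  contDiffOn_z : ContDiffOn ℝ 2 γ.z (interior γ.I)
  x_pos : ∀ s ∈ interior γ.I, 0 < γ.x s
  arc_length : ∀ s ∈ interior γ.I, (deriv γ.x s) ^ 2 + (deriv γ.z s) ^ 2 = 1
  weingarten : ∀ s ∈ interior γ.I, ∀ θ : ℝ, SatisfiesWeingartenAt g α γ.param γ.normal (s, θ)
  pole : ∀ s ∈ γ.I \ interior γ.I, γ.HasRegularPole g α s

/-- The surface of `γ` is an open piece of the surface of `δ`, up to a vertical translation
(and a shift of the arc-length parameter); the orientations agree. -/
def IsOpenPieceOf (γ δ : ProfileCurve) : Prop :=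
  ∃ s₀ c : ℝ, ∀ s ∈ γ.I, s + s₀ ∈ δ.I ∧ γ.x s = δ.x (s + s₀) ∧ γ.z s = δ.z (s + s₀) + c

/-! ### The model surfaces -/

/-- The round sphere of radius `1 / |α|`, oriented so that its principal curvatures are `α`. -/
def sphere (α : ℝ) : ProfileCurve where
  I := Icc 0 (Real.pi / |α|)
  x s := Real.sin (|α| * s) / |α|
  z s := -(Real.cos (|α| * s) / α)

/-- The round cylinder of radius `1 / |ρ|`, oriented so that its principal curvatures are
`0` and `ρ`. -/
def cylinder (ρ : ℝ) : ProfileCurve where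
  I := univ
  x _ := 1 / |ρ|
  z s := ρ / |ρ| * s

/-- The tangent line of the profile curve is never horizontal. -/
def IsUnduloidType (γ : ProfileCurve) : Prop := ∀ s ∈ γ.I, deriv γ.z s ≠ 0

/-- The tangent line of the profile curve is horizontal somewhere. -/
def IsNodoidType (γ : ProfileCurve) : Prop := ∃ s ∈ γ.I, deriv γ.z s = 0

/-- A complete rotational surface of the Weingarten class whose profile curve is invariant under
a non-trivial vertical translation, is not a vertical line, and has minimum distance `τ > 0` to
the axis. -/
structure IsDelaunayType (g : ℝ → ℝ) (α τ : ℝ) (γ : ProfileCurve) : Prop where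
  weingarten : γ.IsRotationalWeingarten g α
  complete : γ.I = univ
  periodic : ∃ T h : ℝ, 0 < T ∧ h ≠ 0 ∧ ∀ s, γ.x (s + T) = γ.x s ∧ γ.z (s + T) = γ.z s + h
  neck_pos : 0 < τ
  neck : IsLeast (range γ.x) τ
  bulge : ∃ τ' > τ, IsGreatest (range γ.x) τ'

/-- The special unduloid with necksize `τ`: the surface is embedded. -/
structure IsSpecialUnduloid (g : ℝ → ℝ) (α τ : ℝ) (γ : ProfileCurve) : Prop where
  delaunay : γ.IsDelaunayType g α τ
  unduloid : γ.IsUnduloidType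
  embedded : Function.Injective fun s => (γ.x s, γ.z s)

/-- The special nodoid with necksize `τ`: the surface is not embedded. -/
structure IsSpecialNodoid (g : ℝ → ℝ) (α τ : ℝ) (γ : ProfileCurve) : Prop where
  delaunay : γ.IsDelaunayType g α τ
  nodoid : γ.IsNodoidType
  not_embedded : ¬ Function.Injective fun s => (γ.x s, γ.z s)

/-- A rotational surface of the Weingarten class, with profile curve defined on `(-a, a)` and
extending continuously and injectively to `[-a, a]`, which is symmetric with respect to the plane
`z = 0`, which is at distance `d` from the axis at both ends, and which is singular there: its
second fundamental form blows up. For `d = 0` its closure is an embedded topological sphere with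
two isolated singularities, for `d > 0` it is an embedded annulus bounded by two singular
circles. -/
structure HasTwoSingularEnds (g : ℝ → ℝ) (α a d : ℝ) (γ : ProfileCurve) : Prop where
  weingarten : γ.IsRotationalWeingarten g α
  pos : 0 < a
  domain : γ.I = Ioo (-a) a
  symm_x : ∀ s ∈ Icc (-a) a, γ.x (-s) = γ.x s
  symm_z : ∀ s ∈ Icc (-a) a, γ.z (-s) = -γ.z s
  continuousOn_x : ContinuousOn γ.x (Icc (-a) a)
  continuousOn_z : ContinuousOn γ.z (Icc (-a) a)
  embedded : InjOn (fun s => (γ.x s, γ.z s)) (Icc (-a) a)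
  dist_axis : γ.x a = d
  blow_up : ∀ C : ℝ, ∀ᶠ s in 𝓝[<] a, ∃ k₁ k₂ : ℝ,
    HasPrincipalCurvatures γ.param γ.normal (s, 0) k₁ k₂ ∧ C < max |k₁| |k₂|

/-- The limits of `⟨N, e₃⟩` at the two ends are `ν` and `-ν`. -/
def HasLimitAngles (a ν : ℝ) (γ : ProfileCurve) : Prop :=
  Tendsto (fun s => γ.normal (s, 0) 2) (𝓝[>] (-a)) (𝓝 ν) ∧
  Tendsto (fun s => γ.normal (s, 0) 2) (𝓝[<] a) (𝓝 (-ν))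

/-- The Gauss curvature is negative near the (by symmetry, both) ends. -/
def NegativelyCurvedNearEnds (a : ℝ) (γ : ProfileCurve) : Prop :=
  ∀ᶠ s in 𝓝[<] a, ∃ k₁ k₂ : ℝ,
    HasPrincipalCurvatures γ.param γ.normal (s, 0) k₁ k₂ ∧ k₁ * k₂ < 0

/-- The pinched special unduloid with limit angles `{ν, -ν}` at its two isolated
singularities. -/
def IsPinchedUnduloid (g : ℝ → ℝ) (α ν : ℝ) (γ : ProfileCurve) : Prop :=
  ∃ a : ℝ, γ.HasTwoSingularEnds g α a 0 ∧ γ.HasLimitAngles a ν ∧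
    γ.NegativelyCurvedNearEnds a ∧ γ.IsUnduloidType

/-- The pinched special nodoid with limit angles `{ν, -ν}` at its two isolated singularities. -/
def IsPinchedNodoid (g : ℝ → ℝ) (α ν : ℝ) (γ : ProfileCurve) : Prop :=
  ∃ a : ℝ, γ.HasTwoSingularEnds g α a 0 ∧ γ.HasLimitAngles a ν ∧ γ.IsNodoidType

/-- The singular special unduloid whose singular circles are at distance `d > 0` from the
axis. -/
def IsSingularUnduloid (g : ℝ → ℝ) (α d : ℝ) (γ : ProfileCurve) : Prop :=
  0 < d ∧ ∃ a : ℝ, γ.HasTwoSingularEnds g α a d ∧ γ.NegativelyCurvedNearEnds a ∧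
    γ.IsUnduloidType

/-- The singular special nodoid whose singular circles are at distance `d > 0` from the axis. -/
def IsSingularNodoid (g : ℝ → ℝ) (α d : ℝ) (γ : ProfileCurve) : Prop :=
  0 < d ∧ ∃ a : ℝ, γ.HasTwoSingularEnds g α a d ∧ γ.IsNodoidType

end ProfileCurve

end

/-! ### Global solutions of bounded Lipschitz autonomous equations -/

/-! Along an arc-length profile curve the parallels have curvature `λ = z'/x` and the curve itself
has curvature `μ`. Since `f` is the involution exchanging the two principal curvatures, the
Weingarten relation reads `μ = f(λ)`, whence `λ' = (x'/x)(f(λ) - λ)`. Either `λ` is identically `α`,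
which gives the sphere, or `λ` never equals `α` and `x · exp(-F(λ))` is constant for a primitive `F`
of `1/(f - id)`. The two cases do not mix because `F → +∞` at `α`. Absorbing the constant into `F`
gives `x = exp(F(λ))` (`exists_first_integral`).

On each side of `α` the function `exp F` is strictly monotone onto a half-line `(u₀, ∞)`; let `Λ` be
its inverse. Then `z' = x Λ(x)`. With `σ` the sign of `α`, `M = σΛ`, `K = σ f(Λ)` and `H(u) = u
M(u)`, one finds `H' = K`, `x'' = -H(x) H'(x)` and `x'² + H(x)² = 1`: the distance to the axis is a
one-dimensional conservative motion confined to `|H| ≤ 1`, and every surface is determined by one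
state of it (`OrbitOn.unique`).

The sign of `α` and the side of `α` combine into two shapes of `H`. If `Λ` lives on the side of `α`
away from `0` (undular), `H` is positive, first decreasing and then increasing, with minimum where
`M = |ρ|`. If `Λ` lives on the side containing `0` (nodal), `H` is strictly increasing and changes
sign. As `H → +∞` at infinity there is an outer turning point, the bulge, with `H = 1`, unless the
minimum of an undular `H` is itself `1`: then `x` is constant and the surface is a cylinder. If
there is an inner turning point, the neck (`H = 1` or `H = -1`), the motion is periodic and gives a
special unduloid or nodoid. Otherwise `H` has a limit `l` at `u₀` with `|l| ≤ 1`, and `u₀` is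
reached in finite time with curvatures blowing up: pinched if `u₀ = 0`, singular if `u₀ > 0`
(`IsUndularBranch.trichotomy`, `IsNodalBranch.dichotomy`, `exists_singular_ends`).

For existence, `u Λ(u) = 𝒢(λ)` when `u = exp(F(λ))`. When `Λ → ±∞`, finiteness of `l` is finiteness
of the limit of `𝒢`, and it forces `u₀ = 0`. Changing the constant of integration in `F` multiplies
`l` by any positive factor, so every limit angle `√(1 - l²)` in `[0, 1)` occurs. When `b` is finite
and `Λ` lies below `α`, instead `u₀ > 0` and `l = σ b u₀`, with `u₀` arbitrary after the same
change; `|l| ≤ 1` is then `u₀ ≤ 1/|b|`. -/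

theorem exists_glue {ι E : Type*} [Zero E] (φ : ι → ℝ → E) (T : ι → ℝ)
    (h : ∀ i j s, |s| < T i → |s| < T j → φ i s = φ j s) :
    ∃ ψ : ℝ → E, ∀ i s, |s| < T i → ψ s = φ i s := by
  classical
  refine ⟨fun s => if hs : ∃ i, |s| < T i then φ hs.choose s else 0, fun i s hs => ?_⟩
  have hex : ∃ i, |s| < T i := ⟨i, hs⟩
  simp only [hex, dif_pos]
  exact h _ _ _ hex.choose_spec hs

theorem exists_global_solution {E : Type*} [NormedAddCommGroup E] [NormedSpace ℝ E]
    [CompleteSpace E] {v : E → E} {K L : NNReal} (hK : LipschitzWith K v) (hL : ∀ e, ‖v e‖ ≤ L)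
    (e₀ : E) : ∃ φ : ℝ → E, φ 0 = e₀ ∧ ∀ t, HasDerivAt φ (v (φ t)) t := by
  have hloc : ∀ n : ℕ, ∃ φ : ℝ → E, φ 0 = e₀ ∧
      ∀ t ∈ Ioo (-((n : ℝ) + 1)) ((n : ℝ) + 1), HasDerivAt φ (v (φ t)) t := by
    intro n
    have hn : (0 : ℝ) ≤ (n : ℝ) + 1 := by positivity
    -- The radius `L (n + 1)` is the farthest a solution of speed at most `L` can travel in time `n
    -- + 1`, so the ball never restricts the time of existence.
    have hP : IsPicardLindelof (fun _ : ℝ => v) (tmin := -((n : ℝ) + 1)) (tmax := (n : ℝ) + 1)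
        ⟨0, by constructor <;> linarith⟩ e₀ (L * ((n : NNReal) + 1)) 0 L K :=
      { lipschitzOnWith := fun t _ => hK.lipschitzOnWith
        continuousOn := fun _ _ => continuousOn_const
        norm_le := fun _ _ e _ => hL e
        mul_max_le := by simp }
    obtain ⟨φ, h0, hφ⟩ := hP.exists_eq_forall_mem_Icc_hasDerivWithinAt₀
    exact ⟨φ, h0, fun t ht => (hφ t (Ioo_subset_Icc_self ht)).hasDerivAt (Icc_mem_nhds ht.1 ht.2)⟩
  choose φ h0 hφ using hloc
  obtain ⟨ψ, hψ⟩ := exists_glue φ (fun n => (n : ℝ) + 1) (by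
    intro i j s hi hj
    set T := min ((i : ℝ) + 1) ((j : ℝ) + 1)
    have hT : 0 < T := by positivity
    have hmem : s ∈ Ioo (-T) T := abs_lt.1 (lt_min hi hj)
    have hli : T ≤ (i : ℝ) + 1 := min_le_left _ _
    have hlj : T ≤ (j : ℝ) + 1 := min_le_right _ _
    refine ODE_solution_unique_of_mem_Ioo (v := fun _ => v) (s := fun _ => univ) (K := K)
      (t₀ := 0) (a := -T) (b := T) (fun _ _ => hK.lipschitzOnWith) ⟨by linarith, hT⟩
      (fun t ht => ⟨hφ i t ⟨by linarith [ht.1], by linarith [ht.2]⟩, mem_univ _⟩)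
      (fun t ht => ⟨hφ j t ⟨by linarith [ht.1], by linarith [ht.2]⟩, mem_univ _⟩)
      ((h0 i).trans (h0 j).symm) hmem)
  refine ⟨ψ, by rw [hψ 0 0 (by simp), h0], fun t => ?_⟩
  obtain ⟨n, hn⟩ := exists_nat_gt |t|
  have hn' : |t| < (n : ℝ) + 1 := by linarith
  have hev : ψ =ᶠ[𝓝 t] φ n := by
    filter_upwards [(continuous_abs.tendsto t).eventually_lt_const hn'] with s hs
    exact hψ n s hs
  rw [hψ n t hn']
  exact (hφ n t (abs_lt.1 hn')).congr_of_eventuallyEq hev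

/-! ### Orbits of a one-dimensional conservative system -/

/-- On `S`, the pair `(x, p)` solves `x' = p`, `p' = -H(x) K(x)` (where `K = H'`) in the region
`x > u₀`, at energy `p² + H(x)² = 1`. -/
structure OrbitOn (u₀ : ℝ) (H K : ℝ → ℝ) (S : Set ℝ) (x p : ℝ → ℝ) : Prop where
  lt : ∀ s ∈ S, u₀ < x s
  hasDerivAt_x : ∀ s ∈ S, HasDerivAt x (p s) s
  hasDerivAt_p : ∀ s ∈ S, HasDerivAt p (-(H (x s) * K (x s))) s
  energy : ∀ s ∈ S, p s ^ 2 + H (x s) ^ 2 = 1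

/-- `H` is differentiable on `(u₀, ∞)` with locally Lipschitz derivative `K`. -/
structure IsPotential (u₀ : ℝ) (H K : ℝ → ℝ) : Prop where
  hasDerivAt : ∀ u > u₀, HasDerivAt H (K u) u
  locallyLipschitzOn : LocallyLipschitzOn (Ioi u₀) K

namespace IsPotential

variable {u₀ : ℝ} {H K : ℝ → ℝ}

theorem continuousOn (h : IsPotential u₀ H K) : ContinuousOn H (Ioi u₀) :=
  fun u hu => (h.hasDerivAt u hu).continuousAt.continuousWithinAt

theorem continuousOn_deriv (h : IsPotential u₀ H K) : ContinuousOn K (Ioi u₀) :=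
  h.locallyLipschitzOn.continuousOn

/-- Compactness of `[m, M]` inside `(u₀, ∞)` turns the local Lipschitz property into a global one
there; this is what ODE uniqueness needs, since orbits over compact time stay in such an interval.
-/
theorem exists_lipschitz_force (h : IsPotential u₀ H K) {m M : ℝ} (hm : u₀ < m) :
    ∃ C : NNReal, LipschitzOnWith C (fun u => -(H u * K u)) (Icc m M) := by
  have hsub : Icc m M ⊆ Ioi u₀ := fun u hu => lt_of_lt_of_le hm hu.1
  obtain ⟨C₁, hC₁⟩ := (h.locallyLipschitzOn.mono hsub).exists_lipschitzOnWith_of_compact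
    isCompact_Icc
  obtain ⟨B, hB⟩ := isCompact_Icc.exists_bound_of_continuousOn (h.continuousOn_deriv.mono hsub)
  obtain ⟨A, hA⟩ := isCompact_Icc.exists_bound_of_continuousOn (h.continuousOn.mono hsub)
  have hlip : ∀ u ∈ Icc m M, ∀ v ∈ Icc m M, |H u - H v| ≤ B * |u - v| := by
    intro u hu v hv
    have := (convex_Icc m M).norm_image_sub_le_of_norm_hasDerivWithin_le (f := H) (f' := K)
      (C := B) (fun w hw => (h.hasDerivAt w (hsub hw)).hasDerivWithinAt) hB hv hu
    simpa [Real.norm_eq_abs] using this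
  refine ⟨(A * C₁ + B * B).toNNReal, LipschitzOnWith.of_dist_le_mul fun u hu v hv => ?_⟩
  have h1 := hlip u hu v hv
  have h2 := hC₁.dist_le_mul u hu v hv
  have hAu := hA u hu
  have hBv := hB v hv
  have hB0 : 0 ≤ B := (norm_nonneg _).trans hBv
  have hA0 : 0 ≤ A := (norm_nonneg _).trans hAu
  simp only [Real.dist_eq, Real.norm_eq_abs] at *
  rw [Real.coe_toNNReal _ (by positivity)]
  have e : -(H u * K u) - -(H v * K v) = -(H u * (K u - K v) + (H u - H v) * K v) := by ring
  rw [e, abs_neg]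
  calc |H u * (K u - K v) + (H u - H v) * K v|
      ≤ |H u| * |K u - K v| + |H u - H v| * |K v| := by
        rw [← abs_mul, ← abs_mul]; exact abs_add_le _ _
    _ ≤ A * (C₁ * |u - v|) + (B * |u - v|) * B := by gcongr
    _ = _ := by ring

end IsPotential

namespace OrbitOn

variable {u₀ : ℝ} {H K : ℝ → ℝ} {S : Set ℝ} {x p y r : ℝ → ℝ}

theorem mono (h : OrbitOn u₀ H K S x p) {T : Set ℝ} (hT : T ⊆ S) : OrbitOn u₀ H K T x p :=
  ⟨fun s hs => h.lt s (hT hs), fun s hs => h.hasDerivAt_x s (hT hs),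
    fun s hs => h.hasDerivAt_p s (hT hs), fun s hs => h.energy s (hT hs)⟩

theorem continuousOn_x (h : OrbitOn u₀ H K S x p) : ContinuousOn x S :=
  fun s hs => (h.hasDerivAt_x s hs).continuousAt.continuousWithinAt

theorem abs_p_le (h : OrbitOn u₀ H K S x p) {s : ℝ} (hs : s ∈ S) : |p s| ≤ 1 := by
  have := h.energy s hs
  rw [abs_le]; constructor <;> nlinarith [sq_nonneg (H (x s))]

theorem comp_add (h : OrbitOn u₀ H K S x p) (c : ℝ) :
    OrbitOn u₀ H K ((· + c) ⁻¹' S) (fun s => x (s + c)) (fun s => p (s + c)) where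
  lt _ hs := h.lt _ hs
  hasDerivAt_x s hs := (h.hasDerivAt_x _ hs).comp_add_const s c
  hasDerivAt_p s hs := (h.hasDerivAt_p _ hs).comp_add_const s c
  energy _ hs := h.energy _ hs

/-- The force depends on position only, so reversing time and the velocity gives an orbit again. -/
theorem reflect (h : OrbitOn u₀ H K S x p) (c : ℝ) :
    OrbitOn u₀ H K ((fun s => c - s) ⁻¹' S) (fun s => x (c - s)) (fun s => -p (c - s)) where
  lt _ hs := h.lt _ hs
  hasDerivAt_x s hs := by
    exact (h.hasDerivAt_x _ hs).comp_const_sub c s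
  hasDerivAt_p s hs := by
    simpa using ((h.hasDerivAt_p _ hs).comp_const_sub c s).fun_neg
  energy _ hs := by simpa using h.energy _ hs

/-- Orbits are determined by their state at one time. -/
theorem unique (hH : IsPotential u₀ H K) (hS : IsOpen S) (hc : S.OrdConnected)
    (h₁ : OrbitOn u₀ H K S x p) (h₂ : OrbitOn u₀ H K S y r) {t : ℝ} (ht : t ∈ S)
    (hx : x t = y t) (hp : p t = r t) {s : ℝ} (hs : s ∈ S) : x s = y s ∧ p s = r s := by
  have hmin : min s t ∈ S := by rcases min_choice s t with h | h <;> rw [h] <;> assumption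
  have hmax : max s t ∈ S := by rcases max_choice s t with h | h <;> rw [h] <;> assumption
  obtain ⟨a, ha, haS⟩ : ∃ a < min s t, a ∈ S :=
    ((eventually_mem_set.2 (mem_nhdsWithin_of_mem_nhds (hS.mem_nhds hmin))).and
      self_mem_nhdsWithin).exists (f := 𝓝[<] min s t) |>.imp fun _ h => ⟨h.2, h.1⟩
  obtain ⟨b, hb, hbS⟩ : ∃ b > max s t, b ∈ S :=
    ((eventually_mem_set.2 (mem_nhdsWithin_of_mem_nhds (hS.mem_nhds hmax))).and
      self_mem_nhdsWithin).exists (f := 𝓝[>] max s t) |>.imp fun _ h => ⟨h.2, h.1⟩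
  have hsub : Icc a b ⊆ S := hc.out haS hbS
  have hab : a ≤ b := (ha.le.trans min_le_max).trans hb.le
  have hne : (Icc a b).Nonempty := nonempty_Icc.2 hab
  -- Over the compact time interval `[a, b]` both orbits stay in a common compact `[m, M]` inside
  -- `(u₀, ∞)`, where the force is Lipschitz.
  obtain ⟨t₁, ht₁, hm₁⟩ := isCompact_Icc.exists_isMinOn hne (h₁.continuousOn_x.mono hsub)
  obtain ⟨t₂, ht₂, hm₂⟩ := isCompact_Icc.exists_isMinOn hne (h₂.continuousOn_x.mono hsub)
  obtain ⟨t₃, ht₃, hm₃⟩ := isCompact_Icc.exists_isMaxOn hne (h₁.continuousOn_x.mono hsub)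
  obtain ⟨t₄, ht₄, hm₄⟩ := isCompact_Icc.exists_isMaxOn hne (h₂.continuousOn_x.mono hsub)
  set m := min (x t₁) (y t₂)
  set M := max (x t₃) (y t₄)
  have hm : u₀ < m := lt_min (h₁.lt _ (hsub ht₁)) (h₂.lt _ (hsub ht₂))
  obtain ⟨C, hC⟩ := hH.exists_lipschitz_force (M := M) hm
  have hv : LipschitzOnWith (max 1 C) (fun w : ℝ × ℝ => (w.2, -(H w.1 * K w.1)))
      (Icc m M ×ˢ univ) := by
    refine LipschitzOnWith.prodMk (LipschitzWith.prod_snd.lipschitzOnWith) ?_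
    have := hC.comp (LipschitzWith.prod_fst (α := ℝ) (β := ℝ)).lipschitzOnWith
      (s := Icc m M ×ˢ univ) (fun w hw => hw.1)
    simpa [Function.comp_def] using this
  have hst : s ∈ Ioo a b := ⟨ha.trans_le (min_le_left _ _), (le_max_left _ _).trans_lt hb⟩
  have htt : t ∈ Ioo a b := ⟨ha.trans_le (min_le_right _ _), (le_max_right _ _).trans_lt hb⟩
  have key := ODE_solution_unique_of_mem_Ioo
    (v := fun _ => fun w : ℝ × ℝ => (w.2, -(H w.1 * K w.1)))
    (s := fun _ => Icc m M ×ˢ univ) (K := max 1 C) (t₀ := t) (a := a) (b := b)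
    (f := fun s => (x s, p s)) (g := fun s => (y s, r s)) (fun _ _ => hv) htt
    (fun τ hτ => ⟨(h₁.hasDerivAt_x τ (hsub (Ioo_subset_Icc_self hτ))).prodMk
      (h₁.hasDerivAt_p τ (hsub (Ioo_subset_Icc_self hτ))),
      ⟨(min_le_left _ _).trans (hm₁ (Ioo_subset_Icc_self hτ)),
        (hm₃ (Ioo_subset_Icc_self hτ)).trans (le_max_left _ _)⟩, mem_univ _⟩)
    (fun τ hτ => ⟨(h₂.hasDerivAt_x τ (hsub (Ioo_subset_Icc_self hτ))).prodMk
      (h₂.hasDerivAt_p τ (hsub (Ioo_subset_Icc_self hτ))),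
      ⟨(min_le_right _ _).trans (hm₂ (Ioo_subset_Icc_self hτ)),
        (hm₄ (Ioo_subset_Icc_self hτ)).trans (le_max_right _ _)⟩, mem_univ _⟩)
    (by simp [hx, hp]) hst
  simpa using key

end OrbitOn

/-! ### Construction of orbits issuing from a bulge -/

theorem exists_first_zero {f : ℝ → ℝ} {a b : ℝ} (hab : a ≤ b) (hf : ContinuousOn f (Icc a b))
    (ha : f a < 0) (hb : 0 ≤ f b) : ∃ c ∈ Ioc a b, f c = 0 ∧ ∀ t ∈ Ico a c, f t < 0 := by
  have hcpt : IsCompact (Icc a b ∩ f ⁻¹' Ici 0) :=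
    isCompact_Icc.of_isClosed_subset (hf.preimage_isClosed_of_isClosed isClosed_Icc isClosed_Ici)
      inter_subset_left
  have hne : (Icc a b ∩ f ⁻¹' Ici 0).Nonempty := ⟨b, right_mem_Icc.2 hab, hb⟩
  have hmem := hcpt.sInf_mem hne
  set c := sInf (Icc a b ∩ f ⁻¹' Ici 0) with hc
  have hac : a < c := by
    rcases hmem.1.1.lt_or_eq with h | h
    · exact h
    · have := hmem.2
      rw [← h] at this
      exact absurd this (not_le.2 ha)
  have hlt : ∀ t ∈ Ico a c, f t < 0 := by
    intro t ht
    by_contra hcon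
    have : c ≤ t := csInf_le hcpt.bddBelow ⟨⟨ht.1, ht.2.le.trans hmem.1.2⟩, not_lt.1 hcon⟩
    exact absurd ht.2 (not_lt.2 this)
  refine ⟨c, ⟨hac, hmem.1.2⟩, le_antisymm ?_ hmem.2, hlt⟩
  have hcont : ContinuousWithinAt f (Ico a c) c :=
    (hf c hmem.1).mono fun t ht => ⟨ht.1, ht.2.le.trans hmem.1.2⟩
  have : (𝓝[Ico a c] c).NeBot := by
    rw [← mem_closure_iff_nhdsWithin_neBot, closure_Ico hac.ne]; exact right_mem_Icc.2 hac.le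
  exact le_of_tendsto hcont (eventually_mem_nhdsWithin.mono fun t ht => (hlt t ht).le)

namespace IsPotential

variable {u₀ : ℝ} {H K : ℝ → ℝ}

/-- The solution starting at rest from the bulge `x₁`, for the force frozen outside `[y, x₁]`. -/
theorem exists_clamped_orbit (hH : IsPotential u₀ H K) {y x₁ : ℝ} (hy : u₀ < y) (hyx : y < x₁)
    (hx₁ : H x₁ = 1) (hK₁ : 0 < K x₁) :
    ∃ x p q : ℝ → ℝ, x 0 = x₁ ∧ p 0 = 0 ∧ (∀ s, HasDerivAt x (p s) s) ∧
      (∀ s, HasDerivAt p (-(q s * K (max y (min (x s) x₁)))) s) ∧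
      (∀ s, p s ^ 2 + q s ^ 2 = 1) ∧ (∀ s, x s ≤ x₁) ∧ (∀ s, y ≤ x s → q s = H (x s)) ∧
      (|H y| = 1 → H y * K y < 0 → ∀ s, y ≤ x s) := by
  have hsub : Icc y x₁ ⊆ Ioi u₀ := fun u hu => lt_of_lt_of_le hy hu.1
  -- `K` with its argument clamped to `[y, x₁]`: a bounded, globally Lipschitz function on the whole
  -- line, so the modified system has global solutions.
  set κ : ℝ → ℝ := fun u => K (max y (min u x₁)) with hκ
  have hcl : ∀ u, max y (min u x₁) ∈ Icc y x₁ := fun u =>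
    ⟨le_max_left _ _, max_le hyx.le (min_le_right _ _)⟩
  obtain ⟨C, hC⟩ := (hH.locallyLipschitzOn.mono hsub).exists_lipschitzOnWith_of_compact
    isCompact_Icc
  obtain ⟨B, hB⟩ := isCompact_Icc.exists_bound_of_continuousOn (hH.continuousOn_deriv.mono hsub)
  have hκlip : LipschitzWith C κ := by
    have h1 : LipschitzWith 1 (fun u : ℝ => max y (min u x₁)) :=
      (LipschitzWith.id.min_const x₁).const_max y
    have := hC.comp h1.lipschitzOnWith (s := univ) (fun u _ => hcl u)
    simpa [lipschitzOnWith_univ, Function.comp_def] using this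
  have hκcont : Continuous κ := hκlip.continuous
  -- The potential of the modified system: it equals `H` on `[y, x₁]` and continues affinely
  -- outside.
  set G : ℝ → ℝ := fun u => 1 + ∫ t in x₁..u, κ t with hG
  have hGd : ∀ u, HasDerivAt G (κ u) u := fun u =>
    (intervalIntegral.integral_hasDerivAt_right (hκcont.intervalIntegrable _ _)
      (hκcont.stronglyMeasurableAtFilter _ _) hκcont.continuousAt).const_add 1
  have hGin : ∀ u ∈ Icc y x₁, G u = H u := by
    intro u hu
    have hu' : uIcc x₁ u ⊆ Icc y x₁ := by rw [uIcc_of_ge hu.2]; exact Icc_subset_Icc_left hu.1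
    have h1 : ∫ t in x₁..u, κ t = ∫ t in x₁..u, K t :=
      intervalIntegral.integral_congr fun t ht => by
        have := hu' ht
        simp [hκ, min_eq_left this.2, max_eq_right this.1]
    have h2 : ∫ t in x₁..u, K t = H u - H x₁ :=
      intervalIntegral.integral_eq_sub_of_hasDerivAt
        (fun t ht => hH.hasDerivAt t (hsub (hu' ht)))
        ((hH.continuousOn_deriv.mono (hu'.trans hsub)).intervalIntegrable)
    simp [hG, h1, h2, hx₁]
  have hGr : ∀ u, x₁ < u → 1 < G u := by
    intro u hu
    have h1 : ∫ t in x₁..u, κ t = ∫ _ in x₁..u, K x₁ :=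
      intervalIntegral.integral_congr fun t ht => by
        rw [uIcc_of_le hu.le] at ht
        simp [hκ, min_eq_right ht.1, max_eq_right hyx.le]
    have : 0 < (u - x₁) * K x₁ := mul_pos (sub_pos.2 hu) hK₁
    simpa [hG, h1] using this
  have hGl : ∀ u, u < y → G u = H y + (u - y) * K y := by
    intro u hu
    have h1 : ∫ t in y..u, κ t = ∫ _ in y..u, K y :=
      intervalIntegral.integral_congr fun t ht => by
        rw [uIcc_of_ge hu.le] at ht
        simp [hκ, max_eq_left ((min_le_left _ _).trans ht.2)]
    have h2 : G u = G y + ∫ t in y..u, κ t := by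
      simp only [hG]
      rw [add_assoc, intervalIntegral.integral_add_adjacent_intervals] <;>
        exact hκcont.intervalIntegrable _ _
    rw [h2, h1, hGin y (left_mem_Icc.2 hyx.le)]
    simp
  -- The system is solved in the tangent angle: `x' = cos θ`, `θ' = κ(x)`. This field is bounded and
  -- Lipschitz, and the energy law becomes the conservation of `sin θ - G(x)`. Since `G > 1` beyond
  -- `x₁`, the bulge is an upper barrier.
  have hv : LipschitzWith (max (1 * 1) (C * 1)) (fun w : ℝ × ℝ => (Real.cos w.2, κ w.1)) :=
    (Real.lipschitzWith_cos.comp LipschitzWith.prod_snd).prodMk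
      (hκlip.comp LipschitzWith.prod_fst)
  obtain ⟨φ, hφ0, hφ⟩ := exists_global_solution hv (L := (max 1 B).toNNReal) (fun w => by
    rw [Real.coe_toNNReal _ (by positivity), Prod.norm_def]
    exact max_le_max (by simpa using Real.abs_cos_le_one _) (hB _ (hcl _))) (x₁, Real.pi / 2)
  have hx : ∀ s, HasDerivAt (fun s => (φ s).1) (Real.cos (φ s).2) s := fun s => (hφ s).fst
  have hθ : ∀ s, HasDerivAt (fun s => (φ s).2) (κ (φ s).1) s := fun s => (hφ s).snd
  have hE : ∀ s, Real.sin (φ s).2 = G (φ s).1 := by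
    have hd : ∀ s, HasDerivAt (fun s => Real.sin (φ s).2 - G (φ s).1) 0 s := by
      intro s
      have := (hθ s).sin.fun_sub ((hGd _).comp s (hx s))
      simpa [Function.comp_def, mul_comm] using this
    intro s
    have := is_const_of_deriv_eq_zero (fun s => (hd s).differentiableAt) (fun s => (hd s).deriv) s 0
    have h0 : G x₁ = 1 := by simp [hG]
    simp only [hφ0, Real.sin_pi_div_two, h0] at this
    linarith
  have hle : ∀ s, (φ s).1 ≤ x₁ := by
    intro s
    by_contra hcon
    have := hGr _ (not_le.1 hcon)
    rw [← hE] at this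
    exact absurd this (not_lt.2 (Real.sin_le_one _))
  refine ⟨fun s => (φ s).1, fun s => Real.cos (φ s).2, fun s => Real.sin (φ s).2, by simp [hφ0],
    by simp [hφ0], hx, fun s => ?_, fun s => Real.cos_sq_add_sin_sq _, hle,
    fun s hs => (hE s).trans (hGin _ ⟨hs, hle s⟩), fun hy1 hyK s => ?_⟩
  · simpa using (hθ s).cos
  -- Below `y` the affine continuation of `H` leaves `[-1, 1]`, because its slope `K y` is opposite
  -- in sign to `H y = ±1`; but `G(x)` is a sine.
  · by_contra hcon
    have hlt := not_le.1 hcon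
    have h1 := hE s
    rw [hGl _ hlt] at h1
    have h2 := Real.sin_le_one (φ s).2
    have h3 := Real.neg_one_le_sin (φ s).2
    rcases (abs_eq zero_le_one).1 hy1 with h | h <;> rw [h] at h1 hyK <;> nlinarith

end IsPotential

/-- A decreasing motion started at the bulge `x₁` reaches every `y` such that `|H| < 1` on
`[y, x₁)`. -/
theorem exists_time_of_descent {H x p q : ℝ → ℝ} {x₁ y : ℝ} (hyx : y < x₁)
    (hHc : ContinuousOn H (Icc y x₁)) (hH1 : ∀ u ∈ Ico y x₁, |H u| < 1)
    (hx0 : x 0 = x₁) (hx : ∀ s, HasDerivAt x (p s) s) (hp : Continuous p)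
    (hE : ∀ s, p s ^ 2 + q s ^ 2 = 1) (hq : ∀ s, y ≤ x s → q s = H (x s))
    (hneg : ∀ᶠ s in 𝓝[>] 0, p s < 0) :
    ∃ T > 0, x T = y ∧ ∀ s ∈ Ioo 0 T, p s < 0 ∧ y < x s := by
  have hxc : Continuous x := continuous_iff_continuousAt.2 fun s => (hx s).continuousAt
  obtain ⟨δ₁, hδ₁, hδ₁'⟩ := mem_nhdsGT_iff_exists_Ioo_subset.1 hneg
  have h2 : ∀ᶠ s in 𝓝[>] (0 : ℝ), y < x s :=
    nhdsWithin_le_nhds ((hxc.tendsto 0).eventually (lt_mem_nhds (by rw [hx0]; exact hyx)))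
  obtain ⟨δ₂, hδ₂, hδ₂'⟩ := mem_nhdsGT_iff_exists_Ioo_subset.1 h2
  set δ := min δ₁ δ₂ / 2 with hδ
  have hmin : 0 < min δ₁ δ₂ := lt_min hδ₁ hδ₂
  have hδ0 : 0 < δ := half_pos hmin
  have hsmall : ∀ s ∈ Ioc 0 δ, p s < 0 ∧ y < x s := fun s hs =>
    have hs' : s < min δ₁ δ₂ := hs.2.trans_lt (half_lt_self hmin)
    ⟨hδ₁' ⟨hs.1, hs'.trans_le (min_le_left _ _)⟩, hδ₂' ⟨hs.1, hs'.trans_le (min_le_right _ _)⟩⟩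
  have hanti : ∀ T, (∀ s ∈ Ioo 0 T, p s < 0) → StrictAntiOn x (Icc 0 T) := fun T hT =>
    strictAntiOn_of_deriv_neg (convex_Icc _ _) hxc.continuousOn fun s hs => by
      rw [interior_Icc] at hs; rw [(hx s).deriv]; exact hT s hs
  -- Negative exactly while the motion is decreasing and still above `y`; its first zero is the
  -- sought time.
  set e : ℝ → ℝ := fun s => max (p s) (y - x s) with he
  have hec : Continuous e := hp.max (continuous_const.sub hxc)
  have heδ : e δ < 0 := by
    have := hsmall δ ⟨hδ0, le_rfl⟩
    exact max_lt this.1 (by linarith [this.2])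
  obtain ⟨b, hb, heb⟩ : ∃ b ≥ δ, 0 ≤ e b := by
    by_contra! hcon
    have hall : ∀ s ≥ δ, p s < 0 ∧ y < x s := fun s hs =>
      ⟨(le_max_left _ _).trans_lt (hcon s hs),
        by have := (le_max_right _ _).trans_lt (hcon s hs); linarith⟩
    have hall' : ∀ s > 0, p s < 0 := fun s hs => by
      rcases le_total s δ with h | h
      · exact (hsmall s ⟨hs, h⟩).1
      · exact (hall s h).1
    have hxδ : x δ < x₁ := by
      rw [← hx0]
      exact hanti δ (fun s hs => hall' s hs.1) (left_mem_Icc.2 hδ0.le) (right_mem_Icc.2 hδ0.le) hδ0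
    have hyδ : y < x δ := (hall δ le_rfl).2
    have hsubI : Icc y (x δ) ⊆ Icc y x₁ := Icc_subset_Icc_right hxδ.le
    obtain ⟨u, hu, hmax⟩ := isCompact_Icc.exists_isMaxOn (nonempty_Icc.2 hyδ.le)
      ((hHc.mono hsubI).abs)
    have hm1 := hH1 u ⟨hu.1, hu.2.trans_lt hxδ⟩
    -- If the motion decreased forever above `y`, then `|H|` would stay below its maximum `|H u| <
    -- 1`, so `p² ≥ c`; with `|p| ≤ 1` the speed is at least `c`, and `y` would be crossed.
    set c := 1 - |H u| ^ 2
    have hc : 0 < c := by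
      have := abs_nonneg (H u)
      show 0 < 1 - |H u| ^ 2
      nlinarith
    have hpc : ∀ s ≥ δ, p s ≤ -c := by
      intro s hs
      have hxs : x s ≤ x δ :=
        (hanti s (fun t ht => hall' t ht.1)).antitoneOn ⟨hδ0.le, hs⟩
          (right_mem_Icc.2 (hδ0.le.trans hs)) hs
      have h1 : |H (x s)| ≤ |H u| := hmax ⟨(hall s hs).2.le, hxs⟩
      have h2 := hE s
      rw [hq s (hall s hs).2.le, ← sq_abs (H (x s))] at h2
      have h3 := (hall s hs).1
      have h4 := abs_nonneg (H (x s))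
      have h5 : |H (x s)| ^ 2 ≤ |H u| ^ 2 := pow_le_pow_left₀ h4 h1 2
      have h6 : c ≤ p s ^ 2 := by show 1 - |H u| ^ 2 ≤ _; linarith
      have h7 : p s ^ 2 ≤ 1 := by nlinarith [sq_nonneg (|H (x s)|)]
      by_contra hcon
      have : -p s < c := by linarith
      nlinarith
    have hdec : ∀ s ≥ δ, x s ≤ x δ - c * (s - δ) := by
      intro s hs
      have hm : AntitoneOn (fun t => x t + c * t) (Ici δ) := by
        refine antitoneOn_of_deriv_nonpos (convex_Ici δ) (by fun_prop) ?_ ?_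
        · exact fun t _ => (((hx t).add ((hasDerivAt_id t).const_mul c)).differentiableAt
            ).differentiableWithinAt
        · intro t ht
          rw [interior_Ici] at ht
          have := ((hx t).add ((hasDerivAt_id t).const_mul c)).deriv
          change deriv (fun t => x t + c * t) t = _ at this
          rw [this]
          have := hpc t (le_of_lt ht)
          linarith
      have := hm self_mem_Ici hs hs
      simp only at this
      linarith
    have h1 := hdec (δ + (x δ - y) / c) (by have : 0 < (x δ - y) / c := div_pos (by linarith) hc
                                            linarith)
    have h2 := (hall (δ + (x δ - y) / c) (by have : 0 < (x δ - y) / c := div_pos (by linarith) hc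
                                             linarith)).2
    rw [add_sub_cancel_left, mul_div_cancel₀ _ hc.ne'] at h1
    linarith
  obtain ⟨T, hT, heT, hbefore⟩ := exists_first_zero hb hec.continuousOn heδ heb
  have hT0 : 0 < T := hδ0.trans hT.1
  have hon : ∀ s ∈ Ioo 0 T, p s < 0 ∧ y < x s := by
    intro s hs
    rcases le_total s δ with h | h
    · exact hsmall s ⟨hs.1, h⟩
    · have := hbefore s ⟨h, hs.2⟩
      exact ⟨(le_max_left _ _).trans_lt this,
        by have := (le_max_right _ _).trans_lt this; linarith⟩
  refine ⟨T, hT0, ?_, hon⟩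
  have hyT : y ≤ x T := by
    have : y - x T ≤ 0 := (le_max_right _ _).trans heT.le
    linarith
  -- The only other way for `e` to vanish is `p T = 0` above `y`, which the energy identity excludes
  -- because `|H| < 1` there.
  by_contra hne
  have hlt : y < x T := lt_of_le_of_ne hyT (Ne.symm hne)
  have hpT : p T = 0 := by
    rcases max_choice (p T) (y - x T) with h | h
    · exact h.symm.trans heT
    · have : y - x T = 0 := h.symm.trans heT
      linarith
  have hxT : x T < x₁ := by
    rw [← hx0]
    exact hanti T (fun s hs => (hon s hs).1) (left_mem_Icc.2 hT0.le) (right_mem_Icc.2 hT0.le) hT0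
  have h1 := hH1 _ ⟨hyT, hxT⟩
  have h2 := hE T
  rw [hpT, hq T hyT, ← sq_abs (H (x T))] at h2
  nlinarith [abs_nonneg (H (x T))]

theorem HasDerivAt.eventually_neg_right {p : ℝ → ℝ} {p' t : ℝ} (h : HasDerivAt p p' t)
    (hp : p t = 0) (hp' : p' < 0) : ∀ᶠ s in 𝓝[>] t, p s < 0 := by
  have h1 := h.tendsto_slope.mono_left
    (nhdsWithin_mono t (fun s (hs : t < s) => (hs.ne' : s ≠ t)) : 𝓝[>] t ≤ 𝓝[≠] t)
  filter_upwards [h1.eventually (gt_mem_nhds hp'), self_mem_nhdsWithin] with s hs hts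
  rw [slope_def_field, hp, sub_zero] at hs
  exact ((div_neg_iff.1 hs).resolve_left fun h => by
    have : t < s := hts
    linarith [h.2]).1

/-- An orbit starting at rest from the bulge `x₁` and decreasing on `(0, T)`. -/
structure IsBulgeOrbit (u₀ : ℝ) (H K : ℝ → ℝ) (x₁ : ℝ) (S : Set ℝ) (T : ℝ) (x p : ℝ → ℝ) :
    Prop where
  orbit : OrbitOn u₀ H K S x p
  pos : 0 < T
  x_zero : x 0 = x₁
  p_zero : p 0 = 0
  p_neg : ∀ s ∈ Ioo 0 T, p s < 0

/-! ### Orbits from a bulge to a neck, to a given distance, and to the lower end `u₀`. -/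

namespace IsPotential

variable {u₀ : ℝ} {H K : ℝ → ℝ}

/-- If the motion is confined by a neck `x₀`, the orbit is complete and reaches the neck. -/
theorem exists_orbit_to_neck (hH : IsPotential u₀ H K) {x₀ x₁ : ℝ} (h₀ : u₀ < x₀) (h₀₁ : x₀ < x₁)
    (hx₁ : H x₁ = 1) (hK₁ : 0 < K x₁) (hlt : ∀ u ∈ Ioo x₀ x₁, |H u| < 1) (hx₀ : |H x₀| = 1)
    (hK₀ : H x₀ * K x₀ < 0) :
    ∃ (x p : ℝ → ℝ) (T : ℝ), IsBulgeOrbit u₀ H K x₁ univ T x p ∧ x T = x₀ ∧ p T = 0 ∧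
      ∀ s, x s ∈ Icc x₀ x₁ := by
  obtain ⟨x, p, q, hx0, hp0, hx, hp, hE, hle, hq, hge⟩ :=
    hH.exists_clamped_orbit h₀ h₀₁ hx₁ hK₁
  replace hge := hge hx₀ hK₀
  have hq' : ∀ s, q s = H (x s) := fun s => hq s (hge s)
  have hcl : ∀ s, max x₀ (min (x s) x₁) = x s := fun s => by
    rw [min_eq_left (hle s), max_eq_right (hge s)]
  have hp' : ∀ s, HasDerivAt p (-(H (x s) * K (x s))) s := fun s => by
    have := hp s
    rwa [hcl, hq'] at this
  have horb : OrbitOn u₀ H K univ x p :=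
    ⟨fun s _ => h₀.trans_le (hge s), fun s _ => hx s, fun s _ => hp' s, fun s _ => by
      rw [← hq']; exact hE s⟩
  have hxc : Continuous x := continuous_iff_continuousAt.2 fun s => (hx s).continuousAt
  have hpc : Continuous p := continuous_iff_continuousAt.2 fun s => (hp s).continuousAt
  have hneg : ∀ᶠ s in 𝓝[>] 0, p s < 0 := (hp' 0).eventually_neg_right hp0 (by
    rw [hx0, hx₁]; linarith)
  have hcontH : ContinuousOn H (Icc x₀ x₁) :=
    hH.continuousOn.mono fun u hu => lt_of_lt_of_le h₀ hu.1
  obtain ⟨δ₁, hδ₁, hδ₁'⟩ := mem_nhdsGT_iff_exists_Ioo_subset.1 hneg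
  have hδ₁0 : 0 < δ₁ := hδ₁
  -- The velocity cannot stay negative. The motion would descend to a neighbourhood of the neck
  -- where the force exceeds a constant `e > 0`, and from then on `p` would grow at least linearly,
  -- against `|p| ≤ 1`.
  obtain ⟨b, hb, hpb⟩ : ∃ b > 0, 0 ≤ p b := by
    by_contra! hcon
    set e := -(H x₀ * K x₀) / 2 with he
    have he0 : 0 < e := by rw [he]; linarith
    have hforce : ∀ᶠ u in 𝓝 x₀, e < -(H u * K u) := by
      have hc : ContinuousAt (fun u => -(H u * K u)) x₀ :=
        ((hH.continuousOn.mul hH.continuousOn_deriv).neg).continuousAt (Ioi_mem_nhds h₀)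
      exact hc.eventually (lt_mem_nhds (by show e < -(H x₀ * K x₀); rw [he]; linarith))
    obtain ⟨η, hη, hη'⟩ := mem_nhdsGE_iff_exists_Ico_subset.1
      (nhdsWithin_le_nhds (s := Ici x₀) hforce)
    set y := min ((x₀ + η) / 2) ((x₀ + x₁) / 2) with hy
    have hηx : x₀ < η := hη
    have hy0 : x₀ < y := lt_min (by linarith) (by linarith)
    have hy1 : y < x₁ := (min_le_right _ _).trans_lt (by linarith)
    have hyη : y < η := (min_le_left _ _).trans_lt (by linarith)
    obtain ⟨T, hT, hxT, -⟩ := exists_time_of_descent hy1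
      (hcontH.mono (Icc_subset_Icc_left hy0.le))
      (fun u hu => hlt u ⟨hy0.trans_le hu.1, hu.2⟩) hx0 hx hpc hE
      (fun s _ => hq' s) hneg
    have hanti : AntitoneOn x (Ici T) := antitoneOn_of_deriv_nonpos (convex_Ici T)
      hxc.continuousOn (fun s _ => (hx s).differentiableAt.differentiableWithinAt) fun s hs => by
        rw [interior_Ici] at hs
        rw [(hx s).deriv]; exact (hcon s (hT.trans hs)).le
    have hm : MonotoneOn (fun t => p t - e * t) (Ici T) := by
      refine monotoneOn_of_deriv_nonneg (convex_Ici T) (by fun_prop) ?_ ?_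
      · exact fun t _ => ((hp' t).sub ((hasDerivAt_id t).const_mul e)).differentiableAt
          |>.differentiableWithinAt
      · intro t ht
        rw [interior_Ici] at ht
        have h1 := ((hp' t).sub ((hasDerivAt_id t).const_mul e)).deriv
        change deriv (fun t => p t - e * t) t = _ at h1
        rw [h1]
        have h2 : x t ≤ y := by rw [← hxT]; exact hanti self_mem_Ici (le_of_lt (show T < t from ht)) (le_of_lt ht)
        have h3 : e < -(H (x t) * K (x t)) := hη' ⟨hge t, h2.trans_lt hyη⟩
        linarith
    have h1 := hm self_mem_Ici (show T + 1 / e ∈ Ici T by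
      have : 0 < 1 / e := by positivity
      simp only [mem_Ici]; linarith) (by
        have : 0 < 1 / e := by positivity
        linarith)
    simp only at h1
    have h2 := hcon (T + 1 / e) (by have : 0 < 1 / e := by positivity
                                    linarith)
    have h3 := (abs_le.1 (horb.abs_p_le (mem_univ T))).1
    have h4 : e * (T + 1 / e) = e * T + 1 := by field_simp
    linarith
  set δ := min (δ₁ / 2) (b / 2) with hδ
  have hδ0 : 0 < δ := lt_min (by linarith) (by linarith)
  have hδb : δ ≤ b := (min_le_right _ _).trans (by linarith)
  have hδδ : δ < δ₁ := (min_le_left _ _).trans_lt (by linarith)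
  obtain ⟨T, hT, hpT, hbefore⟩ := exists_first_zero hδb hpc.continuousOn (hδ₁' ⟨hδ0, hδδ⟩) hpb
  have hT0 : 0 < T := hδ0.trans hT.1
  have hon : ∀ s ∈ Ioo 0 T, p s < 0 := by
    intro s hs
    rcases lt_or_ge s δ with h | h
    · exact hδ₁' ⟨hs.1, h.trans hδδ⟩
    · exact hbefore s ⟨h, hs.2⟩
  refine ⟨x, p, T, ⟨horb, hT0, hx0, hp0, hon⟩, ?_, hpT, fun s => ⟨hge s, hle s⟩⟩
  have hxT : x T < x₁ := by
    rw [← hx0]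
    exact (strictAntiOn_of_deriv_neg (convex_Icc 0 T) hxc.continuousOn fun s hs => by
      rw [interior_Icc] at hs; rw [(hx s).deriv]; exact hon s hs)
      (left_mem_Icc.2 hT0.le) (right_mem_Icc.2 hT0.le) hT0
  by_contra hne
  have h1 := hlt _ ⟨lt_of_le_of_ne (hge T) (Ne.symm hne), hxT⟩
  have h2 := horb.energy T (mem_univ _)
  rw [hpT, ← sq_abs (H (x T))] at h2
  nlinarith [abs_nonneg (H (x T))]

/-- The piece of the orbit lying over `(y, x₁]`, when `|H| < 1` on `[y, x₁)`. -/
theorem exists_orbit_to (hH : IsPotential u₀ H K) {y x₁ : ℝ} (h₀ : u₀ < y) (h₁ : y < x₁)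
    (hx₁ : H x₁ = 1) (hK₁ : 0 < K x₁) (hlt : ∀ u ∈ Ico y x₁, |H u| < 1) :
    ∃ (x p : ℝ → ℝ) (T : ℝ), IsBulgeOrbit u₀ H K x₁ (Ioo (-T) T) T x p ∧ x T = y ∧
      (∀ s ∈ Ioo (-T) T, y < x s) ∧ Continuous x := by
  obtain ⟨x, p, q, hx0, hp0, hx, hp, hE, hle, hq, -⟩ :=
    hH.exists_clamped_orbit h₀ h₁ hx₁ hK₁
  have hcontH : ContinuousOn H (Icc y x₁) :=
    hH.continuousOn.mono fun u hu => lt_of_lt_of_le h₀ hu.1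
  have hq0 : q 0 = 1 := by rw [hq 0 (by rw [hx0]; exact h₁.le), hx0, hx₁]
  -- Stated for an arbitrary solution, since it is applied both to the solution and to its time
  -- reversal.
  have descent : ∀ x p q : ℝ → ℝ, x 0 = x₁ → p 0 = 0 → q 0 = 1 → (∀ s, HasDerivAt x (p s) s) →
      (∀ s, HasDerivAt p (-(q s * K (max y (min (x s) x₁)))) s) →
      (∀ s, p s ^ 2 + q s ^ 2 = 1) → (∀ s, y ≤ x s → q s = H (x s)) →
      ∃ T > 0, x T = y ∧ ∀ s ∈ Ioo 0 T, p s < 0 ∧ y < x s := by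
    intro x p q hx0 hp0 hq0 hx hp hE hq
    refine exists_time_of_descent h₁ hcontH hlt hx0 hx
      (continuous_iff_continuousAt.2 fun s => (hp s).continuousAt) hE hq
      ((hp 0).eventually_neg_right hp0 ?_)
    rw [hx0, hq0, min_self, max_eq_right h₁.le]; linarith
  have main : ∀ (x p q : ℝ → ℝ) (T T' : ℝ), 0 < T → T ≤ T' → x 0 = x₁ → p 0 = 0 →
      (∀ s, HasDerivAt x (p s) s) → (∀ s, HasDerivAt p (-(q s * K (max y (min (x s) x₁)))) s) →
      (∀ s, p s ^ 2 + q s ^ 2 = 1) → (∀ s, x s ≤ x₁) → (∀ s, y ≤ x s → q s = H (x s)) →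
      (∀ s ∈ Ioo 0 T, p s < 0 ∧ y < x s) → (∀ s ∈ Ioo 0 T', y < x (-s)) →
      IsBulgeOrbit u₀ H K x₁ (Ioo (-T) T) T x p ∧ ∀ s ∈ Ioo (-T) T, y < x s := by
    intro x p q T T' hT hTT hx0 hp0 hx hp hE hle hq hon hon'
    have hgt : ∀ s ∈ Ioo (-T) T, y < x s := by
      intro s hs
      rcases lt_trichotomy s 0 with h | h | h
      · simpa using hon' (-s) ⟨by linarith, by linarith [hs.1]⟩
      · rw [h, hx0]; exact h₁
      · exact (hon s ⟨h, hs.2⟩).2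
    refine ⟨⟨⟨fun s hs => h₀.trans (hgt s hs), fun s _ => hx s, fun s hs => ?_, fun s hs => ?_⟩,
      hT, hx0, hp0, fun s hs => (hon s hs).1⟩, hgt⟩
    · have := hp s
      rwa [min_eq_left (hle s), max_eq_right (hgt s hs).le, hq s (hgt s hs).le] at this
    · rw [← hq s (hgt s hs).le]; exact hE s
  have hxn : ∀ s, HasDerivAt (fun s => x (-s)) (-p (-s)) s := fun s => by
    simpa using (hx (0 - s)).comp_const_sub 0 s
  have hpn : ∀ s, HasDerivAt (fun s => -p (-s))
      (-(q (-s) * K (max y (min (x (-s)) x₁)))) s := fun s => by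
    simpa using ((hp (0 - s)).comp_const_sub 0 s).fun_neg
  have hEn : ∀ s, (-p (-s)) ^ 2 + q (-s) ^ 2 = 1 := fun s => by simpa using hE (-s)
  have hxc : Continuous x := continuous_iff_continuousAt.2 fun s => (hx s).continuousAt
  obtain ⟨T, hT, hxT, hon⟩ := descent x p q hx0 hp0 hq0 hx hp hE hq
  obtain ⟨T', hT', hxT', hon'⟩ := descent (fun s => x (-s)) (fun s => -p (-s)) (fun s => q (-s))
    (by simpa using hx0) (by simpa using hp0) (by simpa using hq0) hxn hpn hEn
    (fun s hs => hq _ hs)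
  -- The forward and backward arrival times agree by symmetry, but this is not needed: the solution
  -- or its reversal is kept, whichever arrives first in forward time.
  rcases le_total T T' with h | h
  · obtain ⟨h1, h2⟩ := main x p q T T' hT h hx0 hp0 hx hp hE hle hq hon fun s hs => (hon' s hs).2
    exact ⟨x, p, T, h1, hxT, h2, hxc⟩
  · obtain ⟨h1, h2⟩ := main (fun s => x (-s)) (fun s => -p (-s)) (fun s => q (-s)) T' T hT' h
      (by simpa using hx0) (by simpa using hp0) hxn hpn hEn (fun s => hle _) (fun s hs => hq _ hs)
      hon' fun s hs => by simpa using (hon s hs).2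
    exact ⟨_, _, T', h1, hxT', h2, by fun_prop⟩

end IsPotential

theorem OrbitOn.abs_lt_one {u₀ : ℝ} {H K : ℝ → ℝ} {S : Set ℝ} {x p : ℝ → ℝ}
    (h : OrbitOn u₀ H K S x p) {s : ℝ} (hs : s ∈ S) (hp : p s ≠ 0) : |H (x s)| < 1 := by
  have h1 := h.energy s hs
  have h2 : 0 < p s ^ 2 := by positivity
  rw [← sq_lt_one_iff₀ (abs_nonneg _), sq_abs]
  linarith

theorem OrbitOn.eq_neg_sqrt {u₀ : ℝ} {H K : ℝ → ℝ} {S : Set ℝ} {x p : ℝ → ℝ}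
    (h : OrbitOn u₀ H K S x p) {s : ℝ} (hs : s ∈ S) (hp : p s ≤ 0) :
    p s = -√(1 - H (x s) ^ 2) := by
  rw [← h.energy s hs, add_sub_cancel_right, Real.sqrt_sq_eq_abs, abs_of_nonpos hp, neg_neg]

/-- Along a decreasing piece of orbit, `arcsin H` has derivative `-K`; a lower bound for `|K|`
bounds the duration. -/
theorem OrbitOn.duration_le {u₀ : ℝ} {H K : ℝ → ℝ} (hH : IsPotential u₀ H K) {x p : ℝ → ℝ}
    {a b κ : ℝ} (hab : a < b) (h : OrbitOn u₀ H K (Ioo a b) x p) (hp : ∀ s ∈ Ioo a b, p s < 0)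
    (hκ : ∀ s ∈ Ioo a b, κ ≤ |K (x s)|) : κ * (b - a) ≤ Real.pi := by
  have hd : ∀ s ∈ Ioo a b, HasDerivAt (fun s => Real.arcsin (H (x s))) (-K (x s)) s := by
    intro s hs
    have h1 := abs_lt.1 (h.abs_lt_one hs (hp s hs).ne)
    have h2 := (Real.hasDerivAt_arcsin h1.1.ne' h1.2.ne).comp s
      ((hH.hasDerivAt _ (h.lt s hs)).comp s (h.hasDerivAt_x s hs))
    have h3 := h.eq_neg_sqrt hs (hp s hs).le
    have h4 : √(1 - H (x s) ^ 2) ≠ 0 := fun h0 => by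
      rw [h0] at h3; have := hp s hs; linarith
    have h5 : -K (x s) = 1 / √(1 - H (x s) ^ 2) * (K (x s) * p s) := by
      rw [h3]
      field_simp
    rw [h5]
    exact h2
  -- The mean value theorem is applied on compact subintervals, `arcsin ∘ H ∘ x` being controlled
  -- only on the open interval; the bound then passes to the limit.
  have key : ∀ c d, a < c → c < d → d < b → κ * (d - c) ≤ Real.pi := by
    intro c d hc hcd hdb
    have hsub : Icc c d ⊆ Ioo a b := fun s hs => ⟨hc.trans_le hs.1, hs.2.trans_lt hdb⟩
    obtain ⟨ξ, hξ, hξ'⟩ := exists_hasDerivAt_eq_slope (fun s => Real.arcsin (H (x s)))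
      (fun s => -K (x s)) hcd
      (fun s hs => (hd s (hsub hs)).continuousAt.continuousWithinAt)
      (fun s hs => hd s (hsub (Ioo_subset_Icc_self hs)))
    have h1 := hκ ξ (hsub (Ioo_subset_Icc_self hξ))
    have h2 := Real.arcsin_le_pi_div_two (H (x d))
    have h3 := Real.neg_pi_div_two_le_arcsin (H (x c))
    have h4 := Real.arcsin_le_pi_div_two (H (x c))
    have h5 := Real.neg_pi_div_two_le_arcsin (H (x d))
    have hdc : 0 < d - c := sub_pos.2 hcd
    rw [eq_div_iff hdc.ne'] at hξ'
    calc κ * (d - c) ≤ |K (x ξ)| * (d - c) := by gcongr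
      _ = |-K (x ξ) * (d - c)| := by rw [abs_mul, abs_neg, abs_of_pos hdc]
      _ ≤ Real.pi := by rw [hξ', abs_le]; constructor <;> linarith
  refine le_of_tendsto (f := fun ε => κ * ((b - ε) - (a + ε))) (x := 𝓝[>] 0) ?_ ?_
  · have : Continuous fun ε : ℝ => κ * ((b - ε) - (a + ε)) := by fun_prop
    simpa using (this.tendsto 0).mono_left nhdsWithin_le_nhds
  · filter_upwards [Ioo_mem_nhdsGT (show 0 < (b - a) / 2 by linarith)] with ε hε
    exact key _ _ (by linarith [hε.1]) (by linarith [hε.2]) (by linarith [hε.1])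

namespace IsPotential

variable {u₀ : ℝ} {H K : ℝ → ℝ}

/-- If nothing stops the motion before `u₀`, where `|K|` is bounded below, then `u₀` is reached
in finite time. -/
theorem exists_orbit_to_end (hH : IsPotential u₀ H K) {x₁ : ℝ} (h₁ : u₀ < x₁)
    (hx₁ : H x₁ = 1) (hK₁ : 0 < K x₁) (hlt : ∀ u ∈ Ioo u₀ x₁, |H u| < 1) {κ u₂ : ℝ} (hκ : 0 < κ)
    (hu₂ : u₀ < u₂) (hK : ∀ u ∈ Ioo u₀ u₂, κ ≤ |K u|) :
    ∃ (x p : ℝ → ℝ) (a : ℝ), IsBulgeOrbit u₀ H K x₁ (Ioo (-a) a) a x p ∧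
      ∀ u > u₀, ∃ s ∈ Ioo 0 a, x s < u := by
  have hex : ∀ y : Ioo u₀ x₁, ∃ (w : ℝ → ℝ × ℝ) (T : ℝ),
      IsBulgeOrbit u₀ H K x₁ (Ioo (-T) T) T (fun s => (w s).1) (fun s => (w s).2) ∧
      (w T).1 = y ∧ (∀ s ∈ Ioo (-T) T, y < (w s).1) ∧ Continuous fun s => (w s).1 := by
    intro y
    obtain ⟨x, p, T, h⟩ := hH.exists_orbit_to y.2.1 y.2.2 hx₁ hK₁
      (fun u hu => hlt u ⟨y.2.1.trans_le hu.1, hu.2⟩)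
    exact ⟨fun s => (x s, p s), T, h⟩
  choose w T hw hwT hwgt hwc using hex
  -- The orbits stopped at different heights `y` have the same state at time `0`, so they are
  -- restrictions of one orbit.
  have hagree : ∀ i j s, |s| < T i → |s| < T j → w i s = w j s := by
    intro i j s hi hj
    set m := min (T i) (T j)
    have hm : 0 < m := lt_min (hw i).pos (hw j).pos
    have hi' : Ioo (-m) m ⊆ Ioo (-T i) (T i) :=
      Ioo_subset_Ioo (neg_le_neg (min_le_left _ _)) (min_le_left _ _)
    have hj' : Ioo (-m) m ⊆ Ioo (-T j) (T j) :=
      Ioo_subset_Ioo (neg_le_neg (min_le_right _ _)) (min_le_right _ _)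
    have := OrbitOn.unique hH isOpen_Ioo ordConnected_Ioo ((hw i).orbit.mono hi')
      ((hw j).orbit.mono hj') (t := 0) ⟨by linarith, hm⟩ ((hw i).x_zero.trans (hw j).x_zero.symm)
      ((hw i).p_zero.trans (hw j).p_zero.symm) (abs_lt.1 (lt_min hi hj))
    exact Prod.ext this.1 this.2
  obtain ⟨ψ, hψ⟩ := exists_glue w T hagree
  have hanti : ∀ i, StrictAntiOn (fun s => (w i s).1) (Icc 0 (T i)) := fun i =>
    strictAntiOn_of_deriv_neg (convex_Icc _ _) (hwc i).continuousOn fun s hs => by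
      rw [interior_Icc] at hs
      rw [((hw i).orbit.hasDerivAt_x s ⟨by linarith [hs.1, (hw i).pos], hs.2⟩).deriv]
      exact (hw i).p_neg s hs
  obtain ⟨y₁, hy₁, hy₁'⟩ : ∃ y, u₀ < y ∧ y < min u₂ x₁ := exists_between (lt_min hu₂ h₁)
  set i₁ : Ioo u₀ x₁ := ⟨y₁, hy₁, hy₁'.trans_le (min_le_right _ _)⟩
  -- The arrival times are uniformly bounded: after the height `y₁ < u₂` has been passed, `|K| ≥ κ`
  -- and `OrbitOn.duration_le` leaves at most `π / κ`.
  have hbound : ∀ i, T i ≤ T i₁ + Real.pi / κ := by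
    intro i
    have hπ : 0 < Real.pi / κ := div_pos Real.pi_pos hκ
    rcases le_or_gt (T i) (T i₁) with h | h
    · linarith
    -- The two orbits are only known to agree before `T i₁`, so the common position at that time is
    -- obtained as a limit.
    · have heq : (w i (T i₁)).1 = y₁ := by
        have hcont : ContinuousWithinAt (fun s => (w i s).1) (Ioo 0 (T i₁)) (T i₁) :=
          (hwc i).continuousAt.continuousWithinAt
        have hcont' : ContinuousWithinAt (fun s => (w i₁ s).1) (Ioo 0 (T i₁)) (T i₁) :=
          (hwc i₁).continuousAt.continuousWithinAt
        have hne : (𝓝[Ioo 0 (T i₁)] (T i₁)).NeBot := by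
          rw [← mem_closure_iff_nhdsWithin_neBot, closure_Ioo (hw i₁).pos.ne]
          exact right_mem_Icc.2 (hw i₁).pos.le
        have hlim := hcont'.tendsto
        rw [show (w i₁ (T i₁)).1 = y₁ from hwT i₁] at hlim
        refine tendsto_nhds_unique_of_eventuallyEq hcont hlim ?_
        filter_upwards [self_mem_nhdsWithin] with s hs
        rw [hagree i i₁ s (by rw [abs_of_pos hs.1]; exact hs.2.trans h)
          (by rw [abs_of_pos hs.1]; exact hs.2)]
      have hpos := (hw i₁).pos
      have := OrbitOn.duration_le hH h (κ := κ)
        ((hw i).orbit.mono (Ioo_subset_Ioo_left (by linarith)))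
        (fun s hs => (hw i).p_neg s ⟨hpos.trans hs.1, hs.2⟩) (fun s hs => by
          refine hK _ ⟨(hw i).orbit.lt s ⟨by linarith [hs.1], hs.2⟩, ?_⟩
          refine lt_of_lt_of_le ?_ (hy₁'.le.trans (min_le_left _ _))
          rw [← heq]
          exact hanti i ⟨hpos.le, h.le⟩ ⟨(hpos.trans hs.1).le, hs.2.le⟩ hs.1)
      have h2 : T i - T i₁ ≤ Real.pi / κ := by
        rw [le_div_iff₀ hκ]; linarith
      linarith
  have hbdd : BddAbove (range T) := ⟨_, by rintro _ ⟨i, rfl⟩; exact hbound i⟩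
  set a := sSup (range T) with ha
  have hTa : ∀ i, T i ≤ a := fun i => le_csSup hbdd ⟨i, rfl⟩
  have ha0 : 0 < a := (hw i₁).pos.trans_le (hTa i₁)
  have hcover : ∀ s ∈ Ioo (-a) a, ∃ i, |s| < T i := by
    intro s hs
    obtain ⟨_, ⟨i, rfl⟩, hi⟩ := exists_lt_of_lt_csSup ⟨_, mem_range_self i₁⟩ (abs_lt.2 hs)
    exact ⟨i, hi⟩
  have hev : ∀ i s, |s| < T i → ψ =ᶠ[𝓝 s] w i := fun i s hs => by
    filter_upwards [(continuous_abs.tendsto s).eventually_lt_const hs] with t ht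
    exact hψ i t ht
  have h0 : |(0 : ℝ)| < T i₁ := by simpa using (hw i₁).pos
  refine ⟨fun s => (ψ s).1, fun s => (ψ s).2, a, ⟨⟨fun s hs => ?_, fun s hs => ?_, fun s hs => ?_,
    fun s hs => ?_⟩, ha0, ?_, ?_, fun s hs => ?_⟩, fun u hu => ?_⟩
  · obtain ⟨i, hi⟩ := hcover s hs
    simp only [hψ i s hi]
    exact (hw i).orbit.lt s (abs_lt.1 hi)
  · obtain ⟨i, hi⟩ := hcover s hs
    simp only [hψ i s hi]
    exact ((hw i).orbit.hasDerivAt_x s (abs_lt.1 hi)).congr_of_eventuallyEq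
      ((hev i s hi).fun_comp Prod.fst)
  · obtain ⟨i, hi⟩ := hcover s hs
    simp only [hψ i s hi]
    exact ((hw i).orbit.hasDerivAt_p s (abs_lt.1 hi)).congr_of_eventuallyEq
      ((hev i s hi).fun_comp Prod.snd)
  · obtain ⟨i, hi⟩ := hcover s hs
    simp only [hψ i s hi]
    exact (hw i).orbit.energy s (abs_lt.1 hi)
  · simp only [hψ i₁ 0 h0]; exact (hw i₁).x_zero
  · simp only [hψ i₁ 0 h0]; exact (hw i₁).p_zero
  · obtain ⟨i, hi⟩ := hcover s ⟨by linarith [hs.1], hs.2⟩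
    simp only [hψ i s hi]
    exact (hw i).p_neg s ⟨hs.1, (le_abs_self s).trans_lt hi⟩
  · obtain ⟨y, hy, hy'⟩ := exists_between (lt_min hu h₁)
    set i : Ioo u₀ x₁ := ⟨y, hy, hy'.trans_le (min_le_right _ _)⟩
    have hev1 : ∀ᶠ s in 𝓝[<] (T i), (w i s).1 < u :=
      nhdsWithin_le_nhds (((hwc i).tendsto (T i)).eventually
        (gt_mem_nhds (by rw [hwT]; exact hy'.trans_le (min_le_left _ _))))
    obtain ⟨s, hs, hs'⟩ := (hev1.and (Ioo_mem_nhdsLT (hw i).pos)).exists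
    refine ⟨s, ⟨hs'.1, hs'.2.trans_le (hTa i)⟩, ?_⟩
    simp only [hψ i s (by rw [abs_of_pos hs'.1]; exact hs'.2)]
    exact hs

end IsPotential

namespace IsBulgeOrbit

variable {u₀ : ℝ} {H K : ℝ → ℝ} {x₁ T : ℝ} {S : Set ℝ} {x p : ℝ → ℝ}

/-- Time reversal about a moment of rest gives an orbit with the same state there, so uniqueness
makes the motion symmetric. -/
theorem even (h : IsBulgeOrbit u₀ H K x₁ S T x p) (hH : IsPotential u₀ H K) (hS : IsOpen S)
    (hc : S.OrdConnected) (h0 : (0 : ℝ) ∈ S) (hsymm : ∀ s ∈ S, -s ∈ S) {s : ℝ} (hs : s ∈ S) :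
    x (-s) = x s ∧ p (-s) = -p s := by
  have hsub : S ⊆ (fun s => 0 - s) ⁻¹' S := fun t ht => by simpa using hsymm t ht
  have := OrbitOn.unique hH hS hc h.orbit ((h.orbit.reflect 0).mono hsub) h0 (by simp)
    (by simp [h.p_zero]) (hsymm s hs)
  simpa using this

theorem strictAntiOn (h : IsBulgeOrbit u₀ H K x₁ S T x p) {b : ℝ} (hb : b ≤ T)
    (hS : Icc 0 b ⊆ S) : StrictAntiOn x (Icc 0 b) :=
  strictAntiOn_of_deriv_neg (convex_Icc _ _) (h.orbit.continuousOn_x.mono hS) fun s hs => by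
    rw [interior_Icc] at hs
    rw [(h.orbit.hasDerivAt_x s (hS (Ioo_subset_Icc_self hs))).deriv]
    exact h.p_neg s ⟨hs.1, hs.2.trans_le hb⟩

end IsBulgeOrbit

theorem OrbitOn.p_eq_or {u₀ : ℝ} {H K : ℝ → ℝ} {S : Set ℝ} {x p : ℝ → ℝ}
    (h : OrbitOn u₀ H K S x p) {s v : ℝ} (hs : s ∈ S) (hv : v ^ 2 + H (x s) ^ 2 = 1) :
    v = p s ∨ v = -p s :=
  sq_eq_sq_iff_eq_or_eq_neg.1 (by linarith [h.energy s hs])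

/-- A complete orbit oscillating between a neck `x₀` and a bulge `x₁`, with half-period `T`. -/
structure IsPeriodicOrbit (u₀ : ℝ) (H K : ℝ → ℝ) (x₀ x₁ T : ℝ) (x p : ℝ → ℝ) : Prop where
  bulge : IsBulgeOrbit u₀ H K x₁ univ T x p
  potential : IsPotential u₀ H K
  x_neck : x T = x₀
  p_neck : p T = 0
  mem_Icc : ∀ s, x s ∈ Icc x₀ x₁

namespace IsPeriodicOrbit

variable {u₀ : ℝ} {H K : ℝ → ℝ} {x₀ x₁ T : ℝ} {x p : ℝ → ℝ}

theorem orbit (h : IsPeriodicOrbit u₀ H K x₀ x₁ T x p) : OrbitOn u₀ H K univ x p :=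
  h.bulge.orbit

theorem hasDerivAt_x (h : IsPeriodicOrbit u₀ H K x₀ x₁ T x p) (s : ℝ) : HasDerivAt x (p s) s :=
  h.orbit.hasDerivAt_x s (mem_univ _)

theorem continuous_x (h : IsPeriodicOrbit u₀ H K x₀ x₁ T x p) : Continuous x :=
  continuous_iff_continuousAt.2 fun s => (h.hasDerivAt_x s).continuousAt

theorem even (h : IsPeriodicOrbit u₀ H K x₀ x₁ T x p) (s : ℝ) : x (-s) = x s ∧ p (-s) = -p s :=
  h.bulge.even h.potential isOpen_univ ordConnected_univ (mem_univ _) (fun _ _ => mem_univ _)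
    (mem_univ s)

/-- The symmetry argument at a rest point, now at the neck; composed with the reflection at the
bulge it gives the period `2 * T`. -/
theorem reflect_neck (h : IsPeriodicOrbit u₀ H K x₀ x₁ T x p) (s : ℝ) :
    x (2 * T - s) = x s ∧ p (2 * T - s) = -p s := by
  have := OrbitOn.unique h.potential isOpen_univ ordConnected_univ h.orbit
    ((h.orbit.reflect (2 * T)).mono (fun _ _ => mem_univ _)) (mem_univ T)
    (by rw [show 2 * T - T = T by ring]) (by
      have e : 2 * T - T = T := by ring
      simp [e, h.p_neck]) (mem_univ (2 * T - s))
  simpa using this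

theorem periodic (h : IsPeriodicOrbit u₀ H K x₀ x₁ T x p) (s : ℝ) :
    x (s + 2 * T) = x s ∧ p (s + 2 * T) = p s := by
  have h1 := h.reflect_neck (-s)
  have h2 := h.even s
  have e : 2 * T - -s = s + 2 * T := by ring
  rw [e] at h1
  rw [h1.1, h1.2, h2.1, h2.2]
  simp

/-- The intermediate value theorem gives the position, energy gives the velocity up to sign, and the
reflection at the bulge changes the sign. Hence any orbit meeting `[x₀, x₁]` is a time shift of this
one. -/
theorem exists_state (h : IsPeriodicOrbit u₀ H K x₀ x₁ T x p) {u v : ℝ} (hu : u ∈ Icc x₀ x₁)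
    (hv : v ^ 2 + H u ^ 2 = 1) : ∃ s, x s = u ∧ p s = v := by
  have hIVT := intermediate_value_Icc' h.bulge.pos.le h.continuous_x.continuousOn
  rw [h.x_neck, h.bulge.x_zero] at hIVT
  obtain ⟨s, -, hs⟩ := hIVT hu
  rcases h.orbit.p_eq_or (mem_univ s) (v := v) (by rw [hs]; exact hv) with h1 | h1
  · exact ⟨s, hs, h1.symm⟩
  · exact ⟨-s, (h.even s).1.trans hs, (h.even s).2.trans h1.symm⟩

theorem exists_shift (h : IsPeriodicOrbit u₀ H K x₀ x₁ T x p) {S : Set ℝ} (hS : IsOpen S)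
    (hc : S.OrdConnected) {y r : ℝ → ℝ} (h' : OrbitOn u₀ H K S y r) {t : ℝ} (ht : t ∈ S)
    (hyt : y t ∈ Icc x₀ x₁) : ∃ c, ∀ s ∈ S, y s = x (s + c) := by
  obtain ⟨s₁, hs₁, hs₁'⟩ := h.exists_state hyt (h'.energy t ht)
  refine ⟨s₁ - t, fun s hs => (OrbitOn.unique h.potential hS hc h'
    ((h.orbit.comp_add (s₁ - t)).mono fun _ _ => mem_univ _) ht ?_ ?_ hs).1⟩ <;> simp [hs₁, hs₁']

end IsPeriodicOrbit

/-- An orbit on `(-a, a)` issuing from a bulge `x₁` and converging to `u₀` at both ends. -/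
structure IsTerminatingOrbit (u₀ : ℝ) (H K : ℝ → ℝ) (x₁ a : ℝ) (x p : ℝ → ℝ) : Prop where
  bulge : IsBulgeOrbit u₀ H K x₁ (Ioo (-a) a) a x p
  potential : IsPotential u₀ H K
  reaches : ∀ u > u₀, ∃ s ∈ Ioo 0 a, x s < u

namespace IsTerminatingOrbit

variable {u₀ : ℝ} {H K : ℝ → ℝ} {x₁ a : ℝ} {x p : ℝ → ℝ}

theorem orbit (h : IsTerminatingOrbit u₀ H K x₁ a x p) : OrbitOn u₀ H K (Ioo (-a) a) x p :=
  h.bulge.orbit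

theorem pos (h : IsTerminatingOrbit u₀ H K x₁ a x p) : 0 < a := h.bulge.pos

theorem even (h : IsTerminatingOrbit u₀ H K x₁ a x p) {s : ℝ} (hs : s ∈ Ioo (-a) a) :
    x (-s) = x s ∧ p (-s) = -p s :=
  h.bulge.even h.potential isOpen_Ioo ordConnected_Ioo ⟨by linarith [h.pos], h.pos⟩
    (fun s hs => ⟨by linarith [hs.2], by linarith [hs.1]⟩) hs

theorem strictAntiOn (h : IsTerminatingOrbit u₀ H K x₁ a x p) : StrictAntiOn x (Ico 0 a) := by
  intro s hs t ht hst
  exact h.bulge.strictAntiOn ht.2.le (fun r hr => ⟨by linarith [hr.1, h.pos], hr.2.trans_lt ht.2⟩)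
    ⟨hs.1, hst.le⟩ ⟨ht.1, le_rfl⟩ hst

theorem tendsto_right (h : IsTerminatingOrbit u₀ H K x₁ a x p) :
    Tendsto x (𝓝[<] a) (𝓝[>] u₀) := by
  refine tendsto_nhdsWithin_iff.2 ⟨tendsto_order.2 ⟨fun u hu => ?_, fun u hu => ?_⟩, ?_⟩
  · filter_upwards [Ioo_mem_nhdsLT h.pos] with s hs
    exact hu.trans (h.orbit.lt s ⟨by linarith [hs.1, h.pos], hs.2⟩)
  · obtain ⟨t, ht, htu⟩ := h.reaches u hu
    filter_upwards [Ioo_mem_nhdsLT ht.2] with s hs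
    exact (h.strictAntiOn ⟨ht.1.le, ht.2⟩ ⟨(ht.1.trans hs.1).le, hs.2⟩ hs.1).trans htu
  · filter_upwards [Ioo_mem_nhdsLT h.pos] with s hs
    exact h.orbit.lt s ⟨by linarith [hs.1, h.pos], hs.2⟩

theorem tendsto_left (h : IsTerminatingOrbit u₀ H K x₁ a x p) :
    Tendsto x (𝓝[>] (-a)) (𝓝[>] u₀) := by
  have h1 : Tendsto (fun s => x (-s)) (𝓝[>] (-a)) (𝓝[>] u₀) :=
    h.tendsto_right.comp (by simpa using tendsto_neg_nhdsGT_neg (a := a))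
  refine h1.congr' ?_
  filter_upwards [Ioo_mem_nhdsGT (show -a < a by linarith [h.pos])] with s hs
  exact (h.even hs).1

theorem exists_state (h : IsTerminatingOrbit u₀ H K x₁ a x p) {u v : ℝ} (hu : u ∈ Ioc u₀ x₁)
    (hv : v ^ 2 + H u ^ 2 = 1) : ∃ s ∈ Ioo (-a) a, x s = u ∧ p s = v := by
  obtain ⟨t, ht, htu⟩ := h.reaches u hu.1
  have hIVT := intermediate_value_Icc' ht.1.le (h.orbit.continuousOn_x.mono
    (fun s hs => ⟨by linarith [hs.1, h.pos], hs.2.trans_lt ht.2⟩ : Icc 0 t ⊆ Ioo (-a) a))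
  rw [h.bulge.x_zero] at hIVT
  obtain ⟨s, hs, hsu⟩ := hIVT ⟨htu.le, hu.2⟩
  have hs' : s ∈ Ioo (-a) a := ⟨by linarith [hs.1, h.pos], hs.2.trans_lt ht.2⟩
  rcases h.orbit.p_eq_or hs' (v := v) (by rw [hsu]; exact hv) with h1 | h1
  · exact ⟨s, hs', hsu, h1.symm⟩
  · exact ⟨-s, ⟨by linarith [hs'.2], by linarith [hs'.1]⟩, (h.even hs').1.trans hsu,
      (h.even hs').2.trans h1.symm⟩

/-- Beyond the matching of states, the point is that the other orbit cannot outlive `(-a, a)`: at a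
shifted end it would by continuity take the value `u₀`, whereas orbits stay strictly above `u₀`. -/
theorem exists_shift (h : IsTerminatingOrbit u₀ H K x₁ a x p) {S : Set ℝ} (hS : IsOpen S)
    (hc : S.OrdConnected) {y r : ℝ → ℝ} (h' : OrbitOn u₀ H K S y r) {t : ℝ} (ht : t ∈ S)
    (hyt : y t ≤ x₁) : ∃ c, ∀ s ∈ S, s + c ∈ Ioo (-a) a ∧ y s = x (s + c) := by
  obtain ⟨s₁, hs₁, hx₁, hp₁⟩ := h.exists_state ⟨h'.lt t ht, hyt⟩ (h'.energy t ht)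
  set c := s₁ - t with hcdef
  have htc : t + c = s₁ := by rw [hcdef]; ring
  set S' := S ∩ (· + c) ⁻¹' Ioo (-a) a with hS'
  have hS'o : IsOpen S' := hS.inter (isOpen_Ioo.preimage (by fun_prop))
  have hS'c : S'.OrdConnected :=
    hc.inter (ordConnected_Ioo.preimage_mono fun _ _ h => by simpa using h)
  have ht' : t ∈ S' := ⟨ht, by show t + c ∈ Ioo (-a) a; rwa [htc]⟩
  have heq : ∀ s ∈ S', y s = x (s + c) := fun s hs =>
    (OrbitOn.unique h.potential hS'o hS'c (h'.mono inter_subset_left)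
      ((h.orbit.comp_add c).mono inter_subset_right) ht' (by simp [htc, hx₁])
      (by simp [htc, hp₁]) hs).1
  suffices hsub : ∀ s ∈ S, s + c ∈ Ioo (-a) a from
    ⟨c, fun s hs => ⟨hsub s hs, heq s ⟨hs, hsub s hs⟩⟩⟩
  intro s hs
  constructor
  · by_contra hcon
    have hcon := not_lt.1 hcon
    set e := -a - c
    have het : e < t := by show -a - c < t; linarith [hs₁.1]
    have heS : e ∈ S := hc.out hs ht ⟨by show s ≤ -a - c; linarith, het.le⟩
    have h1 : Tendsto y (𝓝[>] e) (𝓝 (y e)) :=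
      (h'.hasDerivAt_x e heS).continuousAt.tendsto.mono_left nhdsWithin_le_nhds
    have h2 : Tendsto (fun s => x (s + c)) (𝓝[>] e) (𝓝 u₀) := by
      refine (tendsto_nhdsWithin_iff.1 h.tendsto_left).1.comp (tendsto_nhdsWithin_iff.2 ⟨?_, ?_⟩)
      · have : Tendsto (fun s : ℝ => s + c) (𝓝 e) (𝓝 (e + c)) :=
          (continuous_id.add continuous_const).tendsto e
        rw [show e + c = -a by show -a - c + c = -a; ring] at this
        exact this.mono_left nhdsWithin_le_nhds
      · filter_upwards [self_mem_nhdsWithin] with s hs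
        have : e < s := hs
        show -a < s + c
        have : -a - c < s := hs
        linarith
    have h3 : y e = u₀ := by
      refine tendsto_nhds_unique_of_eventuallyEq h1 h2 ?_
      filter_upwards [Ioo_mem_nhdsGT het] with w hw
      have hw1 : -a - c < w := hw.1
      exact heq w ⟨hc.out heS ht ⟨hw.1.le, hw.2.le⟩, by show -a < w + c; linarith,
        by show w + c < a; linarith [hw.2, hs₁.2]⟩
    exact (h'.lt e heS).ne' h3
  · by_contra hcon
    have hcon := not_lt.1 hcon
    set e := a - c
    have het : t < e := by show t < a - c; linarith [hs₁.2]
    have heS : e ∈ S := hc.out ht hs ⟨het.le, by show a - c ≤ s; linarith⟩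
    have h1 : Tendsto y (𝓝[<] e) (𝓝 (y e)) :=
      (h'.hasDerivAt_x e heS).continuousAt.tendsto.mono_left nhdsWithin_le_nhds
    have h2 : Tendsto (fun s => x (s + c)) (𝓝[<] e) (𝓝 u₀) := by
      refine (tendsto_nhdsWithin_iff.1 h.tendsto_right).1.comp (tendsto_nhdsWithin_iff.2 ⟨?_, ?_⟩)
      · have : Tendsto (fun s : ℝ => s + c) (𝓝 e) (𝓝 (e + c)) :=
          (continuous_id.add continuous_const).tendsto e
        rw [show e + c = a by show a - c + c = a; ring] at this
        exact this.mono_left nhdsWithin_le_nhds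
      · filter_upwards [self_mem_nhdsWithin] with s hs
        have : s < a - c := hs
        show s + c < a
        linarith
    have h3 : y e = u₀ := by
      refine tendsto_nhds_unique_of_eventuallyEq h1 h2 ?_
      filter_upwards [Ioo_mem_nhdsLT het] with w hw
      have hw1 : w < a - c := hw.2
      exact heq w ⟨hc.out ht heS ⟨hw.1.le, hw.2.le⟩, by show -a < w + c; linarith [hw.1, hs₁.1],
        by show w + c < a; linarith⟩
    exact (h'.lt e heS).ne' h3

end IsTerminatingOrbit

/-! ### The involution `f` -/

namespace IsEllipticWeingartenFunction

variable {g : ℝ → ℝ} {α : ℝ} {b : EReal}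

theorem contDiffAt (hg : IsEllipticWeingartenFunction g α) {t : ℝ} (ht : α < t) :
    ContDiffAt ℝ 1 g t :=
  hg.contDiffOn.contDiffAt (Ici_mem_nhds ht)

theorem deriv_neg' (hg : IsEllipticWeingartenFunction g α) {t : ℝ} (ht : α < t) :
    deriv g t < 0 := by
  rw [← derivWithin_of_mem_nhds (Ici_mem_nhds ht)]
  exact hg.deriv_neg t ht.le

theorem hasStrictDerivAt (hg : IsEllipticWeingartenFunction g α) {t : ℝ} (ht : α < t) :
    HasStrictDerivAt g (deriv g t) t :=
  (hg.contDiffAt ht).hasStrictDerivAt one_ne_zero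

theorem strictAntiOn (hg : IsEllipticWeingartenFunction g α) : StrictAntiOn g (Ici α) :=
  strictAntiOn_of_deriv_neg (convex_Ici α) hg.contDiffOn.continuousOn fun t ht => by
    rw [interior_Ici] at ht
    exact hg.deriv_neg' ht

/-- Strictness comes from one more step of decrease: `b ≤ g (t + 1) < g t`. -/
theorem lt_map (hg : IsEllipticWeingartenFunction g α)
    (hb : Tendsto (fun t : ℝ => (g t : EReal)) atTop (𝓝 b)) {t : ℝ} (ht : α ≤ t) :
    b < (g t : EReal) := by
  have h1 : b ≤ (g (t + 1) : EReal) := by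
    refine le_of_tendsto hb ?_
    filter_upwards [eventually_ge_atTop (t + 1)] with s hs
    have h2 : α ≤ t + 1 := by linarith
    exact EReal.coe_le_coe_iff.2 (hg.strictAntiOn.antitoneOn h2 (h2.trans hs) hs)
  refine h1.trans_lt (EReal.coe_lt_coe_iff.2 (hg.strictAntiOn ht ?_ (by linarith)))
  show α ≤ t + 1
  linarith

theorem lt_center (hg : IsEllipticWeingartenFunction g α)
    (hb : Tendsto (fun t : ℝ => (g t : EReal)) atTop (𝓝 b)) : b < (α : EReal) := by
  simpa [hg.map_umbilical] using hg.lt_map hb le_rfl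

theorem exists_preimage (hg : IsEllipticWeingartenFunction g α)
    (hb : Tendsto (fun t : ℝ => (g t : EReal)) atTop (𝓝 b)) {t : ℝ} (hbt : b < (t : EReal))
    (ht : t ≤ α) : ∃ τ ∈ Ici α, g τ = t := by
  obtain ⟨s, hs, hsα⟩ := ((hb.eventually (gt_mem_nhds hbt)).and (eventually_ge_atTop α)).exists
  have hs' : g s < t := EReal.coe_lt_coe_iff.1 hs
  obtain ⟨τ, hτ, h⟩ := intermediate_value_Icc' hsα
    (hg.contDiffOn.continuousOn.mono Icc_subset_Ici_self) ⟨hs'.le, by rwa [hg.map_umbilical]⟩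
  exact ⟨τ, hτ.1, h⟩

theorem f_of_ge {t : ℝ} (ht : α ≤ t) : weingartenF g α t = g t := if_pos ht

theorem f_center (hg : IsEllipticWeingartenFunction g α) : weingartenF g α α = α := by
  rw [f_of_ge le_rfl, hg.map_umbilical]

theorem f_of_lt (hg : IsEllipticWeingartenFunction g α)
    (hb : Tendsto (fun t : ℝ => (g t : EReal)) atTop (𝓝 b)) {t : ℝ} (hbt : b < (t : EReal))
    (ht : t < α) : α < weingartenF g α t ∧ g (weingartenF g α t) = t := by
  have hex := hg.exists_preimage hb hbt ht.le
  have e : weingartenF g α t = Function.invFunOn g (Ici α) t := if_neg (not_le.2 ht)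
  rw [e]
  have h1 := Function.invFunOn_mem hex
  have h2 := Function.invFunOn_eq hex
  refine ⟨lt_of_le_of_ne h1 fun h => ?_, h2⟩
  rw [← h, hg.map_umbilical] at h2
  exact ht.ne' h2

theorem map_lt (hg : IsEllipticWeingartenFunction g α) {t : ℝ} (ht : α < t) : g t < α := by
  simpa [hg.map_umbilical] using hg.strictAntiOn self_mem_Ici ht.le ht

theorem f_map (hg : IsEllipticWeingartenFunction g α)
    (hb : Tendsto (fun t : ℝ => (g t : EReal)) atTop (𝓝 b)) {t : ℝ} (ht : α ≤ t) :
    weingartenF g α (g t) = t := by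
  rcases ht.eq_or_lt with rfl | ht
  · rw [hg.map_umbilical, hg.f_center]
  · have h1 := hg.f_of_lt hb (hg.lt_map hb ht.le) (hg.map_lt ht)
    exact hg.strictAntiOn.injOn h1.1.le ht.le h1.2

theorem f_lt_of_gt (hg : IsEllipticWeingartenFunction g α) {t : ℝ} (ht : α < t) :
    weingartenF g α t < α := by
  rw [f_of_ge ht.le]; exact hg.map_lt ht

theorem lt_f (hg : IsEllipticWeingartenFunction g α)
    (hb : Tendsto (fun t : ℝ => (g t : EReal)) atTop (𝓝 b)) {t : ℝ} (hbt : b < (t : EReal)) :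
    b < (weingartenF g α t : EReal) := by
  rcases le_or_gt α t with h | h
  · rw [f_of_ge h]; exact hg.lt_map hb h
  · exact (hg.lt_center hb).trans (EReal.coe_lt_coe_iff.2 (hg.f_of_lt hb hbt h).1)

theorem f_f (hg : IsEllipticWeingartenFunction g α)
    (hb : Tendsto (fun t : ℝ => (g t : EReal)) atTop (𝓝 b)) {t : ℝ} (hbt : b < (t : EReal)) :
    weingartenF g α (weingartenF g α t) = t := by
  rcases le_or_gt α t with h | h
  · rw [f_of_ge h]; exact hg.f_map hb h
  · have := hg.f_of_lt hb hbt h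
    rw [f_of_ge this.1.le]; exact this.2

theorem f_strictAntiOn (hg : IsEllipticWeingartenFunction g α)
    (hb : Tendsto (fun t : ℝ => (g t : EReal)) atTop (𝓝 b)) :
    StrictAntiOn (weingartenF g α) {t : ℝ | b < (t : EReal)} := by
  intro s hs t ht hst
  rcases le_or_gt α s with h | h
  · rw [f_of_ge h, f_of_ge (h.trans hst.le)]
    exact hg.strictAntiOn h (h.trans hst.le) hst
  · have h1 := hg.f_of_lt hb hs h
    rcases le_or_gt α t with h' | h'
    · rw [f_of_ge h']
      have := hg.strictAntiOn.antitoneOn self_mem_Ici h' h'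
      rw [hg.map_umbilical] at this
      exact this.trans_lt h1.1
    · have h2 := hg.f_of_lt hb ht h'
      by_contra hcon
      have := hg.strictAntiOn.antitoneOn h1.1.le h2.1.le (not_lt.1 hcon)
      rw [h1.2, h2.2] at this
      linarith

/-- Below `α` this is the inverse function theorem for `g`. The value `α` is excluded because the
one-sided derivatives of `f` there are `g'(α)` and `1 / g'(α)`, which need not agree. -/
theorem f_hasStrictDerivAt (hg : IsEllipticWeingartenFunction g α)
    (hb : Tendsto (fun t : ℝ => (g t : EReal)) atTop (𝓝 b)) {t : ℝ} (hbt : b < (t : EReal))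
    (ht : t ≠ α) : ∃ f', HasStrictDerivAt (weingartenF g α) f' t := by
  rcases ht.lt_or_gt with h | h
  · have h1 := hg.f_of_lt hb hbt h
    have h2 := (hg.hasStrictDerivAt h1.1).to_local_left_inverse (hg.deriv_neg' h1.1).ne
      (g := weingartenF g α) (by
        filter_upwards [Ioi_mem_nhds h1.1] with s hs
        exact hg.f_map hb (le_of_lt hs))
    rw [h1.2] at h2
    exact ⟨_, h2⟩
  · refine ⟨_, (hg.hasStrictDerivAt h).congr_of_eventuallyEq ?_⟩
    filter_upwards [Ioi_mem_nhds h] with s hs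
    exact (f_of_ge (le_of_lt hs)).symm

theorem f_continuousAt (hg : IsEllipticWeingartenFunction g α)
    (hb : Tendsto (fun t : ℝ => (g t : EReal)) atTop (𝓝 b)) {t : ℝ} (hbt : b < (t : EReal))
    (ht : t ≠ α) : ContinuousAt (weingartenF g α) t := by
  obtain ⟨f', hf'⟩ := hg.f_hasStrictDerivAt hb hbt ht
  exact hf'.hasDerivAt.continuousAt

theorem isOpen_domain (b : EReal) : IsOpen {t : ℝ | b < (t : EReal)} :=
  isOpen_Ioi.preimage continuous_coe_real_ereal

/-- Near the umbilical value, `|f t - t|` is at most linear in `|t - α|`. -/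
theorem exists_f_sub_le (hg : IsEllipticWeingartenFunction g α)
    (hb : Tendsto (fun t : ℝ => (g t : EReal)) atTop (𝓝 b)) :
    ∃ C > 0, ∀ᶠ t in 𝓝 α, |weingartenF g α t - t| ≤ C * |t - α| := by
  set d := derivWithin g (Ici α) α with hd
  have hd0 : d < 0 := hg.deriv_neg α self_mem_Ici
  have hder : HasDerivWithinAt g d (Ici α) α :=
    ((hg.contDiffOn.differentiableOn one_ne_zero) α self_mem_Ici).hasDerivWithinAt
  have hslope : Tendsto (slope g α) (𝓝[>] α) (𝓝 d) := by
    exact (hasDerivWithinAt_iff_tendsto_slope' self_notMem_Ioi).1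
      (hasDerivWithinAt_Ioi_iff_Ici.2 hder)
  -- Slopes are pinched between `2d` and `d/2`: the first bounds `f` above `α`, and the second, read
  -- through the inverse, bounds it below `α`.
  have hev : ∀ᶠ τ in 𝓝[>] α, 2 * d < slope g α τ ∧ slope g α τ < d / 2 :=
    (hslope.eventually (lt_mem_nhds (by linarith))).and
      (hslope.eventually (gt_mem_nhds (by linarith)))
  obtain ⟨β, hβ, hβ'⟩ := mem_nhdsGT_iff_exists_Ioo_subset.1 hev
  have hβα : α < β := hβ
  have hbd : ∀ τ ∈ Ioo α β, 2 * d * (τ - α) < g τ - α ∧ g τ - α < d / 2 * (τ - α) := by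
    intro τ hτ
    have h := hβ' hτ
    have hpos : 0 < τ - α := sub_pos.2 hτ.1
    simp only [mem_ofPred_eq, slope_def_field, hg.map_umbilical] at h
    rw [lt_div_iff₀ hpos, div_lt_iff₀ hpos] at h
    exact h
  have hC1 : 0 < 1 - 2 * d := by linarith
  have hC2 : 0 < 1 - 2 / d := by
    have : 2 / d < 0 := div_neg_of_pos_of_neg two_pos hd0
    linarith
  refine ⟨max (1 - 2 * d) (1 - 2 / d), lt_max_of_lt_left hC1, ?_⟩
  -- For `t` above this value, `f t` does not exceed `(α + β) / 2`, so it stays in the range where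
  -- the slope bounds hold.
  have hγ : g ((α + β) / 2) < α := hg.map_lt (by linarith)
  filter_upwards [Ioo_mem_nhds hγ hβα, (isOpen_domain b).mem_nhds (hg.lt_center hb)] with t ht hbt
  rcases lt_trichotomy t α with h | h | h
  · have h1 := hg.f_of_lt hb hbt h
    set τ := weingartenF g α t
    have hτβ : τ < β := by
      by_contra hcon
      have : g τ ≤ g ((α + β) / 2) := hg.strictAntiOn.antitoneOn
        (show α ≤ (α + β) / 2 by linarith) h1.1.le (by linarith)
      rw [h1.2] at this
      linarith [ht.1]
    have h2 := (hbd τ ⟨h1.1, hτβ⟩).2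
    rw [h1.2] at h2
    rw [abs_of_pos (show 0 < τ - t by linarith [h1.1]), abs_of_neg (sub_neg.2 h)]
    have h3 : τ - α ≤ -(2 / d) * -(t - α) := by
      have : (2 / d) * (t - α) ≥ (2 / d) * (d / 2 * (τ - α)) :=
        mul_le_mul_of_nonpos_left h2.le (div_neg_of_pos_of_neg two_pos hd0).le
      have e : (2 / d) * (d / 2 * (τ - α)) = τ - α := by have := hd0.ne; field_simp
      linarith
    calc τ - t = (τ - α) + -(t - α) := by ring
      _ ≤ (1 - 2 / d) * -(t - α) := by linarith
      _ ≤ _ := mul_le_mul_of_nonneg_right (le_max_right _ _) (by linarith)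
  · rw [h, hg.f_center]; simp
  · have h2 := (hbd t ⟨h, ht.2⟩).1
    have h3 := hg.map_lt h
    rw [f_of_ge h.le, abs_of_neg (show g t - t < 0 by linarith), abs_of_pos (sub_pos.2 h)]
    calc -(g t - t) ≤ (1 - 2 * d) * (t - α) := by linarith
      _ ≤ _ := mul_le_mul_of_nonneg_right (le_max_left _ _) (by linarith)

/-! ### Primitives of `1 / (f - id)` -/

theorem f_sub_ne (hg : IsEllipticWeingartenFunction g α)
    (hb : Tendsto (fun t : ℝ => (g t : EReal)) atTop (𝓝 b)) {t : ℝ} (hbt : b < (t : EReal))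
    (ht : t ≠ α) : weingartenF g α t - t ≠ 0 := by
  rcases ht.lt_or_gt with h | h
  · have := (hg.f_of_lt hb hbt h).1
    exact (by linarith : 0 < weingartenF g α t - t).ne'
  · have := hg.f_lt_of_gt h
    exact (by linarith : weingartenF g α t - t < 0).ne

theorem exists_primitive (hg : IsEllipticWeingartenFunction g α)
    (hb : Tendsto (fun t : ℝ => (g t : EReal)) atTop (𝓝 b)) :
    ∃ F, IsWeingartenPrimitive g α b F := by
  classical
  obtain ⟨t₀, ht₀, ht₀'⟩ := EReal.lt_iff_exists_real_btwn.1 (hg.lt_center hb)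
  replace ht₀' : t₀ < α := EReal.coe_lt_coe_iff.1 ht₀'
  set φ : ℝ → ℝ := fun t => 1 / (weingartenF g α t - t) with hφ
  have hcont : ∀ t : ℝ, b < (t : EReal) → t ≠ α → ContinuousAt φ t := fun t hbt ht =>
    continuousAt_const.div ((hg.f_continuousAt hb hbt ht).sub continuousAt_id)
      (hg.f_sub_ne hb hbt ht)
  have hprim : ∀ (J : Set ℝ), IsOpen J → J.OrdConnected → (∀ t ∈ J, b < (t : EReal) ∧ t ≠ α) →
      ∀ c ∈ J, ∀ t ∈ J, HasDerivAt (fun t => ∫ s in c..t, φ s) (φ t) t := by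
    intro J hJ hJc hJs c hc t ht
    have hco : ContinuousOn φ J := fun s hs =>
      (hcont s (hJs s hs).1 (hJs s hs).2).continuousWithinAt
    exact intervalIntegral.integral_hasDerivAt_right
      ((hco.mono (hJc.uIcc_subset hc ht)).intervalIntegrable)
      (hco.stronglyMeasurableAtFilter hJ t ht) (hco.continuousAt (hJ.mem_nhds ht))
  -- The two sides of `α` are independent components, so each gets its own base point.
  refine ⟨fun t => if t < α then ∫ s in t₀..t, φ s else ∫ s in (α + 1)..t, φ s, ?_⟩
  intro t hbt ht
  rcases ht.lt_or_gt with h | h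
  · refine (hprim ({t : ℝ | b < (t : EReal)} ∩ Iio α) ((isOpen_domain b).inter isOpen_Iio)
      (OrdConnected.inter ⟨fun x hx y _ z hz =>
        lt_of_lt_of_le (show b < (x : EReal) from hx) (EReal.coe_le_coe_iff.2 hz.1)⟩
        ordConnected_Iio) (fun s hs => ⟨hs.1, ne_of_lt hs.2⟩) t₀ ⟨ht₀, ht₀'⟩ t
        ⟨hbt, h⟩).congr_of_eventuallyEq ?_
    filter_upwards [Iio_mem_nhds h] with s hs
    exact if_pos hs
  · refine (hprim (Ioi α) isOpen_Ioi ordConnected_Ioi (fun s hs =>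
      ⟨(hg.lt_center hb).trans (EReal.coe_lt_coe_iff.2 hs), ne_of_gt hs⟩) (α + 1)
      (by simp) t h).congr_of_eventuallyEq ?_
    filter_upwards [Ioi_mem_nhds h] with s hs
    exact if_neg (not_lt.2 (le_of_lt hs))

/-- As `|f t - t| ≤ C |t - α|`, the slope of `F` towards `α` is at least that of `-(1/C) log |t -
α|`. This divergence makes `exp F` unbounded on each side, and it is why a parallel curvature
different from `α` never reaches `α`. -/
theorem tendsto_primitive_center (hg : IsEllipticWeingartenFunction g α)
    (hb : Tendsto (fun t : ℝ => (g t : EReal)) atTop (𝓝 b)) {F : ℝ → ℝ}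
    (hF : IsWeingartenPrimitive g α b F) : Tendsto F (𝓝[≠] α) atTop := by
  obtain ⟨C, hC, hev⟩ := hg.exists_f_sub_le hb
  obtain ⟨ε, hε, hball⟩ := Metric.eventually_nhds_iff_ball.1
    (hev.and ((isOpen_domain b).mem_nhds (hg.lt_center hb)))
  -- `Real.log` is the logarithm of the absolute value, so one expression serves both sides of `α`.
  have hFd : ∀ t ∈ Metric.ball α ε, t ≠ α → HasDerivAt (fun t => F t + 1 / C * Real.log (t - α))
      (1 / (weingartenF g α t - t) + 1 / C * (1 / (t - α))) t := fun t htb ht => by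
    have := (((hasDerivAt_id t).sub_const α).log (sub_ne_zero.2 ht)).const_mul (1 / C)
    simpa using (hF t (hball t htb).2 ht).fun_add this
  have hlog : Tendsto (fun t => -(1 / C * Real.log (t - α))) (𝓝[≠] α) atTop := by
    have h1 : Tendsto (fun t : ℝ => t - α) (𝓝[≠] α) (𝓝[≠] 0) := by
      refine tendsto_nhdsWithin_iff.2 ⟨?_, ?_⟩
      · have : Continuous fun t : ℝ => t - α := by fun_prop
        simpa using (this.tendsto α).mono_left nhdsWithin_le_nhds
      · filter_upwards [self_mem_nhdsWithin] with t ht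
        exact sub_ne_zero.2 ht
    have h2 := (Real.tendsto_log_nhdsNE_zero.comp h1).const_mul_atBot (show 0 < 1 / C by positivity)
    exact tendsto_neg_atBot_atTop.comp h2
  have hbr : ∀ t ∈ Metric.ball α ε, t ≠ α → 1 / C * (1 / |t - α|) ≤
      1 / |weingartenF g α t - t| := fun t htb ht => by
    have h1 := (hball t htb).1
    have h2 : 0 < |t - α| := abs_pos.2 (sub_ne_zero.2 ht)
    have h3 : 0 < |weingartenF g α t - t| := abs_pos.2 (hg.f_sub_ne hb (hball t htb).2 ht)
    rw [one_div_mul_one_div]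
    exact one_div_le_one_div_of_le h3 h1
  have hball' : Metric.ball α ε = Ioo (α - ε) (α + ε) := Real.ball_eq_Ioo α ε
  set t₁ := α - ε / 2
  set t₂ := α + ε / 2
  have hsub1 : Ico t₁ α ⊆ Metric.ball α ε := fun t ht => by
    rw [hball']; exact ⟨by have : α - ε / 2 ≤ t := ht.1
                           linarith, by linarith [ht.2]⟩
  have hsub2 : Ioc α t₂ ⊆ Metric.ball α ε := fun t ht => by
    rw [hball']; exact ⟨by linarith [ht.1], by have : t ≤ α + ε / 2 := ht.2
                                               linarith⟩
  have hmono : MonotoneOn (fun t => F t + 1 / C * Real.log (t - α)) (Ico t₁ α) := by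
    refine monotoneOn_of_deriv_nonneg (convex_Ico _ _)
      (fun t ht => (hFd t (hsub1 ht) ht.2.ne).continuousAt.continuousWithinAt)
      (fun t ht => (hFd t (hsub1 (interior_subset ht))
        (interior_subset ht).2.ne).differentiableAt.differentiableWithinAt) fun t ht => ?_
    have ht' := interior_subset ht
    rw [(hFd t (hsub1 ht') ht'.2.ne).deriv]
    have h1 := hbr t (hsub1 ht') ht'.2.ne
    have h2 := (hg.f_of_lt hb (hball t (hsub1 ht')).2 ht'.2).1
    rw [abs_of_neg (sub_neg.2 ht'.2), abs_of_pos (by linarith [ht'.2])] at h1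
    have h3 : 1 / -(t - α) = -(1 / (t - α)) := by rw [div_neg]
    rw [h3] at h1
    linarith
  have hanti : AntitoneOn (fun t => F t + 1 / C * Real.log (t - α)) (Ioc α t₂) := by
    refine antitoneOn_of_deriv_nonpos (convex_Ioc _ _)
      (fun t ht => (hFd t (hsub2 ht) ht.1.ne').continuousAt.continuousWithinAt)
      (fun t ht => (hFd t (hsub2 (interior_subset ht))
        (interior_subset ht).1.ne').differentiableAt.differentiableWithinAt) fun t ht => ?_
    have ht' := interior_subset ht
    rw [(hFd t (hsub2 ht') ht'.1.ne').deriv]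
    have h1 := hbr t (hsub2 ht') ht'.1.ne'
    have h2 := hg.f_lt_of_gt ht'.1
    rw [abs_of_pos (sub_pos.2 ht'.1), abs_of_neg (by linarith [ht'.1])] at h1
    have h3 : 1 / -(weingartenF g α t - t) = -(1 / (weingartenF g α t - t)) := by rw [div_neg]
    rw [h3] at h1
    linarith
  set m := min (F t₁ + 1 / C * Real.log (t₁ - α)) (F t₂ + 1 / C * Real.log (t₂ - α))
  refine tendsto_atTop_mono' _ ?_ (tendsto_atTop_add_const_left _ m hlog)
  have hnear : Ioo t₁ t₂ ∈ 𝓝 α := Ioo_mem_nhds (by show α - ε / 2 < α; linarith)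
    (by show α < α + ε / 2; linarith)
  filter_upwards [nhdsWithin_le_nhds hnear, self_mem_nhdsWithin] with t ht hne
  rcases lt_or_gt_of_ne (show t ≠ α from hne) with h | h
  · have h1 := hmono ⟨le_rfl, ht.1.trans h⟩ ⟨ht.1.le, h⟩ ht.1.le
    have h2 := min_le_left (F t₁ + 1 / C * Real.log (t₁ - α)) (F t₂ + 1 / C * Real.log (t₂ - α))
    simp only at h1
    show m + _ ≤ _
    linarith
  · have h1 := hanti ⟨h, ht.2.le⟩ ⟨h.trans ht.2, le_rfl⟩ ht.2.le
    have h2 := min_le_right (F t₁ + 1 / C * Real.log (t₁ - α)) (F t₂ + 1 / C * Real.log (t₂ - α))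
    simp only at h1
    show m + _ ≤ _
    linarith

end IsEllipticWeingartenFunction

/-! ### The inverse of `exp F` on one side of the umbilical value -/

/-- `Λ : (u₀, ∞) → J` is the inverse of `exp F : J → (u₀, ∞)`. -/
structure IsSideInverse (f : ℝ → ℝ) (J : Set ℝ) (F : ℝ → ℝ) (u₀ : ℝ) (Λ : ℝ → ℝ) : Prop where
  nonneg : 0 ≤ u₀
  mem : ∀ u > u₀, Λ u ∈ J
  exp_apply : ∀ u > u₀, Real.exp (F (Λ u)) = u
  lt_exp : ∀ t ∈ J, u₀ < Real.exp (F t)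
  apply_exp : ∀ t ∈ J, Λ (Real.exp (F t)) = t
  deriv : ∀ u > u₀, HasStrictDerivAt Λ ((f (Λ u) - Λ u) / u) u

namespace IsEllipticWeingartenFunction

variable {g : ℝ → ℝ} {α : ℝ} {b : EReal} {F : ℝ → ℝ}

/-- The image of `J` under `exp F` is an interval, unbounded above by `hup` and without minimum by
`hlow`, hence `(u₀, ∞)` with `u₀` its infimum. The derivative of the inverse is the reciprocal of
`exp F / (f - id)`. -/
theorem exists_sideInverse (hg : IsEllipticWeingartenFunction g α)
    (hb : Tendsto (fun t : ℝ => (g t : EReal)) atTop (𝓝 b))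
    (hF : IsWeingartenPrimitive g α b F) {J : Set ℝ} (hJo : IsOpen J) (hJc : J.OrdConnected)
    (hJ : ∀ t ∈ J, b < (t : EReal) ∧ t ≠ α) (hinj : InjOn F J)
    (hlow : ∀ t ∈ J, ∃ t' ∈ J, F t' < F t) (hup : ∀ N, ∃ t ∈ J, N < F t) :
    ∃ u₀ Λ, IsSideInverse (weingartenF g α) J F u₀ Λ := by
  set A := (fun t => Real.exp (F t)) '' J with hA
  have hFc : ContinuousOn (fun t => Real.exp (F t)) J := fun t ht =>
    (hF t (hJ t ht).1 (hJ t ht).2).continuousAt.rexp.continuousWithinAt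
  have hAc : A.OrdConnected := (hJc.isPreconnected.image _ hFc).ordConnected
  have hbdd : BddBelow A := ⟨0, by rintro _ ⟨t, -, rfl⟩; exact (Real.exp_pos _).le⟩
  obtain ⟨c, hc, -⟩ := hup 0
  have hne : A.Nonempty := ⟨_, mem_image_of_mem _ hc⟩
  have hlt : ∀ t ∈ J, sInf A < Real.exp (F t) := fun t ht => by
    obtain ⟨t', ht', hlt⟩ := hlow t ht
    exact (csInf_le hbdd (mem_image_of_mem _ ht')).trans_lt (Real.exp_lt_exp.2 hlt)
  have hsurj : ∀ u > sInf A, ∃ t ∈ J, Real.exp (F t) = u := by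
    intro u hu
    obtain ⟨a, ha, hau⟩ := exists_lt_of_csInf_lt hne hu
    obtain ⟨t, ht, hut⟩ := hup u
    have h2 : u ≤ Real.exp (F t) := hut.le.trans ((by linarith : F t ≤ F t + 1).trans
      (Real.add_one_le_exp _))
    exact hAc.out ha (mem_image_of_mem _ ht) ⟨hau.le, h2⟩
  have hinj' : InjOn (fun t => Real.exp (F t)) J := fun s hs t ht h =>
    hinj hs ht (Real.exp_injective h)
  have hleft : ∀ t ∈ J, Function.invFunOn (fun t => Real.exp (F t)) J (Real.exp (F t)) = t :=
    fun t ht => hinj'.leftInvOn_invFunOn ht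
  refine ⟨sInf A, Function.invFunOn (fun t => Real.exp (F t)) J, ⟨Real.sInf_nonneg (by
    rintro _ ⟨t, -, rfl⟩; exact (Real.exp_pos _).le), fun u hu => Function.invFunOn_mem (hsurj u hu),
    fun u hu => Function.invFunOn_eq (hsurj u hu), hlt, hleft, fun u hu => ?_⟩⟩
  obtain ⟨t, ht, rfl⟩ := hsurj u hu
  rw [hleft t ht]
  have hev : ∀ᶠ s in 𝓝 t, HasDerivAt (fun t => Real.exp (F t))
      (Real.exp (F s) * (1 / (weingartenF g α s - s))) s := by
    filter_upwards [hJo.mem_nhds ht] with s hs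
    exact (hF s (hJ s hs).1 (hJ s hs).2).exp
  have hcont : ContinuousAt (fun s => Real.exp (F s) * (1 / (weingartenF g α s - s))) t :=
    (hF t (hJ t ht).1 (hJ t ht).2).continuousAt.rexp.mul
      (continuousAt_const.div ((hg.f_continuousAt hb (hJ t ht).1 (hJ t ht).2).sub continuousAt_id)
        (hg.f_sub_ne hb (hJ t ht).1 (hJ t ht).2))
  have hs := hasStrictDerivAt_of_hasDerivAt_of_continuousAt hev hcont
  have hne := hg.f_sub_ne hb (hJ t ht).1 (hJ t ht).2
  have := hs.to_local_left_inverse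
    (mul_ne_zero (Real.exp_pos _).ne' (one_div_ne_zero hne))
    (g := Function.invFunOn (fun t => Real.exp (F t)) J) (by
      filter_upwards [hJo.mem_nhds ht] with s hs using hleft s hs)
  have e : (weingartenF g α t - t) / Real.exp (F t) =
      (Real.exp (F t) * (1 / (weingartenF g α t - t)))⁻¹ := by
    rw [mul_one_div, inv_div]
  rw [e]
  exact this

theorem primitive_strictAntiOn (hg : IsEllipticWeingartenFunction g α)
    (hb : Tendsto (fun t : ℝ => (g t : EReal)) atTop (𝓝 b))
    (hF : IsWeingartenPrimitive g α b F) : StrictAntiOn F (Ioi α) := by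
  have hd : ∀ t ∈ Ioi α, HasDerivAt F (1 / (weingartenF g α t - t)) t := fun t ht =>
    hF t ((hg.lt_center hb).trans (EReal.coe_lt_coe_iff.2 ht)) (ne_of_gt ht)
  refine strictAntiOn_of_deriv_neg (convex_Ioi α)
    (fun t ht => (hd t ht).continuousAt.continuousWithinAt) fun t ht => ?_
  rw [interior_Ioi] at ht
  rw [(hd t ht).deriv]
  have h1 : α < t := ht
  have := hg.f_lt_of_gt h1
  exact one_div_neg.2 (by linarith)

theorem primitive_strictMonoOn (hg : IsEllipticWeingartenFunction g α)
    (hb : Tendsto (fun t : ℝ => (g t : EReal)) atTop (𝓝 b))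
    (hF : IsWeingartenPrimitive g α b F) :
    StrictMonoOn F ({t : ℝ | b < (t : EReal)} ∩ Iio α) := by
  have hd : ∀ t ∈ {t : ℝ | b < (t : EReal)} ∩ Iio α,
      HasDerivAt F (1 / (weingartenF g α t - t)) t := fun t ht => hF t ht.1 (ne_of_lt ht.2)
  have hc : ({t : ℝ | b < (t : EReal)} ∩ Iio α).OrdConnected :=
    OrdConnected.inter ⟨fun x hx y _ z hz =>
      lt_of_lt_of_le (show b < (x : EReal) from hx) (EReal.coe_le_coe_iff.2 hz.1)⟩ ordConnected_Iio
  refine strictMonoOn_of_deriv_pos hc.convex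
    (fun t ht => (hd t ht).continuousAt.continuousWithinAt) fun t ht => ?_
  have ht' := interior_subset ht
  rw [(hd t ht').deriv]
  have h2 : t < α := ht'.2
  have := (hg.f_of_lt hb ht'.1 h2).1
  exact one_div_pos.2 (by linarith)

theorem exists_lt_primitive (hg : IsEllipticWeingartenFunction g α)
    (hb : Tendsto (fun t : ℝ => (g t : EReal)) atTop (𝓝 b))
    (hF : IsWeingartenPrimitive g α b F) {l : Filter ℝ} [l.NeBot] (hl : l ≤ 𝓝[≠] α) {J : Set ℝ}
    (hJ : J ∈ l) (N : ℝ) : ∃ t ∈ J, N < F t := by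
  have := ((hg.tendsto_primitive_center hb hF).mono_left hl).eventually (eventually_gt_atTop N)
  exact ((eventually_mem_set.2 hJ).and this).exists

/-- The branch of the inverse of `exp F` with values above the umbilical value. -/
theorem exists_right_inverse (hg : IsEllipticWeingartenFunction g α)
    (hb : Tendsto (fun t : ℝ => (g t : EReal)) atTop (𝓝 b))
    (hF : IsWeingartenPrimitive g α b F) :
    ∃ u₀ Λ, IsSideInverse (weingartenF g α) (Ioi α) F u₀ Λ := by
  have hanti := hg.primitive_strictAntiOn hb hF
  refine hg.exists_sideInverse hb hF isOpen_Ioi ordConnected_Ioi (fun t ht =>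
    ⟨(hg.lt_center hb).trans (EReal.coe_lt_coe_iff.2 ht), ne_of_gt ht⟩) hanti.injOn
    (fun t ht => ?_) (hg.exists_lt_primitive hb hF (l := 𝓝[>] α)
      (nhdsWithin_mono _ fun t (ht : α < t) => ht.ne') self_mem_nhdsWithin)
  have h1 : α < t := ht
  have h2 : α < t + 1 := by linarith
  exact ⟨t + 1, h2, hanti h1 h2 (by linarith)⟩

/-- The branch of the inverse of `exp F` with values below the umbilical value. -/
theorem exists_left_inverse (hg : IsEllipticWeingartenFunction g α)
    (hb : Tendsto (fun t : ℝ => (g t : EReal)) atTop (𝓝 b))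
    (hF : IsWeingartenPrimitive g α b F) :
    ∃ u₀ Λ, IsSideInverse (weingartenF g α) ({t : ℝ | b < (t : EReal)} ∩ Iio α) F u₀ Λ := by
  have hmono := hg.primitive_strictMonoOn hb hF
  refine hg.exists_sideInverse hb hF ((isOpen_domain b).inter isOpen_Iio)
    (OrdConnected.inter ⟨fun x hx y _ z hz =>
      lt_of_lt_of_le (show b < (x : EReal) from hx) (EReal.coe_le_coe_iff.2 hz.1)⟩ ordConnected_Iio)
    (fun t ht => ⟨ht.1, ne_of_lt ht.2⟩) hmono.injOn (fun t ht => ?_)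
    (hg.exists_lt_primitive hb hF (l := 𝓝[<] α)
      (nhdsWithin_mono _ fun t (ht : t < α) => ht.ne)
      (inter_mem (nhdsWithin_le_nhds ((isOpen_domain b).mem_nhds (hg.lt_center hb)))
        self_mem_nhdsWithin))
  obtain ⟨t', h1, h2⟩ := EReal.lt_iff_exists_real_btwn.1 (show b < (t : EReal) from ht.1)
  have h2 : t' < t := EReal.coe_lt_coe_iff.1 h2
  have hm : t' ∈ {t : ℝ | b < (t : EReal)} ∩ Iio α := ⟨h1, h2.trans ht.2⟩
  exact ⟨t', hm, hmono hm ht h2⟩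

end IsEllipticWeingartenFunction

/-! ### Branches of the profile equation -/

/-- The data describing, up to the sign `σ`, the profile curves whose rotational curvature
`σ M(x)` and profile curvature `σ K(x)` are functions of the distance `x` to the axis. -/
structure IsBranch (g : ℝ → ℝ) (α : ℝ) (b : EReal) (σ u₀ : ℝ) (M K : ℝ → ℝ) : Prop where
  sign : σ = 1 ∨ σ = -1
  nonneg : 0 ≤ u₀
  range : ∀ u > u₀, b < ((σ * M u : ℝ) : EReal)
  relation : ∀ u > u₀, weingartenF g α (σ * M u) = σ * K u
  deriv : ∀ u > u₀, HasDerivAt M ((K u - M u) / u) u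
  locallyLipschitzOn : LocallyLipschitzOn (Ioi u₀) K
  bounded : ∀ u₁ > u₀, ∃ C, ∀ u ≥ u₁, max |M u| |K u| ≤ C
  blow_up : Tendsto (fun u => max |M u| |K u|) (𝓝[>] u₀) atTop
  pinch : u₀ = 0 → Tendsto (fun u => |M u|) (𝓝[>] u₀) atTop
  atTop : Tendsto (fun u => u * M u) atTop atTop

/-- A branch along which the profile curve has horizontal tangent somewhere. -/
structure IsNodalBranch (g : ℝ → ℝ) (α : ℝ) (b : EReal) (σ u₀ : ℝ) (M K : ℝ → ℝ) : Prop
    extends IsBranch g α b σ u₀ M K where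
  strictMonoOn : StrictMonoOn M (Ioi u₀)
  strictAntiOn : StrictAntiOn K (Ioi u₀)
  exists_lower_bound : ∃ κ > 0, ∀ u > u₀, κ ≤ K u
  exists_zero : ∃ v > u₀, M v = 0

/-- A branch along which the profile curve never has horizontal tangent. -/
structure IsUndularBranch (g : ℝ → ℝ) (α : ℝ) (b : EReal) (σ u₀ : ℝ) (M K : ℝ → ℝ) : Prop
    extends IsBranch g α b σ u₀ M K where
  pos : ∀ u > u₀, 0 < M u
  strictMonoOn : StrictMonoOn K (Ioi u₀)
  exists_critical : ∃ v > u₀, K v = 0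

theorem HasStrictDerivAt.exists_lipschitzOnWith {f : ℝ → ℝ} {f' t : ℝ}
    (h : HasStrictDerivAt f f' t) : ∃ C : NNReal, ∃ s ∈ 𝓝 t, LipschitzOnWith C f s :=
  h.hasStrictFDerivAt.exists_lipschitzOnWith

namespace IsSideInverse

variable {g : ℝ → ℝ} {α : ℝ} {b : EReal} {F : ℝ → ℝ} {J : Set ℝ} {u₀ : ℝ} {Λ : ℝ → ℝ}

/-- What the two sides of `α` have in common. Taking `σ α > 0` makes `M → |α| > 0`, so that `u M(u)
→ +∞`. By `hbdd` both curvatures lie between `α` and their values at `u₁`, which bounds them away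
from `u₀`. -/
theorem isBranch (hg : IsEllipticWeingartenFunction g α)
    (hb : Tendsto (fun t : ℝ => (g t : EReal)) atTop (𝓝 b))
    (h : IsSideInverse (weingartenF g α) J F u₀ Λ) (hJ : ∀ t ∈ J, b < (t : EReal) ∧ t ≠ α)
    {σ : ℝ} (hσ : σ = 1 ∨ σ = -1) (hσα : 0 < σ * α) (hlim : Tendsto Λ atTop (𝓝 α))
    (hbdd : ∀ u₁ > u₀, ∀ u ≥ u₁, Λ u ∈ uIcc α (Λ u₁) ∧
      weingartenF g α (Λ u) ∈ uIcc α (weingartenF g α (Λ u₁)))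
    (hblow : Tendsto (fun u => max |Λ u| |weingartenF g α (Λ u)|) (𝓝[>] u₀) atTop)
    (hpinch : u₀ = 0 → Tendsto (fun u => |Λ u|) (𝓝[>] u₀) atTop) :
    IsBranch g α b σ u₀ (fun u => σ * Λ u) (fun u => σ * weingartenF g α (Λ u)) := by
  have hσσ : σ * σ = 1 := by rcases hσ with rfl | rfl <;> norm_num
  have hσabs : |σ| = 1 := by rcases hσ with rfl | rfl <;> norm_num
  have hM : ∀ u, σ * (σ * Λ u) = Λ u := fun u => by rw [← mul_assoc, hσσ, one_mul]
  have habs : ∀ a : ℝ, |σ * a| = |a| := fun a => by rw [abs_mul, hσabs, one_mul]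
  refine ⟨hσ, h.nonneg, fun u hu => ?_, fun u _ => ?_, fun u hu => ?_, fun u hu => ?_,
    fun u₁ hu₁ => ?_, by simpa only [habs] using hblow, by simpa only [habs] using hpinch, ?_⟩
  · rw [hM]; exact (hJ _ (h.mem u hu)).1
  · rw [hM, ← mul_assoc, hσσ, one_mul]
  · have e : (σ * weingartenF g α (Λ u) - σ * Λ u) / u =
        σ * ((weingartenF g α (Λ u) - Λ u) / u) := by ring
    rw [e]
    exact (h.deriv u hu).hasDerivAt.const_mul σ
  · have hu' := hJ _ (h.mem u hu)
    obtain ⟨f', hf'⟩ := hg.f_hasStrictDerivAt hb hu'.1 hu'.2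
    obtain ⟨C, s, hs, hC⟩ := ((hf'.comp u (h.deriv u hu)).const_mul σ).exists_lipschitzOnWith
    exact ⟨C, s, nhdsWithin_le_nhds hs, hC⟩
  · refine ⟨max (max |α| |Λ u₁|) (max |α| |weingartenF g α (Λ u₁)|), fun u hu => ?_⟩
    obtain ⟨h1, h2⟩ := hbdd u₁ hu₁ u hu
    have key : ∀ x y z : ℝ, x ∈ uIcc y z → |x| ≤ max |y| |z| := fun x y z hx => by
      rcases mem_uIcc.1 hx with hx | hx
      · exact abs_le_max_abs_abs hx.1 hx.2
      · rw [max_comm]; exact abs_le_max_abs_abs hx.1 hx.2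
    rw [habs, habs]
    exact max_le_max (key _ _ _ h1) (key _ _ _ h2)
  · exact tendsto_id.atTop_mul_pos hσα (hlim.const_mul σ)

end IsSideInverse

namespace IsSideInverse

variable {g : ℝ → ℝ} {α : ℝ} {b : EReal} {F : ℝ → ℝ} {J : Set ℝ} {u₀ : ℝ} {Λ : ℝ → ℝ} {σ : ℝ}

/-! #### Above the umbilical value -/

theorem right_strictAntiOn (hg : IsEllipticWeingartenFunction g α)
    (hb : Tendsto (fun t : ℝ => (g t : EReal)) atTop (𝓝 b)) (hF : IsWeingartenPrimitive g α b F)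
    (h : IsSideInverse (weingartenF g α) (Ioi α) F u₀ Λ) : StrictAntiOn Λ (Ioi u₀) := by
  intro u hu v hv huv
  by_contra hcon
  have h1 := (hg.primitive_strictAntiOn hb hF).antitoneOn (h.mem u hu) (h.mem v hv) (not_lt.1 hcon)
  have h2 := Real.exp_le_exp.2 h1
  rw [h.exp_apply u hu, h.exp_apply v hv] at h2
  linarith

theorem right_apply_lt (hg : IsEllipticWeingartenFunction g α)
    (hb : Tendsto (fun t : ℝ => (g t : EReal)) atTop (𝓝 b)) (hF : IsWeingartenPrimitive g α b F)
    (h : IsSideInverse (weingartenF g α) (Ioi α) F u₀ Λ) {t u : ℝ} (ht : α < t) (hu : u₀ < u) :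
    Λ u < t ↔ Real.exp (F t) < u := by
  have := (right_strictAntiOn hg hb hF h).lt_iff_gt hu (h.lt_exp t ht)
  rwa [h.apply_exp t ht] at this

theorem right_lt_apply (hg : IsEllipticWeingartenFunction g α)
    (hb : Tendsto (fun t : ℝ => (g t : EReal)) atTop (𝓝 b)) (hF : IsWeingartenPrimitive g α b F)
    (h : IsSideInverse (weingartenF g α) (Ioi α) F u₀ Λ) {t u : ℝ} (ht : α < t) (hu : u₀ < u) :
    t < Λ u ↔ u < Real.exp (F t) := by
  have := (right_strictAntiOn hg hb hF h).lt_iff_gt (h.lt_exp t ht) hu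
  rwa [h.apply_exp t ht] at this

theorem right_tendsto_atTop (hg : IsEllipticWeingartenFunction g α)
    (hb : Tendsto (fun t : ℝ => (g t : EReal)) atTop (𝓝 b)) (hF : IsWeingartenPrimitive g α b F)
    (h : IsSideInverse (weingartenF g α) (Ioi α) F u₀ Λ) : Tendsto Λ (𝓝[>] u₀) atTop := by
  refine tendsto_atTop.2 fun N => ?_
  have hN : α < max N (α + 1) := lt_max_of_lt_right (by linarith)
  filter_upwards [Ioo_mem_nhdsGT (h.lt_exp _ hN)] with u hu
  exact (le_max_left _ _).trans ((right_lt_apply hg hb hF h hN hu.1).2 hu.2).le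

theorem right_tendsto_center (hg : IsEllipticWeingartenFunction g α)
    (hb : Tendsto (fun t : ℝ => (g t : EReal)) atTop (𝓝 b)) (hF : IsWeingartenPrimitive g α b F)
    (h : IsSideInverse (weingartenF g α) (Ioi α) F u₀ Λ) : Tendsto Λ atTop (𝓝 α) := by
  refine tendsto_order.2 ⟨fun a ha => ?_, fun a ha => ?_⟩
  · filter_upwards [eventually_gt_atTop u₀] with u hu
    exact ha.trans (h.mem u hu)
  · filter_upwards [eventually_gt_atTop u₀, eventually_gt_atTop (Real.exp (F a))] with u hu hu'
    exact (right_apply_lt hg hb hF h ha hu).2 hu'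

theorem right_tendsto_exp (hg : IsEllipticWeingartenFunction g α)
    (hb : Tendsto (fun t : ℝ => (g t : EReal)) atTop (𝓝 b)) (hF : IsWeingartenPrimitive g α b F)
    (h : IsSideInverse (weingartenF g α) (Ioi α) F u₀ Λ) :
    Tendsto (fun t => Real.exp (F t)) atTop (𝓝[>] u₀) := by
  refine tendsto_nhdsWithin_iff.2 ⟨tendsto_order.2 ⟨fun a ha => ?_, fun a ha => ?_⟩, ?_⟩
  · filter_upwards [eventually_gt_atTop α] with t ht
    exact ha.trans (h.lt_exp t ht)
  · filter_upwards [eventually_gt_atTop α, eventually_gt_atTop (Λ a)] with t ht ht'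
    exact (right_apply_lt hg hb hF h ht ha).1 ht'
  · filter_upwards [eventually_gt_atTop α] with t ht
    exact h.lt_exp t ht

theorem right_isBranch (hg : IsEllipticWeingartenFunction g α)
    (hb : Tendsto (fun t : ℝ => (g t : EReal)) atTop (𝓝 b)) (hF : IsWeingartenPrimitive g α b F)
    (h : IsSideInverse (weingartenF g α) (Ioi α) F u₀ Λ) (hσ : σ = 1 ∨ σ = -1)
    (hσα : 0 < σ * α) :
    IsBranch g α b σ u₀ (fun u => σ * Λ u) (fun u => σ * weingartenF g α (Λ u)) := by
  have habs : Tendsto (fun u => |Λ u|) (𝓝[>] u₀) atTop :=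
    tendsto_abs_atTop_atTop.comp (right_tendsto_atTop hg hb hF h)
  have hJ : ∀ t ∈ Ioi α, b < (t : EReal) ∧ t ≠ α := fun t ht =>
    ⟨(hg.lt_center hb).trans (EReal.coe_lt_coe_iff.2 ht), ne_of_gt ht⟩
  refine isBranch hg hb h hJ hσ hσα (right_tendsto_center hg hb hF h) (fun u₁ hu₁ u hu => ?_)
    (tendsto_atTop_mono (fun u => le_max_left _ _) habs) fun _ => habs
  have hu' : u₀ < u := lt_of_lt_of_le hu₁ hu
  have h1 := (right_strictAntiOn hg hb hF h).antitoneOn hu₁ hu' hu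
  have h2 := (hg.f_strictAntiOn hb).antitoneOn (hJ _ (h.mem u hu')).1 (hJ _ (h.mem u₁ hu₁)).1 h1
  exact ⟨mem_uIcc.2 (Or.inl ⟨le_of_lt (h.mem u hu'), h1⟩),
    mem_uIcc.2 (Or.inr ⟨h2, (hg.f_lt_of_gt (h.mem u hu')).le⟩)⟩

/-- Here `Λ > α > 0`, so the parallels never lose their sign; the profile curvature vanishes where
`Λ = f(0)`. -/
theorem right_isUndularBranch (hg : IsEllipticWeingartenFunction g α)
    (hb : Tendsto (fun t : ℝ => (g t : EReal)) atTop (𝓝 b)) (hb0 : b < 0)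
    (hF : IsWeingartenPrimitive g α b F)
    (h : IsSideInverse (weingartenF g α) (Ioi α) F u₀ Λ) (hα : 0 < α) :
    IsUndularBranch g α b 1 u₀ (fun u => 1 * Λ u) (fun u => 1 * weingartenF g α (Λ u)) := by
  refine ⟨right_isBranch hg hb hF h (Or.inl rfl) (by simpa using hα), fun u hu => ?_,
    fun u hu v hv huv => ?_, ?_⟩
  · have : α < Λ u := h.mem u hu
    linarith
  · have hd : ∀ w ∈ Ioi u₀, b < (Λ w : EReal) := fun w hw =>
      (hg.lt_center hb).trans (EReal.coe_lt_coe_iff.2 (h.mem w hw))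
    simpa using hg.f_strictAntiOn hb (hd v hv) (hd u hu) (right_strictAntiOn hg hb hF h hu hv huv)
  · have h0 : b < ((0 : ℝ) : EReal) := by simpa using hb0
    have h1 := (hg.f_of_lt hb h0 hα).1
    refine ⟨Real.exp (F (weingartenF g α 0)), h.lt_exp _ h1, ?_⟩
    simp only [h.apply_exp _ h1, hg.f_f hb h0, mul_zero]

/-- Now `Λ` runs over `(α, ∞)`, which contains `0`, while `f(Λ) < α < 0` keeps the profile curvature
away from zero. -/
theorem right_isNodalBranch (hg : IsEllipticWeingartenFunction g α)
    (hb : Tendsto (fun t : ℝ => (g t : EReal)) atTop (𝓝 b))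
    (hF : IsWeingartenPrimitive g α b F)
    (h : IsSideInverse (weingartenF g α) (Ioi α) F u₀ Λ) (hα : α < 0) :
    IsNodalBranch g α b (-1) u₀ (fun u => -1 * Λ u) (fun u => -1 * weingartenF g α (Λ u)) := by
  have hanti := right_strictAntiOn hg hb hF h
  have hd : ∀ w ∈ Ioi u₀, b < (Λ w : EReal) := fun w hw =>
    (hg.lt_center hb).trans (EReal.coe_lt_coe_iff.2 (h.mem w hw))
  refine ⟨right_isBranch hg hb hF h (Or.inr rfl) (by simpa using hα), fun u hu v hv huv => ?_,
    fun u hu v hv huv => ?_, ⟨-α, by linarith, fun u hu => ?_⟩,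
    ⟨Real.exp (F 0), h.lt_exp _ hα, ?_⟩⟩
  · have := hanti hu hv huv
    linarith
  · have := hg.f_strictAntiOn hb (hd v hv) (hd u hu) (hanti hu hv huv)
    linarith
  · have := hg.f_lt_of_gt (h.mem u hu)
    linarith
  · simp [h.apply_exp _ hα]

/-! #### Below the umbilical value -/

theorem left_strictMonoOn (hg : IsEllipticWeingartenFunction g α)
    (hb : Tendsto (fun t : ℝ => (g t : EReal)) atTop (𝓝 b)) (hF : IsWeingartenPrimitive g α b F)
    (h : IsSideInverse (weingartenF g α) ({t : ℝ | b < (t : EReal)} ∩ Iio α) F u₀ Λ) :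
    StrictMonoOn Λ (Ioi u₀) := by
  intro u hu v hv huv
  by_contra hcon
  have h1 := (hg.primitive_strictMonoOn hb hF).monotoneOn (h.mem v hv) (h.mem u hu) (not_lt.1 hcon)
  have h2 := Real.exp_le_exp.2 h1
  rw [h.exp_apply u hu, h.exp_apply v hv] at h2
  linarith

theorem left_apply_lt (hg : IsEllipticWeingartenFunction g α)
    (hb : Tendsto (fun t : ℝ => (g t : EReal)) atTop (𝓝 b)) (hF : IsWeingartenPrimitive g α b F)
    (h : IsSideInverse (weingartenF g α) ({t : ℝ | b < (t : EReal)} ∩ Iio α) F u₀ Λ) {t u : ℝ}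
    (hbt : b < (t : EReal)) (ht : t < α) (hu : u₀ < u) : Λ u < t ↔ u < Real.exp (F t) := by
  have := (left_strictMonoOn hg hb hF h).lt_iff_lt hu (h.lt_exp t ⟨hbt, ht⟩)
  rwa [h.apply_exp t ⟨hbt, ht⟩] at this

theorem left_lt_apply (hg : IsEllipticWeingartenFunction g α)
    (hb : Tendsto (fun t : ℝ => (g t : EReal)) atTop (𝓝 b)) (hF : IsWeingartenPrimitive g α b F)
    (h : IsSideInverse (weingartenF g α) ({t : ℝ | b < (t : EReal)} ∩ Iio α) F u₀ Λ) {t u : ℝ}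
    (hbt : b < (t : EReal)) (ht : t < α) (hu : u₀ < u) : t < Λ u ↔ Real.exp (F t) < u := by
  have := (left_strictMonoOn hg hb hF h).lt_iff_lt (h.lt_exp t ⟨hbt, ht⟩) hu
  rwa [h.apply_exp t ⟨hbt, ht⟩] at this

theorem left_eventually_lt (hg : IsEllipticWeingartenFunction g α)
    (hb : Tendsto (fun t : ℝ => (g t : EReal)) atTop (𝓝 b)) (hF : IsWeingartenPrimitive g α b F)
    (h : IsSideInverse (weingartenF g α) ({t : ℝ | b < (t : EReal)} ∩ Iio α) F u₀ Λ) {t : ℝ}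
    (hbt : b < (t : EReal)) (ht : t < α) : ∀ᶠ u in 𝓝[>] u₀, Λ u < t := by
  filter_upwards [Ioo_mem_nhdsGT (h.lt_exp t ⟨hbt, ht⟩)] with u hu
  exact (left_apply_lt hg hb hF h hbt ht hu.1).2 hu.2

theorem left_tendsto_center (hg : IsEllipticWeingartenFunction g α)
    (hb : Tendsto (fun t : ℝ => (g t : EReal)) atTop (𝓝 b)) (hF : IsWeingartenPrimitive g α b F)
    (h : IsSideInverse (weingartenF g α) ({t : ℝ | b < (t : EReal)} ∩ Iio α) F u₀ Λ) :
    Tendsto Λ atTop (𝓝 α) := by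
  refine tendsto_order.2 ⟨fun a ha => ?_, fun a ha => ?_⟩
  · obtain ⟨t, ht, ht'⟩ := EReal.lt_iff_exists_real_btwn.1
      (max_lt (hg.lt_center hb) (EReal.coe_lt_coe_iff.2 ha))
    have hbt := (le_max_left _ _).trans_lt ht
    have hat : a < t := EReal.coe_lt_coe_iff.1 ((le_max_right _ _).trans_lt ht)
    have htα : t < α := EReal.coe_lt_coe_iff.1 ht'
    filter_upwards [eventually_gt_atTop u₀, eventually_gt_atTop (Real.exp (F t))] with u hu hu'
    exact hat.trans ((left_lt_apply hg hb hF h hbt htα hu).2 hu')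
  · filter_upwards [eventually_gt_atTop u₀] with u hu
    exact lt_trans (h.mem u hu).2 ha

theorem left_tendsto_atBot (hg : IsEllipticWeingartenFunction g α)
    (hb : Tendsto (fun t : ℝ => (g t : EReal)) atTop (𝓝 b)) (hF : IsWeingartenPrimitive g α b F)
    (h : IsSideInverse (weingartenF g α) ({t : ℝ | b < (t : EReal)} ∩ Iio α) F u₀ Λ)
    (hbot : b = ⊥) : Tendsto Λ (𝓝[>] u₀) atBot := by
  refine tendsto_atBot.2 fun N => ?_
  filter_upwards [left_eventually_lt hg hb hF h (t := min N (α - 1))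
    (by rw [hbot]; exact EReal.bot_lt_coe _) (min_lt_of_right_lt (by linarith))] with u hu
  exact hu.le.trans (min_le_left _ _)

theorem left_tendsto_exp (hg : IsEllipticWeingartenFunction g α)
    (hb : Tendsto (fun t : ℝ => (g t : EReal)) atTop (𝓝 b)) (hF : IsWeingartenPrimitive g α b F)
    (h : IsSideInverse (weingartenF g α) ({t : ℝ | b < (t : EReal)} ∩ Iio α) F u₀ Λ)
    (hbot : b = ⊥) : Tendsto (fun t => Real.exp (F t)) atBot (𝓝[>] u₀) := by
  have hbt : ∀ t : ℝ, b < (t : EReal) := fun t => by rw [hbot]; exact EReal.bot_lt_coe _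
  refine tendsto_nhdsWithin_iff.2 ⟨tendsto_order.2 ⟨fun a ha => ?_, fun a ha => ?_⟩, ?_⟩
  · filter_upwards [eventually_lt_atBot α] with t ht
    exact ha.trans (h.lt_exp t ⟨hbt t, ht⟩)
  · filter_upwards [eventually_lt_atBot α, eventually_lt_atBot (Λ a)] with t ht ht'
    exact (left_lt_apply hg hb hF h (hbt t) ht ha).1 ht'
  · filter_upwards [eventually_lt_atBot α] with t ht
    exact h.lt_exp t ⟨hbt t, ht⟩

theorem left_tendsto_finite (hg : IsEllipticWeingartenFunction g α)
    (hb : Tendsto (fun t : ℝ => (g t : EReal)) atTop (𝓝 b)) (hF : IsWeingartenPrimitive g α b F)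
    (h : IsSideInverse (weingartenF g α) ({t : ℝ | b < (t : EReal)} ∩ Iio α) F u₀ Λ) {β : ℝ}
    (hβ : b = (β : EReal)) : Tendsto Λ (𝓝[>] u₀) (𝓝 β) := by
  have hβα : β < α := EReal.coe_lt_coe_iff.1 (hβ ▸ hg.lt_center hb)
  refine tendsto_order.2 ⟨fun a ha => ?_, fun a ha => ?_⟩
  · filter_upwards [self_mem_nhdsWithin] with u hu
    have : b < (Λ u : EReal) := (h.mem u hu).1
    rw [hβ] at this
    exact ha.trans (EReal.coe_lt_coe_iff.1 this)
  · obtain ⟨t, ht, ht'⟩ := exists_between (lt_min ha hβα)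
    filter_upwards [left_eventually_lt hg hb hF h (t := t)
      (by rw [hβ]; exact EReal.coe_lt_coe_iff.2 ht) (ht'.trans_le (min_le_right _ _))] with u hu
    exact hu.trans (ht'.trans_le (min_le_left _ _))

/-- For finite `b = β` the difference `f t - t` is bounded below by some `D > 0` near `β`, so `F' ≤
1/D` on a bounded interval and `F` cannot tend to `-∞`: the distance to the axis stays bounded
below. -/
theorem left_pos (hg : IsEllipticWeingartenFunction g α)
    (hb : Tendsto (fun t : ℝ => (g t : EReal)) atTop (𝓝 b)) (hF : IsWeingartenPrimitive g α b F)
    (h : IsSideInverse (weingartenF g α) ({t : ℝ | b < (t : EReal)} ∩ Iio α) F u₀ Λ)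
    (hbot : b ≠ ⊥) : 0 < u₀ := by
  obtain ⟨β, hβ⟩ : ∃ β : ℝ, b = (β : EReal) :=
    ⟨b.toReal, (EReal.coe_toReal (hg.lt_center hb).ne_top hbot).symm⟩
  have hβα : β < α := EReal.coe_lt_coe_iff.1 (hβ ▸ hg.lt_center hb)
  obtain ⟨t₀, ht₀, ht₀'⟩ := exists_between hβα
  have hbd : ∀ t, β < t → b < (t : EReal) := fun t ht => by
    rw [hβ]; exact EReal.coe_lt_coe_iff.2 ht
  have hmono := hg.primitive_strictMonoOn hb hF
  set D := weingartenF g α t₀ - t₀ with hD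
  have hD0 : 0 < D := by
    have := (hg.f_of_lt hb (hbd _ ht₀) ht₀').1
    rw [hD]; linarith
  have hder : ∀ t ∈ Ioc β t₀, HasDerivAt (fun t => F t - 1 / D * t)
      (1 / (weingartenF g α t - t) - 1 / D) t := fun t ht => by
    simpa using (hF t (hbd t ht.1) (ht.2.trans_lt ht₀').ne).fun_sub
      ((hasDerivAt_id t).const_mul (1 / D))
  have hanti : AntitoneOn (fun t => F t - 1 / D * t) (Ioc β t₀) := by
    refine antitoneOn_of_deriv_nonpos (convex_Ioc _ _)
      (fun t ht => (hder t ht).continuousAt.continuousWithinAt)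
      (fun t ht => (hder t (interior_subset ht)).differentiableAt.differentiableWithinAt)
      fun t ht => ?_
    have ht' := interior_subset ht
    rw [(hder t ht').deriv]
    have h1 := (hg.f_strictAntiOn hb).antitoneOn (hbd t ht'.1) (hbd t₀ ht₀) ht'.2
    have h2 : D ≤ weingartenF g α t - t := by rw [hD]; linarith [ht'.2]
    have := one_div_le_one_div_of_le hD0 h2
    linarith
  set m := F t₀ - 1 / D * (t₀ - β) with hm
  have hDi : 0 < 1 / D := by positivity
  have hle : ∀ t ∈ {t : ℝ | b < (t : EReal)} ∩ Iio α, m ≤ F t := by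
    intro t ht
    have htβ : β < t := by
      have : b < (t : EReal) := ht.1
      rw [hβ] at this
      exact EReal.coe_lt_coe_iff.1 this
    rcases le_total t t₀ with h1 | h1
    · have h2 := hanti ⟨htβ, h1⟩ ⟨ht₀, le_rfl⟩ h1
      simp only at h2
      rw [hm]
      nlinarith
    · have h2 := hmono.monotoneOn ⟨hbd t₀ ht₀, ht₀'⟩ ht h1
      rw [hm]
      nlinarith
  refine (Real.exp_pos m).trans_le (le_of_forall_gt_imp_ge_of_dense fun u hu => ?_)
  have h1 := hle _ (h.mem u hu)
  have h2 := Real.exp_le_exp.2 h1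
  rwa [h.exp_apply u hu] at h2

theorem left_isBranch (hg : IsEllipticWeingartenFunction g α)
    (hb : Tendsto (fun t : ℝ => (g t : EReal)) atTop (𝓝 b)) (hF : IsWeingartenPrimitive g α b F)
    (h : IsSideInverse (weingartenF g α) ({t : ℝ | b < (t : EReal)} ∩ Iio α) F u₀ Λ)
    (hσ : σ = 1 ∨ σ = -1) (hσα : 0 < σ * α) :
    IsBranch g α b σ u₀ (fun u => σ * Λ u) (fun u => σ * weingartenF g α (Λ u)) := by
  refine isBranch hg hb h (fun t ht => ⟨ht.1, ne_of_lt ht.2⟩) hσ hσα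
    (left_tendsto_center hg hb hF h) (fun u₁ hu₁ u hu => ?_)
    (tendsto_atTop.2 fun N => ?_) fun h0 => ?_
  · have hu' : u₀ < u := lt_of_lt_of_le hu₁ hu
    have h1 := (left_strictMonoOn hg hb hF h).monotoneOn hu₁ hu' hu
    have h2 := (hg.f_strictAntiOn hb).antitoneOn (h.mem u₁ hu₁).1 (h.mem u hu').1 h1
    exact ⟨mem_uIcc.2 (Or.inr ⟨h1, le_of_lt (h.mem u hu').2⟩), mem_uIcc.2
      (Or.inl ⟨(hg.f_of_lt hb (h.mem u hu').1 (h.mem u hu').2).1.le, h2⟩)⟩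
  -- If `b` is finite, `Λ` stays bounded near `u₀` and it is `f(Λ)` that blows up: `Λ < g N` forces
  -- `f(Λ) > N`.
  · have hN : α < max N (α + 1) := lt_max_of_lt_right (by linarith)
    filter_upwards [left_eventually_lt hg hb hF h (hg.lt_map hb hN.le) (hg.map_lt hN),
      self_mem_nhdsWithin] with u hu hu'
    have h1 := hg.f_strictAntiOn hb (h.mem u hu').1 (hg.lt_map hb hN.le) hu
    rw [hg.f_map hb hN.le] at h1
    exact (le_max_left _ _).trans (h1.le.trans ((le_abs_self _).trans (le_max_right _ _)))
  -- Reaching the axis is only possible for `b = -∞`, and then `Λ` itself diverges.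
  · have hbot : b = ⊥ := by
      by_contra hne
      exact (left_pos hg hb hF h hne).ne' h0
    exact tendsto_abs_atBot_atTop.comp (left_tendsto_atBot hg hb hF h hbot)

theorem left_isUndularBranch (hg : IsEllipticWeingartenFunction g α)
    (hb : Tendsto (fun t : ℝ => (g t : EReal)) atTop (𝓝 b)) (hb0 : b < 0)
    (hF : IsWeingartenPrimitive g α b F)
    (h : IsSideInverse (weingartenF g α) ({t : ℝ | b < (t : EReal)} ∩ Iio α) F u₀ Λ)
    (hα : α < 0) :
    IsUndularBranch g α b (-1) u₀ (fun u => -1 * Λ u) (fun u => -1 * weingartenF g α (Λ u)) := by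
  refine ⟨left_isBranch hg hb hF h (Or.inr rfl) (by simpa using hα), fun u hu => ?_,
    fun u hu v hv huv => ?_, ?_⟩
  · have : Λ u < α := (h.mem u hu).2
    linarith
  · have := hg.f_strictAntiOn hb (h.mem u hu).1 (h.mem v hv).1
      (left_strictMonoOn hg hb hF h hu hv huv)
    linarith
  · have h0 : b < ((0 : ℝ) : EReal) := by simpa using hb0
    have h1 : weingartenF g α 0 ∈ {t : ℝ | b < (t : EReal)} ∩ Iio α :=
      ⟨hg.lt_f hb h0, hg.f_lt_of_gt hα⟩
    refine ⟨Real.exp (F (weingartenF g α 0)), h.lt_exp _ h1, ?_⟩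
    simp only [h.apply_exp _ h1, hg.f_f hb h0, mul_zero]

/-- The hypothesis `b < 0 < α` places `0` in the range `(b, α)` of `Λ`, producing a horizontal
tangent; `f(Λ) > α` bounds the profile curvature below. -/
theorem left_isNodalBranch (hg : IsEllipticWeingartenFunction g α)
    (hb : Tendsto (fun t : ℝ => (g t : EReal)) atTop (𝓝 b)) (hb0 : b < 0)
    (hF : IsWeingartenPrimitive g α b F)
    (h : IsSideInverse (weingartenF g α) ({t : ℝ | b < (t : EReal)} ∩ Iio α) F u₀ Λ)
    (hα : 0 < α) :
    IsNodalBranch g α b 1 u₀ (fun u => 1 * Λ u) (fun u => 1 * weingartenF g α (Λ u)) := by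
  have hmono := left_strictMonoOn hg hb hF h
  have h0 : (0 : ℝ) ∈ {t : ℝ | b < (t : EReal)} ∩ Iio α := ⟨by simpa using hb0, hα⟩
  refine ⟨left_isBranch hg hb hF h (Or.inl rfl) (by simpa using hα), fun u hu v hv huv => ?_,
    fun u hu v hv huv => ?_, ⟨α, hα, fun u hu => ?_⟩, ⟨Real.exp (F 0), h.lt_exp _ h0, ?_⟩⟩
  · simpa using hmono hu hv huv
  · simpa using hg.f_strictAntiOn hb (h.mem u hu).1 (h.mem v hv).1 (hmono hu hv huv)
  · have := (hg.f_of_lt hb (h.mem u hu).1 (h.mem u hu).2).1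
    linarith
  · simp [h.apply_exp _ h0]

end IsSideInverse

/-! ### Principal curvatures of rotational surfaces -/

theorem hasFDerivAt_vec3 {f₀ f₁ f₂ : ℝ × ℝ → ℝ} {f₀' f₁' f₂' : ℝ × ℝ →L[ℝ] ℝ} {q : ℝ × ℝ}
    (h₀ : HasFDerivAt f₀ f₀' q) (h₁ : HasFDerivAt f₁ f₁' q) (h₂ : HasFDerivAt f₂ f₂' q) :
    DifferentiableAt ℝ (fun q => (!₂[f₀ q, f₁ q, f₂ q] : E3)) q ∧
      ∀ v, fderiv ℝ (fun q => (!₂[f₀ q, f₁ q, f₂ q] : E3)) q v = !₂[f₀' v, f₁' v, f₂' v] := by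
  have hd : DifferentiableAt ℝ (fun q => (!₂[f₀ q, f₁ q, f₂ q] : E3)) q := by
    rw [differentiableAt_euclidean]
    intro i
    fin_cases i
    · exact h₀.differentiableAt
    · exact h₁.differentiableAt
    · exact h₂.differentiableAt
  refine ⟨hd, fun v => ?_⟩
  have h := hasFDerivWithinAt_euclidean.1 (hd.hasFDerivAt.hasFDerivWithinAt (s := univ))
  ext i
  have hi := (h i).hasFDerivAt univ_mem
  fin_cases i
  · exact DFunLike.congr_fun (hi.unique h₀) v
  · exact DFunLike.congr_fun (hi.unique h₁) v
  · exact DFunLike.congr_fun (hi.unique h₂) v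

theorem HasDerivAt.comp_fst {φ : ℝ → ℝ} {s θ p : ℝ} (h : HasDerivAt φ p s) :
    HasFDerivAt (fun q : ℝ × ℝ => φ q.1) (p • ContinuousLinearMap.fst ℝ ℝ ℝ) (s, θ) :=
  HasDerivAt.comp_hasFDerivAt (f := Prod.fst) (s, θ) h hasFDerivAt_fst

theorem HasDerivAt.comp_snd {φ : ℝ → ℝ} {s θ p : ℝ} (h : HasDerivAt φ p θ) :
    HasFDerivAt (fun q : ℝ × ℝ => φ q.2) (p • ContinuousLinearMap.snd ℝ ℝ ℝ) (s, θ) :=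
  HasDerivAt.comp_hasFDerivAt (f := Prod.snd) (s, θ) h hasFDerivAt_snd

namespace ProfileCurve

theorem fderiv_param {γ : ProfileCurve} {s θ p q : ℝ} (hx : HasDerivAt γ.x p s)
    (hz : HasDerivAt γ.z q s) : DifferentiableAt ℝ γ.param (s, θ) ∧
      ∀ v, fderiv ℝ γ.param (s, θ) v = !₂[v.1 * (p * Real.cos θ) - v.2 * (γ.x s * Real.sin θ),
        v.1 * (p * Real.sin θ) + v.2 * (γ.x s * Real.cos θ), v.1 * q] := by
  have hx' : HasFDerivAt (fun q : ℝ × ℝ => γ.x q.1) _ (s, θ) := hx.comp_fst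
  have hz' : HasFDerivAt (fun q : ℝ × ℝ => γ.z q.1) _ (s, θ) := hz.comp_fst
  have hc : HasFDerivAt (fun q : ℝ × ℝ => Real.cos q.2) _ (s, θ) := (Real.hasDerivAt_cos θ).comp_snd
  have hs : HasFDerivAt (fun q : ℝ × ℝ => Real.sin q.2) _ (s, θ) := (Real.hasDerivAt_sin θ).comp_snd
  obtain ⟨h1, h2⟩ := hasFDerivAt_vec3 (hx'.mul hc) (hx'.mul hs) hz'
  refine ⟨h1, fun v => (h2 v).trans ?_⟩
  ext i
  fin_cases i <;> simp <;> ring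

/-- At a point where the profile curve has curvature `μ` and the parallel has normal curvature
`l`, these are the two principal curvatures. -/
theorem hasPrincipalCurvatures_iff {γ : ProfileCurve} {s θ p q μ l k₁ k₂ : ℝ}
    (hx : HasDerivAt γ.x p s) (hz : HasDerivAt γ.z q s)
    (hp : HasDerivAt (deriv γ.x) (-(μ * q)) s) (hq : HasDerivAt (deriv γ.z) (μ * p) s)
    (hE : p ^ 2 + q ^ 2 = 1) (hl : q = l * γ.x s) (hx0 : γ.x s ≠ 0) :
    HasPrincipalCurvatures γ.param γ.normal (s, θ) k₁ k₂ ↔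
      (k₁ = μ ∧ k₂ = l) ∨ (k₁ = l ∧ k₂ = μ) := by
  obtain ⟨hXd, hX⟩ := fderiv_param (θ := θ) hx hz
  have hx' : HasFDerivAt (fun q : ℝ × ℝ => deriv γ.x q.1) _ (s, θ) := hp.comp_fst
  have hz' : HasFDerivAt (fun q : ℝ × ℝ => -deriv γ.z q.1) _ (s, θ) := hq.fun_neg.comp_fst
  have hc : HasFDerivAt (fun q : ℝ × ℝ => Real.cos q.2) _ (s, θ) := (Real.hasDerivAt_cos θ).comp_snd
  have hs : HasFDerivAt (fun q : ℝ × ℝ => Real.sin q.2) _ (s, θ) := (Real.hasDerivAt_sin θ).comp_snd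
  obtain ⟨hNd, hN⟩ := hasFDerivAt_vec3 (hz'.mul hc) (hz'.mul hs) hx'
  have hdz : deriv γ.z s = q := hz.deriv
  have hN' : ∀ v, fderiv ℝ γ.normal (s, θ) v =
      !₂[-(μ * v.1 * (p * Real.cos θ)) + l * v.2 * (γ.x s * Real.sin θ),
        -(μ * v.1 * (p * Real.sin θ)) - l * v.2 * (γ.x s * Real.cos θ), -(μ * v.1 * q)] := by
    intro v
    refine (hN v).trans ?_
    ext i
    fin_cases i <;> simp [hdz] <;> rw [hl] <;> ring
  have hsc := Real.sin_sq_add_cos_sq θ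
  -- The shape operator is diagonal in the coordinates `(s, θ)`, so the eigenvector equation splits
  -- into one scalar equation per coordinate.
  have key : ∀ (k : ℝ) (v : ℝ × ℝ), fderiv ℝ γ.normal (s, θ) v = -(k • fderiv ℝ γ.param (s, θ) v) ↔
      (k - μ) * v.1 = 0 ∧ (k - l) * v.2 = 0 := by
    intro k v
    rw [hN', hX]
    constructor
    · intro h
      have h0 := congrArg (fun w : E3 => w 0) h
      have h1 := congrArg (fun w : E3 => w 1) h
      have h2 := congrArg (fun w : E3 => w 2) h
      simp at h0 h1 h2
      have hA : (k - μ) * v.1 * p = 0 := by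
        linear_combination Real.cos θ * h0 + Real.sin θ * h1 - (k - μ) * v.1 * p * hsc
      have hB : (k - l) * v.2 * γ.x s = 0 := by
        linear_combination -Real.sin θ * h0 + Real.cos θ * h1 - (k - l) * v.2 * γ.x s * hsc
      have hC : (k - μ) * v.1 * q = 0 := by linear_combination -h2
      refine ⟨?_, (mul_eq_zero.1 hB).resolve_right hx0⟩
      linear_combination p * hA + q * hC - (k - μ) * v.1 * hE
    · rintro ⟨h1, h2⟩
      ext i
      fin_cases i <;> simp
      · linear_combination p * Real.cos θ * h1 - γ.x s * Real.sin θ * h2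
      · linear_combination p * Real.sin θ * h1 + γ.x s * Real.cos θ * h2
      · linear_combination -q * h1
  constructor
  · rintro ⟨-, -, v, w, hvw, hv, hw⟩
    obtain ⟨hv1, hv2⟩ := (key _ _).1 hv
    obtain ⟨hw1, hw2⟩ := (key _ _).1 hw
    have hdet : v.1 * w.2 - v.2 * w.1 ≠ 0 := by
      intro hdet
      rw [LinearIndependent.pair_iff] at hvw
      have e1 := hvw w.2 (-v.2) (by ext <;> simp <;> linarith)
      have e2 := hvw w.1 (-v.1) (by ext <;> simp <;> linarith)
      have : v = 0 := Prod.ext (by simpa using e2.2) (by simpa using e1.2)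
      have := hvw 1 0 (by simp [this])
      simp at this
    -- One of the two products in the determinant is nonzero; which one decides the order in which
    -- the two curvatures are attached to the two basis vectors.
    by_cases h : v.1 * w.2 = 0
    · have h' : v.2 * w.1 ≠ 0 := fun h' => hdet (by rw [h, h', sub_zero])
      have hv0 := left_ne_zero_of_mul h'
      have hw0 := right_ne_zero_of_mul h'
      exact Or.inr ⟨sub_eq_zero.1 ((mul_eq_zero.1 hv2).resolve_right hv0),
        sub_eq_zero.1 ((mul_eq_zero.1 hw1).resolve_right hw0)⟩
    · have hv0 := left_ne_zero_of_mul h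
      have hw0 := right_ne_zero_of_mul h
      exact Or.inl ⟨sub_eq_zero.1 ((mul_eq_zero.1 hv1).resolve_right hv0),
        sub_eq_zero.1 ((mul_eq_zero.1 hw2).resolve_right hw0)⟩
  · intro h
    refine ⟨hXd, hNd, ?_⟩
    rcases h with ⟨rfl, rfl⟩ | ⟨rfl, rfl⟩
    · exact ⟨(1, 0), (0, 1), by rw [LinearIndependent.pair_iff]; intro a b h; simpa using h,
        (key _ _).2 (by simp), (key _ _).2 (by simp)⟩
    · exact ⟨(0, 1), (1, 0), by rw [LinearIndependent.pair_iff]; intro a b h; simpa [and_comm] using h,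
        (key _ _).2 (by simp), (key _ _).2 (by simp)⟩

variable {g : ℝ → ℝ} {α : ℝ} {b : EReal}

/-- The pair `{l, f l}` always has the form `{κ₁, g κ₁}`; whether `l` is the larger or the smaller
curvature depends on its position relative to `α`, so both orders are needed. -/
theorem satisfiesWeingartenAt_of (hg : IsEllipticWeingartenFunction g α)
    (hb : Tendsto (fun t : ℝ => (g t : EReal)) atTop (𝓝 b)) {X N : ℝ × ℝ → E3} {w : ℝ × ℝ}
    {l : ℝ} (hl : b < (l : EReal))
    (h₁ : HasPrincipalCurvatures X N w l (weingartenF g α l))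
    (h₂ : HasPrincipalCurvatures X N w (weingartenF g α l) l) :
    SatisfiesWeingartenAt g α X N w := by
  rcases le_or_gt α l with h | h
  · rw [IsEllipticWeingartenFunction.f_of_ge h] at h₁
    have := hg.strictAntiOn.antitoneOn self_mem_Ici h h
    rw [hg.map_umbilical] at this
    exact ⟨l, g l, h₁, this.trans h, h, rfl⟩
  · have h3 := hg.f_of_lt hb hl h
    exact ⟨weingartenF g α l, l, h₂, by linarith [h3.1], h3.1.le, h3.2.symm⟩

theorem relation_of_curvatures (hg : IsEllipticWeingartenFunction g α)
    (hb : Tendsto (fun t : ℝ => (g t : EReal)) atTop (𝓝 b)) {κ₁ κ₂ l μ : ℝ} (h₁ : α ≤ κ₁)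
    (h₂ : κ₂ = g κ₁) (h : (κ₁ = μ ∧ κ₂ = l) ∨ (κ₁ = l ∧ κ₂ = μ)) :
    b < (l : EReal) ∧ μ = weingartenF g α l := by
  rcases h with ⟨rfl, rfl⟩ | ⟨rfl, rfl⟩
  · rw [h₂]
    exact ⟨hg.lt_map hb h₁, (hg.f_map hb h₁).symm⟩
  · refine ⟨(hg.lt_center hb).trans_le (EReal.coe_le_coe_iff.2 h₁), ?_⟩
    rw [h₂, IsEllipticWeingartenFunction.f_of_ge h₁]

end ProfileCurve

/-! ### The profile equation, its converse, and regular poles. -/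

namespace ProfileCurve

variable {g : ℝ → ℝ} {α : ℝ} {b : EReal} {γ : ProfileCurve}

namespace IsRotationalWeingarten

theorem hasDerivAt (h : γ.IsRotationalWeingarten g α) {s : ℝ} (hs : s ∈ interior γ.I) :
    HasDerivAt γ.x (deriv γ.x s) s ∧ HasDerivAt γ.z (deriv γ.z s) s :=
  ⟨((h.contDiffOn_x.contDiffAt (isOpen_interior.mem_nhds hs)).differentiableAt
      two_ne_zero).hasDerivAt,
    ((h.contDiffOn_z.contDiffAt (isOpen_interior.mem_nhds hs)).differentiableAt
      two_ne_zero).hasDerivAt⟩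

theorem differentiableAt_deriv (h : γ.IsRotationalWeingarten g α) {s : ℝ}
    (hs : s ∈ interior γ.I) :
    DifferentiableAt ℝ (deriv γ.x) s ∧ DifferentiableAt ℝ (deriv γ.z) s := by
  have hx := h.contDiffOn_x.deriv_of_isOpen (m := 1) isOpen_interior (by norm_num)
  have hz := h.contDiffOn_z.deriv_of_isOpen (m := 1) isOpen_interior (by norm_num)
  exact ⟨(hx.contDiffAt (isOpen_interior.mem_nhds hs)).differentiableAt one_ne_zero,
    (hz.contDiffAt (isOpen_interior.mem_nhds hs)).differentiableAt one_ne_zero⟩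

/-- The profile equation: the tangent angle turns at the rate `f(λ)`, where `λ = z' / x`. -/
theorem profile_equation (hg : IsEllipticWeingartenFunction g α)
    (hb : Tendsto (fun t : ℝ => (g t : EReal)) atTop (𝓝 b))
    (h : γ.IsRotationalWeingarten g α) {s : ℝ} (hs : s ∈ interior γ.I) :
    b < ((deriv γ.z s / γ.x s : ℝ) : EReal) ∧
    HasDerivAt (deriv γ.x) (-(weingartenF g α (deriv γ.z s / γ.x s) * deriv γ.z s)) s ∧
    HasDerivAt (deriv γ.z) (weingartenF g α (deriv γ.z s / γ.x s) * deriv γ.x s) s := by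
  obtain ⟨hx, hz⟩ := h.hasDerivAt hs
  obtain ⟨hdp, hdq⟩ := h.differentiableAt_deriv hs
  have hp := hdp.hasDerivAt
  have hq := hdq.hasDerivAt
  set p := deriv γ.x s
  set q := deriv γ.z s
  set p' := deriv (deriv γ.x) s
  set q' := deriv (deriv γ.z) s
  have hx0 := (h.x_pos s hs).ne'
  have hE : p ^ 2 + q ^ 2 = 1 := h.arc_length s hs
  -- Differentiating the arc-length condition: the acceleration is normal to the curve, hence equal
  -- to `μ` times the rotated tangent.
  have horth : p * p' + q * q' = 0 := by
    have h1 : HasDerivAt (fun s => (deriv γ.x s) ^ 2 + (deriv γ.z s) ^ 2)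
        (2 * p * p' + 2 * q * q') s := by
      simpa using (hp.fun_pow 2).fun_add (hq.fun_pow 2)
    have h2 : HasDerivAt (fun s => (deriv γ.x s) ^ 2 + (deriv γ.z s) ^ 2) 0 s := by
      refine (hasDerivAt_const s (1 : ℝ)).congr_of_eventuallyEq ?_
      filter_upwards [isOpen_interior.mem_nhds hs] with t ht using h.arc_length t ht
    have := h1.unique h2
    linarith
  set μ := p * q' - p' * q with hμ
  have e1 : p' = -(μ * q) := by
    rw [hμ]; linear_combination (-p') * hE + p * horth
  have e2 : q' = μ * p := by
    rw [hμ]; linear_combination (-q') * hE + q * horth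
  have hp2 : HasDerivAt (deriv γ.x) (-(μ * q)) s := by rw [← e1]; exact hp
  have hq2 : HasDerivAt (deriv γ.z) (μ * p) s := by rw [← e2]; exact hq
  obtain ⟨κ₁, κ₂, hpc, -, hκ, hκ'⟩ := h.weingarten s hs 0
  have hl : q = q / γ.x s * γ.x s := (div_mul_cancel₀ _ hx0).symm
  obtain ⟨h1, h2⟩ := relation_of_curvatures hg hb hκ hκ'
    ((hasPrincipalCurvatures_iff hx hz hp2 hq2 hE hl hx0).1 hpc)
  rw [← h2]
  exact ⟨h1, hp2, hq2⟩

theorem hasPrincipalCurvatures_iff (hg : IsEllipticWeingartenFunction g α)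
    (hb : Tendsto (fun t : ℝ => (g t : EReal)) atTop (𝓝 b))
    (h : γ.IsRotationalWeingarten g α) {s θ k₁ k₂ : ℝ} (hs : s ∈ interior γ.I) :
    HasPrincipalCurvatures γ.param γ.normal (s, θ) k₁ k₂ ↔
      (k₁ = weingartenF g α (deriv γ.z s / γ.x s) ∧ k₂ = deriv γ.z s / γ.x s) ∨
      (k₁ = deriv γ.z s / γ.x s ∧ k₂ = weingartenF g α (deriv γ.z s / γ.x s)) := by
  obtain ⟨hx, hz⟩ := h.hasDerivAt hs
  obtain ⟨-, hp, hq⟩ := profile_equation hg hb h hs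
  have hx0 := (h.x_pos s hs).ne'
  exact ProfileCurve.hasPrincipalCurvatures_iff hx hz hp hq (h.arc_length s hs)
    (div_mul_cancel₀ _ hx0).symm hx0

theorem interior_ordConnected (h : γ.IsRotationalWeingarten g α) :
    (interior γ.I).OrdConnected :=
  (h.ordConnected.convex : Convex ℝ γ.I).interior.ordConnected

theorem subset_closure_interior (h : γ.IsRotationalWeingarten g α) :
    γ.I ⊆ closure (interior γ.I) := by
  rw [(h.ordConnected.convex : Convex ℝ γ.I).closure_interior_eq_closure_of_nonempty_interior h.nonempty_interior]
  exact subset_closure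

end IsRotationalWeingarten

/-- A solution of the profile equation on an open interval generates a surface of the class. -/
theorem isRotationalWeingarten_of (hg : IsEllipticWeingartenFunction g α)
    (hb : Tendsto (fun t : ℝ => (g t : EReal)) atTop (𝓝 b)) {p l : ℝ → ℝ} (hI : IsOpen γ.I)
    (hIc : γ.I.OrdConnected) (hne : γ.I.Nonempty) (hpos : ∀ s ∈ γ.I, 0 < γ.x s)
    (hx : ∀ s ∈ γ.I, HasDerivAt γ.x (p s) s)
    (hz : ∀ s ∈ γ.I, HasDerivAt γ.z (l s * γ.x s) s)
    (hp : ∀ s ∈ γ.I, HasDerivAt p (-(weingartenF g α (l s) * (l s * γ.x s))) s)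
    (hq : ∀ s ∈ γ.I, HasDerivAt (fun s => l s * γ.x s) (weingartenF g α (l s) * p s) s)
    (hl : ∀ s ∈ γ.I, b < (l s : EReal)) (hE : ∀ s ∈ γ.I, p s ^ 2 + (l s * γ.x s) ^ 2 = 1)
    (hc : ContinuousOn (fun s => weingartenF g α (l s)) γ.I) :
    γ.IsRotationalWeingarten g α := by
  have hdx : ∀ s ∈ γ.I, deriv γ.x s = p s := fun s hs => (hx s hs).deriv
  have hdz : ∀ s ∈ γ.I, deriv γ.z s = l s * γ.x s := fun s hs => (hz s hs).deriv
  have hpc : ContinuousOn p γ.I := fun s hs => (hp s hs).continuousAt.continuousWithinAt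
  have hqc : ContinuousOn (fun s => l s * γ.x s) γ.I := fun s hs =>
    (hq s hs).continuousAt.continuousWithinAt
  have hcd1 : ∀ φ ψ : ℝ → ℝ, (∀ s ∈ γ.I, HasDerivAt φ (ψ s) s) → ContinuousOn ψ γ.I →
      ContDiffOn ℝ 1 φ γ.I := fun φ ψ h hψ => by
    rw [show (1 : WithTop ℕ∞) = 0 + 1 from (zero_add 1).symm, contDiffOn_succ_iff_deriv_of_isOpen hI]
    refine ⟨fun s hs => (h s hs).differentiableAt.differentiableWithinAt, by simp, ?_⟩
    rw [contDiffOn_zero]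
    exact hψ.congr fun s hs => (h s hs).deriv
  have hcd2 : ∀ φ ψ : ℝ → ℝ, (∀ s ∈ γ.I, HasDerivAt φ (ψ s) s) → ContDiffOn ℝ 1 ψ γ.I →
      ContDiffOn ℝ 2 φ γ.I := fun φ ψ h hψ => by
    rw [show (2 : WithTop ℕ∞) = 1 + 1 from one_add_one_eq_two.symm,
      contDiffOn_succ_iff_deriv_of_isOpen hI]
    exact ⟨fun s hs => (h s hs).differentiableAt.differentiableWithinAt, by simp,
      hψ.congr fun s hs => (h s hs).deriv⟩
  refine ⟨hIc, by rwa [hI.interior_eq], fun s hs => (hx s hs).continuousAt.continuousWithinAt,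
    fun s hs => (hz s hs).continuousAt.continuousWithinAt, ?_, ?_, ?_, ?_, ?_, ?_⟩ <;>
    rw [hI.interior_eq]
  · exact hcd2 _ _ hx (hcd1 _ _ hp (hc.mul hqc).neg)
  · exact hcd2 _ _ hz (hcd1 _ _ hq (hc.mul hpc))
  · exact hpos
  · intro s hs
    rw [hdx s hs, hdz s hs]
    exact hE s hs
  · intro s hs θ
    have hevx : deriv γ.x =ᶠ[𝓝 s] p := by
      filter_upwards [hI.mem_nhds hs] with t ht using hdx t ht
    have hevz : deriv γ.z =ᶠ[𝓝 s] fun s => l s * γ.x s := by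
      filter_upwards [hI.mem_nhds hs] with t ht using hdz t ht
    have key := fun k₁ k₂ => ProfileCurve.hasPrincipalCurvatures_iff (θ := θ) (k₁ := k₁) (k₂ := k₂)
      (hx s hs) (hz s hs)
      ((hp s hs).congr_of_eventuallyEq hevx) ((hq s hs).congr_of_eventuallyEq hevz) (hE s hs) rfl
      (hpos s hs).ne'
    exact satisfiesWeingartenAt_of hg hb (hl s hs) ((key _ _).2 (Or.inr ⟨rfl, rfl⟩))
      ((key _ _).2 (Or.inl ⟨rfl, rfl⟩))
  · simp

/-- Near a regular pole the curvature of the parallels stays bounded. -/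
theorem HasRegularPole.exists_bound {s₀ : ℝ} (hr : γ.IsRotationalWeingarten g α)
    (hs₀ : s₀ ∈ γ.I) (h : γ.HasRegularPole g α s₀) :
    Tendsto γ.x (𝓝[interior γ.I] s₀) (𝓝 0) ∧
      ∃ C, ∀ᶠ s in 𝓝[interior γ.I] s₀, |deriv γ.z s| ≤ C * γ.x s := by
  obtain ⟨hx0, U, -, -, hU, hev, -, -⟩ := h
  have hlim : Tendsto γ.x (𝓝[interior γ.I] s₀) (𝓝 0) := by
    have := (hr.continuousOn_x s₀ hs₀).mono interior_subset
    rwa [ContinuousWithinAt, hx0] at this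
  refine ⟨hlim, ?_⟩
  have hne : (𝓝[interior γ.I] s₀).NeBot :=
    mem_closure_iff_nhdsWithin_neBot.1 (hr.subset_closure_interior hs₀)
  obtain ⟨W, hW, hWo, hWs⟩ := eventually_nhds_iff.1 (eventually_nhdsWithin_iff.1 hev)
  set V : ℝ → ℝ := fun r => U (r, 0) with hV
  have hline : ∀ r : ℝ, HasDerivAt (fun r : ℝ => (r, (0 : ℝ))) (1, 0) r := fun r =>
    (hasDerivAt_id r).prodMk (hasDerivAt_const r 0)
  have hUd : ∀ᶠ w in 𝓝 (0 : ℝ × ℝ), DifferentiableAt ℝ U w :=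
    (hU.eventually (by simp)).mono fun w hw => hw.differentiableAt two_ne_zero
  have hU' : DifferentiableAt ℝ (fderiv ℝ U) 0 :=
    (hU.fderiv_right (m := 1) (by norm_num)).differentiableAt one_ne_zero
  have hline0 : Tendsto (fun r : ℝ => (r, (0 : ℝ))) (𝓝 0) (𝓝 0) :=
    (hline 0).continuousAt.tendsto
  have hVd : ∀ᶠ r in 𝓝 (0 : ℝ), HasDerivAt V (fderiv ℝ U (r, 0) (1, 0)) r :=
    (hline0.eventually hUd).mono fun r hr => hr.hasFDerivAt.comp_hasDerivAt r (hline r)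
  have hV0 : HasDerivAt V (fderiv ℝ U (0, 0) (1, 0)) 0 := hVd.self_of_nhds
  set V' : ℝ → ℝ := fun r => fderiv ℝ U (r, 0) (1, 0) with hV'
  have hV'd : DifferentiableAt ℝ V' 0 := by
    have h1 : DifferentiableAt ℝ (fun r : ℝ => fderiv ℝ U (r, 0)) 0 :=
      DifferentiableAt.comp (f := fun r : ℝ => (r, (0 : ℝ))) (0 : ℝ) hU' (hline 0).differentiableAt
    exact h1.clm_apply (differentiableAt_const _)
  have hpos : ∀ᶠ s in 𝓝[interior γ.I] s₀, 0 < γ.x s :=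
    eventually_nhdsWithin_of_forall hr.x_pos
  -- The points of the curve at angles `0` and `π` have equal height, so the difference quotients of
  -- `V` at `x` and `-x` are opposite and the slope at the axis vanishes.
  have hVzero : V' 0 = 0 := by
    have hsl : Tendsto (fun r => (V r - V 0) / r) (𝓝[≠] 0) (𝓝 (V' 0)) := by
      have := hV0.tendsto_slope
      refine this.congr fun r => ?_
      rw [slope_def_field, sub_zero]
    have ht1 : Tendsto γ.x (𝓝[interior γ.I] s₀) (𝓝[≠] 0) :=
      tendsto_nhdsWithin_iff.2 ⟨hlim, hpos.mono fun s hs => hs.ne'⟩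
    have ht2 : Tendsto (fun s => -γ.x s) (𝓝[interior γ.I] s₀) (𝓝[≠] 0) :=
      tendsto_nhdsWithin_iff.2 ⟨by simpa using hlim.neg, hpos.mono fun s hs => by
        simpa using hs.ne'⟩
    have h1 := hsl.comp ht1
    have h2 := (hsl.comp ht2).neg
    have h3 : V' 0 = -V' 0 := by
      refine tendsto_nhds_unique_of_eventuallyEq h1 h2 ?_
      filter_upwards [nhdsWithin_mono s₀ interior_subset hev, hpos] with s hs hs'
      have e1 := hs 0
      have e2 := hs Real.pi
      simp only [Real.cos_zero, Real.sin_zero, Real.cos_pi, Real.sin_pi, mul_one, mul_zero,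
        mul_neg] at e1 e2
      simp only [Function.comp, hV, e1, e2]
      rw [div_neg, neg_neg]
    linarith
  -- `U` is `C²`, so `V'` is differentiable at `0` and vanishes linearly; then `z' = V'(x) x'` gives
  -- the bound.
  obtain ⟨C, hC⟩ : ∃ C, ∀ᶠ r in 𝓝 (0 : ℝ), |V' r| ≤ C * |r| := by
    obtain ⟨C, hC⟩ := hV'd.isBigO_sub.bound
    exact ⟨C, by simpa [hVzero] using hC⟩
  refine ⟨C, ?_⟩
  filter_upwards [hlim.eventually hVd, hlim.eventually hC, hpos, self_mem_nhdsWithin,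
    nhdsWithin_le_nhds (hWo.mem_nhds hWs)] with s h1 h2 h3 h4 h5
  obtain ⟨hx, -⟩ := hr.hasDerivAt h4
  have hz : HasDerivAt γ.z (V' (γ.x s) * deriv γ.x s) s := by
    refine (h1.comp s hx).congr_of_eventuallyEq ?_
    filter_upwards [hWo.mem_nhds h5, isOpen_interior.mem_nhds h4] with t ht ht'
    have := hW t ht (interior_subset ht') 0
    simp only [Real.cos_zero, Real.sin_zero, mul_one, mul_zero] at this
    exact this.symm
  have hp1 : |deriv γ.x s| ≤ 1 := by
    have := hr.arc_length s h4
    rw [abs_le]; constructor <;> nlinarith [sq_nonneg (deriv γ.z s)]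
  rw [hz.deriv, abs_mul]
  rw [abs_of_pos h3] at h2
  exact (mul_le_of_le_one_right (abs_nonneg _) hp1).trans h2

end ProfileCurve

theorem IsOpen.eq_of_hasDerivAt_zero {S : Set ℝ} (hS : IsOpen S) (hc : S.OrdConnected)
    {φ : ℝ → ℝ} (h : ∀ s ∈ S, HasDerivAt φ 0 s) {s t : ℝ} (hs : s ∈ S) (ht : t ∈ S) :
    φ s = φ t :=
  hS.is_const_of_deriv_eq_zero hc.isPreconnected
    (fun r hr => (h r hr).differentiableAt.differentiableWithinAt) (fun r hr => (h r hr).deriv) hs ht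

/-! ### Umbilical surfaces and the first integral of all the others. -/

namespace ProfileCurve

variable {g : ℝ → ℝ} {α : ℝ} {b : EReal} {γ : ProfileCurve}

namespace IsRotationalWeingarten

/-- A surface all of whose parallels have curvature `α` is a piece of a sphere. -/
theorem isOpenPieceOf_sphere (hg : IsEllipticWeingartenFunction g α)
    (hb : Tendsto (fun t : ℝ => (g t : EReal)) atTop (𝓝 b)) (hα : α ≠ 0)
    (h : γ.IsRotationalWeingarten g α)
    (hs : ∀ s ∈ interior γ.I, deriv γ.z s / γ.x s = α) : γ.IsOpenPieceOf (sphere α) := by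
  obtain ⟨s₁, hs₁⟩ := h.nonempty_interior
  set A := |α| with hA
  have hA0 : 0 < A := abs_pos.2 hα
  have hAA : A * A = α * α := abs_mul_abs_self α
  have hz' : ∀ s ∈ interior γ.I, deriv γ.z s = α * γ.x s := fun s hs' =>
    (div_eq_iff (h.x_pos s hs').ne').1 (hs s hs')
  have hp' : ∀ s ∈ interior γ.I, HasDerivAt (deriv γ.x) (-(A * A * γ.x s)) s := fun s hs' => by
    have := (profile_equation hg hb h hs').2.1
    rw [hs s hs', hg.f_center, hz' s hs', ← mul_assoc, ← hAA] at this
    exact this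
  have hE := fun s hs' => h.arc_length s hs'
  -- The phase of the harmonic oscillator `x'' = -A² x` at the base point, chosen so that `x' = cos`
  -- and `A x = sin` there.
  set φ := Real.arccos (deriv γ.x s₁) with hφ
  have hp1 : -1 ≤ deriv γ.x s₁ ∧ deriv γ.x s₁ ≤ 1 := by
    have := hE s₁ hs₁
    constructor <;> nlinarith [sq_nonneg (deriv γ.z s₁)]
  have hcos : Real.cos φ = deriv γ.x s₁ := Real.cos_arccos hp1.1 hp1.2
  have hsin : Real.sin φ = A * γ.x s₁ := by
    have hpos : 0 < A * γ.x s₁ := mul_pos hA0 (h.x_pos s₁ hs₁)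
    rw [hφ, Real.sin_arccos, ← hE s₁ hs₁, add_sub_cancel_left, hz' s₁ hs₁, Real.sqrt_eq_iff_mul_self_eq
      (sq_nonneg _) hpos.le]
    linear_combination (-(γ.x s₁) ^ 2) * hAA
  set θ : ℝ → ℝ := fun s => A * (s - s₁) + φ with hθ
  have hθd : ∀ s, HasDerivAt θ A s := fun s => by
    have := (((hasDerivAt_id s).sub_const s₁).const_mul A).add_const φ
    rwa [mul_one] at this
  -- The oscillator state, rotated back by the phase `θ`, is constant; this identity and the next
  -- fix it as `(0, 1)`, that is `A x = sin θ`.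
  have hconst₁ : ∀ s ∈ interior γ.I,
      A * γ.x s * Real.cos (θ s) - deriv γ.x s * Real.sin (θ s) = 0 := by
    intro s hs'
    have hd : ∀ t ∈ interior γ.I, HasDerivAt
        (fun t => A * γ.x t * Real.cos (θ t) - deriv γ.x t * Real.sin (θ t)) 0 t := by
      intro t ht
      have := (((h.hasDerivAt ht).1.const_mul A).fun_mul (hθd t).cos).fun_sub
        ((hp' t ht).fun_mul (hθd t).sin)
      refine this.congr_deriv ?_
      ring
    have := isOpen_interior.eq_of_hasDerivAt_zero h.interior_ordConnected hd hs' hs₁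
    rw [this]
    simp [hθ, hcos, hsin, mul_comm]
  have hconst₂ : ∀ s ∈ interior γ.I,
      A * γ.x s * Real.sin (θ s) + deriv γ.x s * Real.cos (θ s) = 1 := by
    intro s hs'
    have hd : ∀ t ∈ interior γ.I, HasDerivAt
        (fun t => A * γ.x t * Real.sin (θ t) + deriv γ.x t * Real.cos (θ t)) 0 t := by
      intro t ht
      have := (((h.hasDerivAt ht).1.const_mul A).fun_mul (hθd t).sin).fun_add
        ((hp' t ht).fun_mul (hθd t).cos)
      refine this.congr_deriv ?_
      ring
    have := isOpen_interior.eq_of_hasDerivAt_zero h.interior_ordConnected hd hs' hs₁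
    rw [this]
    simp only [hθ, sub_self, mul_zero, zero_add]
    rw [← hsin, ← hcos, ← sq, ← sq, Real.sin_sq_add_cos_sq]
  have hx : ∀ s ∈ interior γ.I, A * γ.x s = Real.sin (θ s) := fun s hs' => by
    linear_combination Real.cos (θ s) * hconst₁ s hs' + Real.sin (θ s) * hconst₂ s hs' -
      A * γ.x s * Real.sin_sq_add_cos_sq (θ s)
  have hφ0 : 0 < φ ∧ φ < Real.pi := by
    have hpos : 0 < Real.sin φ := by rw [hsin]; exact mul_pos hA0 (h.x_pos s₁ hs₁)
    have h1 := Real.arccos_nonneg (deriv γ.x s₁)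
    have h2 := Real.arccos_le_pi (deriv γ.x s₁)
    refine ⟨lt_of_le_of_ne h1 fun h0 => ?_, lt_of_le_of_ne h2 fun h0 => ?_⟩
    · rw [← h0, Real.sin_zero] at hpos; exact hpos.false
    · rw [h0, Real.sin_pi] at hpos; exact hpos.false
  -- As `x > 0`, the connected range of `θ` avoids the zeros `0` and `π` of the sine and stays
  -- between them.
  have hθmem : ∀ s ∈ interior γ.I, θ s ∈ Ioo 0 Real.pi := by
    have hzero : ∀ c, Real.sin c = 0 → ∀ s ∈ interior γ.I, θ s ≠ c := by
      intro c hc s hs' hsc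
      have := hx s hs'
      rw [hsc, hc] at this
      exact (mul_pos hA0 (h.x_pos s hs')).ne' this
    have himg : (θ '' interior γ.I).OrdConnected :=
      (h.interior_ordConnected.isPreconnected.image θ
        (fun s _ => (hθd s).continuousAt.continuousWithinAt)).ordConnected
    have hθ₁ : θ s₁ = φ := by simp [hθ]
    intro s hs'
    constructor
    · by_contra hcon
      obtain ⟨r, hr, hr0⟩ := himg.out (mem_image_of_mem θ hs') (mem_image_of_mem θ hs₁)
        ⟨not_lt.1 hcon, by rw [hθ₁]; exact hφ0.1.le⟩
      exact hzero 0 Real.sin_zero r hr hr0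
    · by_contra hcon
      obtain ⟨r, hr, hr0⟩ := himg.out (mem_image_of_mem θ hs₁) (mem_image_of_mem θ hs')
        ⟨by rw [hθ₁]; exact hφ0.2.le, not_lt.1 hcon⟩
      exact hzero _ Real.sin_pi r hr hr0
  set s₀ := φ / A - s₁ with hs₀
  have hθs : ∀ s, A * (s + s₀) = θ s := fun s => by
    simp only [hs₀, hθ]; field_simp; ring
  have hzc : ∀ s ∈ interior γ.I, γ.z s + Real.cos (θ s) / α =
      γ.z s₁ + Real.cos (θ s₁) / α := by
    intro s hs'
    refine isOpen_interior.eq_of_hasDerivAt_zero h.interior_ordConnected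
      (φ := fun s => γ.z s + Real.cos (θ s) / α) (fun t ht => ?_) hs' hs₁
    have := (h.hasDerivAt ht).2.fun_add ((hθd t).cos.div_const α)
    refine this.congr_deriv ?_
    rw [hz' t ht, ← hx t ht]
    field_simp
    linear_combination -(γ.x t) * hAA
  -- An end point belonging to the interval is a limit of interior points, so the identities and the
  -- bounds on `θ` reach it by continuity.
  refine ⟨s₀, γ.z s₁ + Real.cos (θ s₁) / α, fun s hs' => ?_⟩
  have hcl := h.subset_closure_interior hs'
  have hne : (𝓝[interior γ.I] s).NeBot := mem_closure_iff_nhdsWithin_neBot.1 hcl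
  have hθc : Continuous θ := continuous_iff_continuousAt.2 fun s => (hθd s).continuousAt
  have hxs : γ.x s = Real.sin (θ s) / A := by
    refine tendsto_nhds_unique_of_eventuallyEq ((h.continuousOn_x s hs').mono interior_subset)
      ((Continuous.continuousAt (f := fun s => Real.sin (θ s) / A) (by fun_prop)).tendsto.mono_left
        nhdsWithin_le_nhds) ?_
    filter_upwards [self_mem_nhdsWithin] with t ht
    rw [eq_div_iff hA0.ne', mul_comm]; exact hx t ht
  have hzs : γ.z s = -(Real.cos (θ s) / α) + (γ.z s₁ + Real.cos (θ s₁) / α) := by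
    refine tendsto_nhds_unique_of_eventuallyEq ((h.continuousOn_z s hs').mono interior_subset)
      ((Continuous.continuousAt (f := fun s => -(Real.cos (θ s) / α) +
        (γ.z s₁ + Real.cos (θ s₁) / α)) (by fun_prop)).tendsto.mono_left nhdsWithin_le_nhds) ?_
    filter_upwards [self_mem_nhdsWithin] with t ht
    linarith [hzc t ht]
  have hmem : θ s ∈ Icc 0 Real.pi := by
    have : θ s ∈ closure (Ioo 0 Real.pi) :=
      map_mem_closure hθc hcl fun t ht => hθmem t ht
    rwa [closure_Ioo Real.pi_pos.ne] at this
  rw [← hθs] at hmem hxs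
  refine ⟨⟨?_, ?_⟩, hxs, ?_⟩
  · exact nonneg_of_mul_nonneg_right hmem.1 hA0
  · show s + s₀ ≤ Real.pi / A
    rw [le_div_iff₀ hA0]; linarith [hmem.2]
  · show γ.z s = -(Real.cos (A * (s + s₀)) / α) + _
    rw [hθs]; exact hzs

/-- Away from spheres, the parallels never have curvature `α`, and `exp F` of that curvature is
the distance to the axis, for a suitable primitive `F`. -/
theorem exists_first_integral (hg : IsEllipticWeingartenFunction g α)
    (hb : Tendsto (fun t : ℝ => (g t : EReal)) atTop (𝓝 b)) (h : γ.IsRotationalWeingarten g α)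
    (hns : ¬ ∀ s ∈ interior γ.I, deriv γ.z s / γ.x s = α) :
    ∃ F, IsWeingartenPrimitive g α b F ∧
      (∀ s ∈ interior γ.I, γ.x s = Real.exp (F (deriv γ.z s / γ.x s))) ∧
      ((∀ s ∈ interior γ.I, α < deriv γ.z s / γ.x s) ∨
        ∀ s ∈ interior γ.I, deriv γ.z s / γ.x s < α) := by
  classical
  obtain ⟨F₀, hF₀⟩ := hg.exists_primitive hb
  set l : ℝ → ℝ := fun s => deriv γ.z s / γ.x s with hl
  push Not at hns
  obtain ⟨s₁, hs₁, hls₁⟩ := hns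
  have hld : ∀ s ∈ interior γ.I, HasDerivAt l (deriv γ.x s / γ.x s * (weingartenF g α (l s) - l s)) s := by
    intro s hs
    have hx0 := (h.x_pos s hs).ne'
    have := (profile_equation hg hb h hs).2.2.fun_div (h.hasDerivAt hs).1 hx0
    refine this.congr_deriv ?_
    show _ = deriv γ.x s / γ.x s * (weingartenF g α (deriv γ.z s / γ.x s) - deriv γ.z s / γ.x s)
    field_simp
  have hbl : ∀ s ∈ interior γ.I, b < (l s : EReal) := fun s hs => (profile_equation hg hb h hs).1
  -- `exp(-F₀)` extended by `0` at `α`, continuous because `F₀ → +∞` there. Thus `Φ = x Ψ(λ)` is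
  -- continuous even if `λ` were to meet `α`.
  set Ψ : ℝ → ℝ := fun t => if t = α then 0 else Real.exp (-F₀ t) with hΨ
  have hΨc : ∀ t : ℝ, b < (t : EReal) → ContinuousAt Ψ t := by
    intro t ht
    by_cases hta : t = α
    · rw [hta, ContinuousAt, ← nhdsNE_sup_pure, tendsto_sup]
      refine ⟨?_, tendsto_pure_nhds _ _⟩
      have h1 : Tendsto (fun t => Real.exp (-F₀ t)) (𝓝[≠] α) (𝓝 0) :=
        Real.tendsto_exp_neg_atTop_nhds_zero.comp (hg.tendsto_primitive_center hb hF₀)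
      have h2 : Ψ α = 0 := if_pos rfl
      rw [h2]
      refine h1.congr' ?_
      filter_upwards [self_mem_nhdsWithin] with s hs
      exact (if_neg hs).symm
    · refine (hF₀ t ht hta).continuousAt.neg.rexp.congr ?_
      filter_upwards [isOpen_ne.mem_nhds hta] with s hs
      exact (if_neg hs).symm
  set Φ : ℝ → ℝ := fun s => γ.x s * Ψ (l s) with hΦ
  have hΦc : ContinuousOn Φ (interior γ.I) := fun s hs =>
    ((h.hasDerivAt hs).1.continuousAt.mul
      (ContinuousAt.comp (hΨc _ (hbl s hs)) (hld s hs).continuousAt)).continuousWithinAt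
  have hΦpos : ∀ s ∈ interior γ.I, l s ≠ α → 0 < Φ s := fun s hs hne => by
    simp only [hΦ, hΨ, if_neg hne]
    exact mul_pos (h.x_pos s hs) (Real.exp_pos _)
  have hΦd : ∀ s ∈ interior γ.I, l s ≠ α → HasDerivAt Φ 0 s := by
    intro s hs hne
    have hev : Φ =ᶠ[𝓝 s] fun s => γ.x s * Real.exp (-F₀ (l s)) := by
      filter_upwards [(hld s hs).continuousAt.eventually (isOpen_ne.mem_nhds hne)] with t ht
      simp only [hΦ, hΨ, if_neg (show l t ≠ α from ht)]
    refine HasDerivAt.congr_of_eventuallyEq ?_ hev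
    have := (h.hasDerivAt hs).1.fun_mul
      (((hF₀ _ (hbl s hs) hne).comp s (hld s hs)).fun_neg.exp)
    refine this.congr_deriv ?_
    have hx0 := (h.x_pos s hs).ne'
    have hf0 := hg.f_sub_ne hb (hbl s hs) hne
    field_simp
    ring
  set c := Φ s₁ with hc
  have hc0 : 0 < c := hΦpos s₁ hs₁ hls₁
  -- Connectedness argument: where `Φ = c > 0` one has `λ ≠ α`, so `Φ` is locally constant and the
  -- level set is open; it is relatively closed by continuity.
  set u : Set ℝ := interior γ.I ∩ {s | Φ s = c} with hu
  have hne_of : ∀ s, Φ s = c → l s ≠ α := by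
    intro s hs h0
    simp only [hΦ, hΨ, if_pos h0, mul_zero] at hs
    exact hc0.ne hs
  have huo : IsOpen u := by
    rw [isOpen_iff_mem_nhds]
    rintro s ⟨hs, hsc⟩
    have hne := hne_of s hsc
    obtain ⟨ε, hε, hball⟩ := Metric.eventually_nhds_iff_ball.1
      ((isOpen_interior.eventually_mem hs).and
        ((hld s hs).continuousAt.eventually (isOpen_ne.mem_nhds hne)))
    filter_upwards [Metric.ball_mem_nhds s hε] with t ht
    refine ⟨(hball t ht).1, ?_⟩
    rw [Real.ball_eq_Ioo] at hball ht
    have := isOpen_Ioo.eq_of_hasDerivAt_zero ordConnected_Ioo (φ := Φ)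
      (fun r hr => hΦd r (hball r hr).1 (hball r hr).2) ht (show s ∈ Ioo (s - ε) (s + ε) from ⟨by linarith, by linarith⟩)
    exact this.trans hsc
  have hsub : interior γ.I ⊆ u := by
    refine h.interior_ordConnected.isPreconnected.subset_of_closure_inter_subset huo
      ⟨s₁, hs₁, hs₁, rfl⟩ ?_
    rintro s ⟨hscl, hs⟩
    refine ⟨hs, ?_⟩
    have hne : (𝓝[u] s).NeBot := mem_closure_iff_nhdsWithin_neBot.1 hscl
    refine tendsto_nhds_unique ((hΦc s hs).mono inter_subset_left : Tendsto Φ (𝓝[u] s) _)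
      (tendsto_const_nhds.congr' ?_)
    filter_upwards [self_mem_nhdsWithin] with t ht
    exact ht.2.symm
  have hlne : ∀ s ∈ interior γ.I, l s ≠ α := fun s hs => hne_of s (hsub hs).2
  -- The constant of integration is absorbed into the primitive.
  refine ⟨fun t => F₀ t + Real.log c, fun t hbt ht => (hF₀ t hbt ht).add_const _, fun s hs => ?_, ?_⟩
  · have h1 : Φ s = c := (hsub hs).2
    simp only [hΦ, hΨ, if_neg (hlne s hs)] at h1
    rw [Real.exp_add, Real.exp_log hc0, ← h1, mul_left_comm, ← Real.exp_add, add_neg_cancel,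
      Real.exp_zero, mul_one]
  · have himg : (l '' interior γ.I).OrdConnected :=
      (h.interior_ordConnected.isPreconnected.image l
        (fun s hs => (hld s hs).continuousAt.continuousWithinAt)).ordConnected
    rcases (hlne s₁ hs₁).lt_or_gt with h1 | h1
    · refine Or.inr fun s hs => ?_
      by_contra hcon
      obtain ⟨r, hr, hr'⟩ := himg.out (mem_image_of_mem l hs₁) (mem_image_of_mem l hs)
        ⟨h1.le, not_lt.1 hcon⟩
      exact hlne r hr hr'
    · refine Or.inl fun s hs => ?_
      by_contra hcon
      obtain ⟨r, hr, hr'⟩ := himg.out (mem_image_of_mem l hs) (mem_image_of_mem l hs₁)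
        ⟨not_lt.1 hcon, h1.le⟩
      exact hlne r hr hr'

end IsRotationalWeingarten

end ProfileCurve

/-! ### Surfaces following a branch -/

namespace IsBranch

variable {g : ℝ → ℝ} {α : ℝ} {b : EReal} {σ u₀ : ℝ} {M K : ℝ → ℝ}

theorem sign_mul_self (h : IsBranch g α b σ u₀ M K) : σ * σ = 1 := by
  rcases h.sign with rfl | rfl <;> norm_num

theorem sign_ne_zero (h : IsBranch g α b σ u₀ M K) : σ ≠ 0 := by
  rcases h.sign with rfl | rfl <;> norm_num

theorem abs_sign_mul (h : IsBranch g α b σ u₀ M K) (a : ℝ) : |σ * a| = |a| := by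
  rcases h.sign with rfl | rfl <;> simp

/-- The equation `u M' = K - M` is precisely `(u M)' = K`. -/
theorem potential (h : IsBranch g α b σ u₀ M K) : IsPotential u₀ (fun u => u * M u) K where
  hasDerivAt u hu := by
    have hu0 : u ≠ 0 := (h.nonneg.trans_lt hu).ne'
    refine ((hasDerivAt_id u).fun_mul (h.deriv u hu)).congr_deriv ?_
    simp only [id]
    field_simp
    ring
  locallyLipschitzOn := h.locallyLipschitzOn

end IsBranch

namespace ProfileCurve

variable {g : ℝ → ℝ} {α : ℝ} {b : EReal} {σ u₀ : ℝ} {M K : ℝ → ℝ} {γ δ : ProfileCurve}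

/-- The parallel of `γ` at distance `x` from the axis has curvature `σ M(x)`. -/
structure Follows (γ : ProfileCurve) (σ u₀ : ℝ) (M : ℝ → ℝ) : Prop where
  lt : ∀ s ∈ interior γ.I, u₀ < γ.x s
  deriv_z : ∀ s ∈ interior γ.I, deriv γ.z s = σ * (γ.x s * M (γ.x s))

namespace Follows

theorem div_eq (h : γ.Follows σ u₀ M) (hr : γ.IsRotationalWeingarten g α) {s : ℝ}
    (hs : s ∈ interior γ.I) : deriv γ.z s / γ.x s = σ * M (γ.x s) := by
  rw [h.deriv_z s hs, div_eq_iff (hr.x_pos s hs).ne']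
  ring

/-- In the profile equation the sign enters twice, through `z' = σ H(x)` and `f(λ) = σ K(x)`, and
cancels. -/
theorem orbitOn (hg : IsEllipticWeingartenFunction g α)
    (hb : Tendsto (fun t : ℝ => (g t : EReal)) atTop (𝓝 b)) (h : γ.Follows σ u₀ M)
    (hB : IsBranch g α b σ u₀ M K) (hr : γ.IsRotationalWeingarten g α) :
    OrbitOn u₀ (fun u => u * M u) K (interior γ.I) γ.x (deriv γ.x) where
  lt := h.lt
  hasDerivAt_x s hs := (hr.hasDerivAt hs).1
  hasDerivAt_p s hs := by
    have := (IsRotationalWeingarten.profile_equation hg hb hr hs).2.1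
    rw [h.div_eq hr hs, hB.relation _ (h.lt s hs), h.deriv_z s hs] at this
    refine this.congr_deriv ?_
    linear_combination -(K (γ.x s) * (γ.x s * M (γ.x s))) * hB.sign_mul_self
  energy s hs := by
    have := hr.arc_length s hs
    rw [h.deriv_z s hs] at this
    rw [← this]
    linear_combination -(γ.x s * M (γ.x s)) ^ 2 * hB.sign_mul_self

theorem hasPrincipalCurvatures_iff (hg : IsEllipticWeingartenFunction g α)
    (hb : Tendsto (fun t : ℝ => (g t : EReal)) atTop (𝓝 b)) (h : γ.Follows σ u₀ M)
    (hB : IsBranch g α b σ u₀ M K) (hr : γ.IsRotationalWeingarten g α) {s θ k₁ k₂ : ℝ}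
    (hs : s ∈ interior γ.I) : HasPrincipalCurvatures γ.param γ.normal (s, θ) k₁ k₂ ↔
      (k₁ = σ * K (γ.x s) ∧ k₂ = σ * M (γ.x s)) ∨ (k₁ = σ * M (γ.x s) ∧ k₂ = σ * K (γ.x s)) := by
  rw [IsRotationalWeingarten.hasPrincipalCurvatures_iff hg hb hr hs, h.div_eq hr hs,
    hB.relation _ (h.lt s hs)]

/-- A surface following a branch has no poles. -/
theorem isOpen (h : γ.Follows σ u₀ M) (hB : IsBranch g α b σ u₀ M K)
    (hr : γ.IsRotationalWeingarten g α) : IsOpen γ.I := by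
  rw [← interior_eq_iff_isOpen]
  refine interior_subset.antisymm fun s hs => ?_
  by_contra hcon
  obtain ⟨hlim, C, hC⟩ := (hr.pole s ⟨hs, hcon⟩).exists_bound hr hs
  have hne : (𝓝[interior γ.I] s).NeBot :=
    mem_closure_iff_nhdsWithin_neBot.1 (hr.subset_closure_interior hs)
  -- A pole can only occur for `u₀ = 0`, where `|M| → ∞`; but near a regular pole the curvature of
  -- the parallels is bounded.
  have h0 : u₀ = 0 := by
    refine le_antisymm (ge_of_tendsto hlim ?_) hB.nonneg
    filter_upwards [self_mem_nhdsWithin] with t ht using (h.lt t ht).le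
  have hlim' : Tendsto γ.x (𝓝[interior γ.I] s) (𝓝[>] u₀) :=
    tendsto_nhdsWithin_iff.2 ⟨by rwa [h0], by
      filter_upwards [self_mem_nhdsWithin] with t ht using h.lt t ht⟩
  have hinf := (hB.pinch h0).comp hlim'
  obtain ⟨t, ht⟩ := ((hinf.eventually (eventually_gt_atTop C)).and
    (hC.and self_mem_nhdsWithin)).exists
  obtain ⟨h1, h2, h3⟩ := ht
  have hx := hr.x_pos t h3
  rw [h.deriv_z t h3, hB.abs_sign_mul, abs_mul, abs_of_pos hx, mul_comm] at h2
  exact absurd (le_of_mul_le_mul_right h2 hx) (not_le.2 h1)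

/-- Since `z'` is the same function of `x` on both curves, matching `x` after a shift forces the
heights to differ by a constant. -/
theorem isOpenPieceOf (hδ : ∀ s ∈ δ.I, HasDerivAt δ.z (σ * (δ.x s * M (δ.x s))) s)
    (h : γ.Follows σ u₀ M) (hB : IsBranch g α b σ u₀ M K) (hr : γ.IsRotationalWeingarten g α)
    {c : ℝ} (hc : ∀ s ∈ interior γ.I, s + c ∈ δ.I ∧ γ.x s = δ.x (s + c)) : γ.IsOpenPieceOf δ := by
  have hI := (h.isOpen hB hr).interior_eq
  obtain ⟨s₁, hs₁⟩ := hr.nonempty_interior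
  refine ⟨c, γ.z s₁ - δ.z (s₁ + c), fun s hs => ?_⟩
  rw [← hI] at hs
  refine ⟨(hc s hs).1, (hc s hs).2, ?_⟩
  have := isOpen_interior.eq_of_hasDerivAt_zero hr.interior_ordConnected
    (φ := fun s => γ.z s - δ.z (s + c)) (fun t ht => by
      have := (hr.hasDerivAt ht).2.fun_sub ((hδ _ (hc t ht).1).comp_add_const t c)
      refine this.congr_deriv ?_
      rw [h.deriv_z t ht, ← (hc t ht).2, sub_self]) hs hs₁
  linarith

end Follows

/-- Converse of `Follows.orbitOn`: this turns the orbits constructed above into surfaces of the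
class. -/
theorem isRotationalWeingarten_of_orbit (hg : IsEllipticWeingartenFunction g α)
    (hb : Tendsto (fun t : ℝ => (g t : EReal)) atTop (𝓝 b)) (hB : IsBranch g α b σ u₀ M K)
    (hI : IsOpen γ.I) (hIc : γ.I.OrdConnected) (hne : γ.I.Nonempty) {p : ℝ → ℝ}
    (horb : OrbitOn u₀ (fun u => u * M u) K γ.I γ.x p)
    (hz : ∀ s ∈ γ.I, HasDerivAt γ.z (σ * (γ.x s * M (γ.x s))) s) :
    γ.IsRotationalWeingarten g α ∧ γ.Follows σ u₀ M := by
  have e : ∀ s, σ * M (γ.x s) * γ.x s = σ * (γ.x s * M (γ.x s)) := fun s => by ring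
  have hσ := hB.sign_mul_self
  refine ⟨isRotationalWeingarten_of hg hb (p := p) (l := fun s => σ * M (γ.x s)) hI hIc hne
    (fun s hs => hB.nonneg.trans_lt (horb.lt s hs)) horb.hasDerivAt_x
    (fun s hs => by rw [e]; exact hz s hs) (fun s hs => ?_) (fun s hs => ?_)
    (fun s hs => hB.range _ (horb.lt s hs)) (fun s hs => ?_) ?_, fun s hs => ?_, fun s hs => ?_⟩
  · refine (horb.hasDerivAt_p s hs).congr_deriv ?_
    rw [hB.relation _ (horb.lt s hs)]
    linear_combination K (γ.x s) * (γ.x s * M (γ.x s)) * hσ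
  · simp only [e]
    rw [hB.relation _ (horb.lt s hs), mul_assoc]
    exact ((hB.potential.hasDerivAt _ (horb.lt s hs)).comp s (horb.hasDerivAt_x s hs)).const_mul σ
  · rw [e, ← horb.energy s hs]
    linear_combination (γ.x s * M (γ.x s)) ^ 2 * hσ
  · have h1 : ContinuousOn (fun s => σ * K (γ.x s)) γ.I :=
      (hB.potential.continuousOn_deriv.comp horb.continuousOn_x horb.lt).const_smul σ
    exact h1.congr fun s hs => hB.relation _ (horb.lt s hs)
  · exact horb.lt s (interior_subset hs)
  · exact (hz s (interior_subset hs)).deriv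

/-- Every surface of the class that is not a piece of a sphere follows one of the two sides. -/
theorem IsRotationalWeingarten.exists_follows (hg : IsEllipticWeingartenFunction g α)
    (hb : Tendsto (fun t : ℝ => (g t : EReal)) atTop (𝓝 b)) (hr : γ.IsRotationalWeingarten g α)
    (hns : ¬ ∀ s ∈ interior γ.I, deriv γ.z s / γ.x s = α) :
    ∃ F u₀ Λ, IsWeingartenPrimitive g α b F ∧
      (∀ σ : ℝ, σ * σ = 1 → γ.Follows σ u₀ fun u => σ * Λ u) ∧
      (IsSideInverse (weingartenF g α) (Ioi α) F u₀ Λ ∨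
        IsSideInverse (weingartenF g α) ({t : ℝ | b < (t : EReal)} ∩ Iio α) F u₀ Λ) := by
  obtain ⟨F, hF, hexp, hside⟩ := hr.exists_first_integral hg hb hns
  have key : ∀ J u₀ Λ, IsSideInverse (weingartenF g α) J F u₀ Λ →
      (∀ s ∈ interior γ.I, deriv γ.z s / γ.x s ∈ J) →
      ∀ σ : ℝ, σ * σ = 1 → γ.Follows σ u₀ fun u => σ * Λ u := by
    intro J u₀ Λ hΛ hJ σ hσ
    refine ⟨fun s hs => ?_, fun s hs => ?_⟩
    · rw [hexp s hs]; exact hΛ.lt_exp _ (hJ s hs)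
    · have h1 : Λ (γ.x s) = deriv γ.z s / γ.x s := by
        conv_lhs => rw [hexp s hs]
        exact hΛ.apply_exp _ (hJ s hs)
      have hx := (hr.x_pos s hs).ne'
      simp only [h1]
      field_simp
      linear_combination (-deriv γ.z s) * hσ
  rcases hside with h | h
  · obtain ⟨u₀, Λ, hΛ⟩ := hg.exists_right_inverse hb hF
    exact ⟨F, u₀, Λ, hF, key _ _ _ hΛ h, Or.inl hΛ⟩
  · obtain ⟨u₀, Λ, hΛ⟩ := hg.exists_left_inverse hb hF
    exact ⟨F, u₀, Λ, hF, key _ _ _ hΛ fun s hs =>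
      ⟨(profile_equation hg hb hr hs).1, h s hs⟩, Or.inr hΛ⟩

end ProfileCurve

/-! ### Orbits of undular and nodal branches -/

namespace IsUndularBranch

variable {g : ℝ → ℝ} {α : ℝ} {b : EReal} {σ u₀ : ℝ} {M K : ℝ → ℝ}

theorem potential_pos (h : IsUndularBranch g α b σ u₀ M K) {u : ℝ} (hu : u₀ < u) : 0 < u * M u :=
  mul_pos (h.nonneg.trans_lt hu) (h.pos u hu)

theorem strictAntiOn_potential (h : IsUndularBranch g α b σ u₀ M K) {v : ℝ} (hv : u₀ < v)
    (hKv : K v = 0) : StrictAntiOn (fun u => u * M u) (Ioc u₀ v) :=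
  strictAntiOn_of_deriv_neg (convex_Ioc _ _)
    (h.potential.continuousOn.mono Ioc_subset_Ioi_self) fun u hu => by
      rw [interior_Ioc] at hu
      rw [(h.potential.hasDerivAt u hu.1).deriv, ← hKv]
      exact h.strictMonoOn hu.1 hv hu.2

theorem strictMonoOn_potential (h : IsUndularBranch g α b σ u₀ M K) {v : ℝ} (hv : u₀ < v)
    (hKv : K v = 0) : StrictMonoOn (fun u => u * M u) (Ici v) :=
  strictMonoOn_of_deriv_pos (convex_Ici _)
    (h.potential.continuousOn.mono (Ici_subset_Ioi.2 hv)) fun u hu => by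
      rw [interior_Ici] at hu
      rw [(h.potential.hasDerivAt u (hv.trans hu)).deriv, ← hKv]
      exact h.strictMonoOn hv (hv.trans hu) hu

theorem critical_le (h : IsUndularBranch g α b σ u₀ M K) {v : ℝ} (hv : u₀ < v)
    (hKv : K v = 0) {u : ℝ} (hu : u₀ < u) (huv : u ≠ v) : v * M v < u * M u := by
  rcases huv.lt_or_gt with h1 | h1
  · exact h.strictAntiOn_potential hv hKv ⟨hu, h1.le⟩ ⟨hv, le_rfl⟩ h1
  · exact h.strictMonoOn_potential hv hKv self_mem_Ici h1.le h1

theorem exists_bulge (h : IsUndularBranch g α b σ u₀ M K) {v : ℝ} (hv : u₀ < v)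
    (hKv : K v = 0) (h1 : v * M v < 1) : ∃ x₁ > v, x₁ * M x₁ = 1 ∧ 0 < K x₁ ∧
      (∀ u ∈ Ico v x₁, |u * M u| < 1) ∧ ∀ u > u₀, |u * M u| ≤ 1 → u ≤ x₁ := by
  have hmono := h.strictMonoOn_potential hv hKv
  obtain ⟨w, hw, hvw⟩ := ((h.atTop.eventually (eventually_ge_atTop 1)).and
    (eventually_ge_atTop v)).exists
  obtain ⟨x₁, hx₁, he⟩ := intermediate_value_Icc hvw
    (h.potential.continuousOn.mono fun u hu => hv.trans_le hu.1) ⟨h1.le, hw⟩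
  simp only at he
  have hvx : v < x₁ := lt_of_le_of_ne hx₁.1 fun e => by rw [e, he] at h1; exact lt_irrefl _ h1
  refine ⟨x₁, hvx, he, ?_, fun u hu => ?_, fun u hu hle => ?_⟩
  · rw [← hKv]; exact h.strictMonoOn hv (hv.trans hvx) hvx
  · rw [abs_of_pos (h.potential_pos (hv.trans_le hu.1)), ← he]
    exact hmono hu.1 hvx.le hu.2
  · by_contra hcon
    have hcon := not_le.1 hcon
    have := hmono hvx.le (hvx.trans hcon).le hcon
    simp only [he] at this
    linarith [le_abs_self (u * M u)]

/-- Starting from a limit `l ≤ 1`, `H` is strictly decreasing up to its minimum, hence `H < 1` up to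
the bulge even when `l = 1`. Near `u₀` the slope `K` is bounded away from `0` because it is
increasing and negative there, so `u₀` is reached in finite time. -/
theorem exists_terminatingOrbit (h : IsUndularBranch g α b σ u₀ M K) {l : ℝ}
    (hl : Tendsto (fun u => u * M u) (𝓝[>] u₀) (𝓝 l)) (hl1 : l ≤ 1) :
    ∃ x₁ a x p, IsTerminatingOrbit u₀ (fun u => u * M u) K x₁ a x p ∧
      ∀ u > u₀, |u * M u| ≤ 1 → u ≤ x₁ := by
  obtain ⟨v, hv, hKv⟩ := h.exists_critical
  have hanti := h.strictAntiOn_potential hv hKv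
  have hlt : ∀ u ∈ Ioc u₀ v, u * M u < 1 := fun u hu => by
    obtain ⟨w, hw, hwu⟩ := exists_between hu.1
    have h1 : w * M w ≤ l := by
      refine ge_of_tendsto hl ?_
      filter_upwards [Ioo_mem_nhdsGT hw] with t ht
      exact (hanti ⟨ht.1, ht.2.le.trans (hwu.le.trans hu.2)⟩ ⟨hw, hwu.le.trans hu.2⟩ ht.2).le
    exact (hanti ⟨hw, hwu.le.trans hu.2⟩ hu hwu).trans_le (h1.trans hl1)
  obtain ⟨x₁, hvx, he, hK, hIco, hle⟩ := h.exists_bulge hv hKv (hlt v ⟨hv, le_rfl⟩)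
  obtain ⟨w, hw, hwv⟩ := exists_between hv
  have hKw : K w < 0 := hKv ▸ h.strictMonoOn hw hv hwv
  obtain ⟨x, p, a, hx, hreach⟩ := h.potential.exists_orbit_to_end (hv.trans hvx) he hK
    (fun u hu => by
      rcases le_or_gt v u with h1 | h1
      · exact hIco u ⟨h1, hu.2⟩
      · show |u * M u| < 1
        rw [abs_of_pos (h.potential_pos hu.1)]
        exact hlt u ⟨hu.1, h1.le⟩) (neg_pos.2 hKw) hw
    (fun u hu => by
      have := h.strictMonoOn hu.1 hw hu.2
      rw [abs_of_neg (this.trans hKw)]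
      linarith)
  exact ⟨x₁, a, x, p, ⟨hx, h.potential, hreach⟩, hle⟩

theorem exists_periodicOrbit (h : IsUndularBranch g α b σ u₀ M K) {v x₀ : ℝ} (hv : u₀ < v)
    (hKv : K v = 0) (h1 : v * M v < 1) (h₀ : u₀ < x₀) (h₀v : x₀ < v) (hx₀ : x₀ * M x₀ = 1) :
    ∃ x₁ T x p, IsPeriodicOrbit u₀ (fun u => u * M u) K x₀ x₁ T x p ∧ x₀ < x₁ ∧
      ∀ u > u₀, |u * M u| ≤ 1 → u ∈ Icc x₀ x₁ := by
  obtain ⟨x₁, hvx, he, hK, hIco, hle⟩ := h.exists_bulge hv hKv h1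
  have hanti := h.strictAntiOn_potential hv hKv
  have hK₀ : K x₀ < 0 := hKv ▸ h.strictMonoOn h₀ hv h₀v
  obtain ⟨x, p, T, hx, hxT, hpT, hIcc⟩ := h.potential.exists_orbit_to_neck h₀ (h₀v.trans hvx) he hK
    (fun u hu => by
      rcases le_or_gt v u with h1 | h1
      · exact hIco u ⟨h1, hu.2⟩
      · show |u * M u| < 1
        rw [abs_of_pos (h.potential_pos (h₀.trans hu.1)), ← hx₀]
        exact hanti ⟨h₀, h₀v.le⟩ ⟨h₀.trans hu.1, h1.le⟩ hu.1)
    (show |x₀ * M x₀| = 1 by rw [hx₀, abs_one])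
    (show x₀ * M x₀ * K x₀ < 0 by rwa [hx₀, one_mul])
  refine ⟨x₁, T, x, p, ⟨hx, h.potential, hxT, hpT, hIcc⟩, h₀v.trans hvx, fun u hu hu1 =>
    ⟨not_lt.1 fun hcon => ?_, hle u hu hu1⟩⟩
  have := hanti ⟨hu, (hcon.trans h₀v).le⟩ ⟨h₀, h₀v.le⟩ hcon
  simp only [hx₀] at this
  linarith [le_abs_self (u * M u)]

/-- The three possibilities for the neck of an undular branch. -/
theorem trichotomy (h : IsUndularBranch g α b σ u₀ M K) {u v : ℝ} (hu : u₀ < u)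
    (hu1 : |u * M u| ≤ 1) (hv : u₀ < v) (hKv : K v = 0) :
    (v * M v = 1 ∧ ∀ w > u₀, |w * M w| ≤ 1 → w = v) ∨
      (v * M v < 1 ∧ ∃ x₀ > u₀, x₀ < v ∧ x₀ * M x₀ = 1) ∨
      ∃ l ≤ 1, Tendsto (fun u => u * M u) (𝓝[>] u₀) (𝓝 l) := by
  have hle : v * M v ≤ 1 := by
    rcases eq_or_ne u v with rfl | huv
    · exact (le_abs_self _).trans hu1
    · exact (h.critical_le hv hKv hu huv).le.trans ((le_abs_self _).trans hu1)
  rcases hle.eq_or_lt with he | hlt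
  · refine Or.inl ⟨he, fun w hw hw1 => ?_⟩
    by_contra hwv
    have := h.critical_le hv hKv hw hwv
    linarith [le_abs_self (w * M w)]
  refine Or.inr ?_
  have hanti := h.strictAntiOn_potential hv hKv
  by_cases hex : ∃ w ∈ Ioo u₀ v, 1 ≤ w * M w
  · obtain ⟨w, hw, hw1⟩ := hex
    obtain ⟨x₀, hx₀, he⟩ := intermediate_value_Icc' hw.2.le
      (h.potential.continuousOn.mono fun u hu => hw.1.trans_le hu.1) ⟨hlt.le, hw1⟩
    simp only at he
    exact Or.inl ⟨hlt, x₀, hw.1.trans_le hx₀.1, lt_of_le_of_ne hx₀.2 fun e => by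
      rw [← e, he] at hlt; exact lt_irrefl _ hlt, he⟩
  · push Not at hex
    have hne : (Ioo u₀ v).Nonempty := nonempty_Ioo.2 hv
    have hb1 : ∀ y ∈ (fun u => u * M u) '' Ioo u₀ v, y ≤ 1 := by
      rintro _ ⟨w, hw, rfl⟩; exact (hex w hw).le
    -- Without a neck `H` is bounded by `1` and monotone near `u₀`, so it converges.
    exact Or.inr ⟨_, csSup_le (hne.image _) hb1, AntitoneOn.tendsto_nhdsWithin_Ioo_right hne
      (hanti.antitoneOn.mono Ioo_subset_Ioc_self) ⟨1, hb1⟩⟩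

theorem limit_pos (h : IsUndularBranch g α b σ u₀ M K) {l : ℝ}
    (hl : Tendsto (fun u => u * M u) (𝓝[>] u₀) (𝓝 l)) : 0 < l := by
  obtain ⟨v, hv, hKv⟩ := h.exists_critical
  refine (h.potential_pos hv).trans_le (ge_of_tendsto hl ?_)
  filter_upwards [Ioo_mem_nhdsGT hv] with t ht
  exact (h.critical_le hv hKv ht.1 ht.2.ne).le

theorem eventually_deriv_neg (h : IsUndularBranch g α b σ u₀ M K) :
    ∀ᶠ u in 𝓝[>] u₀, K u < 0 := by
  obtain ⟨v, hv, hKv⟩ := h.exists_critical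
  filter_upwards [Ioo_mem_nhdsGT hv] with t ht
  exact hKv ▸ h.strictMonoOn ht.1 hv ht.2

end IsUndularBranch

namespace IsNodalBranch

variable {g : ℝ → ℝ} {α : ℝ} {b : EReal} {σ u₀ : ℝ} {M K : ℝ → ℝ}

theorem deriv_pos (h : IsNodalBranch g α b σ u₀ M K) {u : ℝ} (hu : u₀ < u) : 0 < K u := by
  obtain ⟨κ, hκ, hK⟩ := h.exists_lower_bound
  exact hκ.trans_le (hK u hu)

theorem strictMonoOn_potential (h : IsNodalBranch g α b σ u₀ M K) :
    StrictMonoOn (fun u => u * M u) (Ioi u₀) :=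
  strictMonoOn_of_deriv_pos (convex_Ioi _) h.potential.continuousOn fun u hu => by
    rw [interior_Ioi] at hu
    rw [(h.potential.hasDerivAt u hu).deriv]
    exact h.deriv_pos hu

theorem exists_bulge (h : IsNodalBranch g α b σ u₀ M K) : ∃ v x₁, u₀ < v ∧ v < x₁ ∧ M v = 0 ∧
    x₁ * M x₁ = 1 := by
  obtain ⟨v, hv, hMv⟩ := h.exists_zero
  obtain ⟨w, hw, hvw⟩ := ((h.atTop.eventually (eventually_ge_atTop 1)).and
    (eventually_ge_atTop v)).exists
  obtain ⟨x₁, hx₁, he⟩ := intermediate_value_Icc hvw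
    (h.potential.continuousOn.mono fun u hu => hv.trans_le hu.1) ⟨by simp [hMv], hw⟩
  simp only at he
  exact ⟨v, x₁, hv, lt_of_le_of_ne hx₁.1 fun e => by simp [← e, hMv] at he, hMv, he⟩

/-- Monotonicity of `H` gives `-1 < H` throughout, so nothing stops the descent, and the uniform
bound `K ≥ κ` makes it last a finite time. -/
theorem exists_terminatingOrbit (h : IsNodalBranch g α b σ u₀ M K) {l : ℝ}
    (hl : Tendsto (fun u => u * M u) (𝓝[>] u₀) (𝓝 l)) (hl1 : -1 ≤ l) :
    ∃ x₁ a x p, IsTerminatingOrbit u₀ (fun u => u * M u) K x₁ a x p ∧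
      ∀ u > u₀, |u * M u| ≤ 1 → u ≤ x₁ := by
  have hmono := h.strictMonoOn_potential
  have hlt : ∀ u > u₀, -1 < u * M u := fun u hu => by
    obtain ⟨w, hw, hwu⟩ := exists_between hu
    have h1 : l ≤ w * M w := by
      refine le_of_tendsto hl ?_
      filter_upwards [Ioo_mem_nhdsGT hw] with t ht
      exact (hmono ht.1 hw ht.2).le
    exact (hl1.trans h1).trans_lt (hmono hw hu hwu)
  obtain ⟨v, x₁, hv, hvx, -, he⟩ := h.exists_bulge
  obtain ⟨κ, hκ, hK⟩ := h.exists_lower_bound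
  obtain ⟨x, p, a, hx, hreach⟩ := h.potential.exists_orbit_to_end (hv.trans hvx) he
    (h.deriv_pos (hv.trans hvx))
    (fun u hu => abs_lt.2 ⟨hlt u hu.1, by
      have := hmono hu.1 (hv.trans hvx) hu.2
      simp only [he] at this ⊢
      exact this⟩) hκ (lt_add_one u₀)
    (fun u hu => (hK u hu.1).trans (le_abs_self _))
  refine ⟨x₁, a, x, p, ⟨hx, h.potential, hreach⟩, fun u hu hu1 => not_lt.1 fun hcon => ?_⟩
  have := hmono (hv.trans hvx) hu hcon
  simp only [he] at this
  linarith [le_abs_self (u * M u)]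

theorem exists_periodicOrbit (h : IsNodalBranch g α b σ u₀ M K) {x₀ : ℝ} (h₀ : u₀ < x₀)
    (hx₀ : x₀ * M x₀ = -1) :
    ∃ x₁ T x p, IsPeriodicOrbit u₀ (fun u => u * M u) K x₀ x₁ T x p ∧ x₀ < x₁ ∧
      ∀ u > u₀, |u * M u| ≤ 1 → u ∈ Icc x₀ x₁ := by
  have hmono := h.strictMonoOn_potential
  obtain ⟨v, x₁, hv, hvx, -, he⟩ := h.exists_bulge
  have h₁ := hv.trans hvx
  have h₀₁ : x₀ < x₁ := (hmono.lt_iff_lt h₀ h₁).1 (by simp only [he, hx₀]; norm_num)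
  obtain ⟨x, p, T, hx, hxT, hpT, hIcc⟩ := h.potential.exists_orbit_to_neck h₀ h₀₁ he
    (h.deriv_pos h₁)
    (fun u hu => abs_lt.2 ⟨by
      have := hmono h₀ (h₀.trans hu.1) hu.1
      simp only [hx₀] at this ⊢
      exact this, by
      have := hmono (h₀.trans hu.1) h₁ hu.2
      simp only [he] at this ⊢
      exact this⟩)
    (show |x₀ * M x₀| = 1 by simp [hx₀])
    (show x₀ * M x₀ * K x₀ < 0 by linarith [h.deriv_pos h₀, hx₀ ▸ neg_one_mul (K x₀)])
  refine ⟨x₁, T, x, p, ⟨hx, h.potential, hxT, hpT, hIcc⟩, h₀₁, fun u hu hu1 =>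
    ⟨not_lt.1 fun hcon => ?_, not_lt.1 fun hcon => ?_⟩⟩
  · have := hmono hu h₀ hcon
    simp only [hx₀] at this
    linarith [neg_le_abs (u * M u)]
  · have := hmono h₁ hu hcon
    simp only [he] at this
    linarith [le_abs_self (u * M u)]

/-- The two possibilities for the neck of a nodal branch. -/
theorem dichotomy (h : IsNodalBranch g α b σ u₀ M K) :
    (∃ x₀ > u₀, x₀ * M x₀ = -1) ∨ ∃ l ≥ -1, Tendsto (fun u => u * M u) (𝓝[>] u₀) (𝓝 l) := by
  by_cases hex : ∃ w > u₀, w * M w ≤ -1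
  · obtain ⟨w, hw, hw1⟩ := hex
    obtain ⟨v, hv, hMv⟩ := h.exists_zero
    have hwv : w ≤ v := not_lt.1 fun hcon => by
      have := h.strictMonoOn_potential hv hw hcon
      simp only [hMv, mul_zero] at this
      linarith
    obtain ⟨x₀, hx₀, he⟩ := intermediate_value_Icc hwv
      (h.potential.continuousOn.mono fun u hu => hw.trans_le hu.1) ⟨hw1, by simp [hMv]⟩
    exact Or.inl ⟨x₀, hw.trans_le hx₀.1, he⟩
  · push Not at hex
    have hb1 : ∀ y ∈ (fun u => u * M u) '' Ioi u₀, -1 ≤ y := by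
      rintro _ ⟨w, hw, rfl⟩; exact (hex w hw).le
    exact Or.inr ⟨_, le_csInf (nonempty_Ioi.image _) hb1, MonotoneOn.tendsto_nhdsGT
      h.strictMonoOn_potential.monotoneOn ⟨-1, hb1⟩⟩

theorem limit_neg (h : IsNodalBranch g α b σ u₀ M K) {l : ℝ}
    (hl : Tendsto (fun u => u * M u) (𝓝[>] u₀) (𝓝 l)) : l < 0 := by
  obtain ⟨v, hv, hMv⟩ := h.exists_zero
  obtain ⟨w, hw, hwv⟩ := exists_between hv
  have h1 : w * M w < 0 := by
    have := h.strictMonoOn_potential hw hv hwv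
    simpa [hMv] using this
  refine lt_of_le_of_lt (le_of_tendsto hl ?_) h1
  filter_upwards [Ioo_mem_nhdsGT hw] with t ht
  exact (h.strictMonoOn_potential ht.1 hw ht.2).le

end IsNodalBranch

/-! ### Special unduloids and nodoids -/

theorem Continuous.exists_primitive {q : ℝ → ℝ} (hq : Continuous q) :
    ∃ z : ℝ → ℝ, z 0 = 0 ∧ ∀ s, HasDerivAt z (q s) s :=
  ⟨fun s => ∫ t in (0 : ℝ)..s, q t, intervalIntegral.integral_same,
    fun s => (hq.integral_hasStrictDerivAt 0 s).hasDerivAt⟩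

theorem OrbitOn.abs_le_one {u₀ : ℝ} {H K : ℝ → ℝ} {S : Set ℝ} {x p : ℝ → ℝ}
    (h : OrbitOn u₀ H K S x p) {s : ℝ} (hs : s ∈ S) : |H (x s)| ≤ 1 := by
  rw [← sq_le_one_iff_abs_le_one]
  nlinarith [h.energy s hs, sq_nonneg (p s)]

section

variable {g : ℝ → ℝ} {α : ℝ} {b : EReal} {σ u₀ : ℝ} {M K : ℝ → ℝ}

namespace IsPeriodicOrbit

variable {x₀ x₁ T : ℝ} {x p z : ℝ → ℝ}

theorem translate_height {H : ℝ → ℝ} (h : IsPeriodicOrbit u₀ H K x₀ x₁ T x p)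
    (hz : ∀ s, HasDerivAt z (σ * H (x s)) s) (s : ℝ) : z (s + 2 * T) = z s + (z (2 * T) - z 0) := by
  have := isOpen_univ.eq_of_hasDerivAt_zero ordConnected_univ (φ := fun s => z (s + 2 * T) - z s)
    (fun s _ => (((hz (s + 2 * T)).comp_add_const s (2 * T)).fun_sub (hz s)).congr_deriv (by
      rw [(h.periodic s).1, sub_self])) (mem_univ s) (mem_univ 0)
  rw [zero_add] at this
  linarith

theorem reflect_height {H : ℝ → ℝ} (h : IsPeriodicOrbit u₀ H K x₀ x₁ T x p)
    (hz : ∀ s, HasDerivAt z (σ * H (x s)) s) (s : ℝ) : z (2 * T - s) + z s = 2 * z T := by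
  have := isOpen_univ.eq_of_hasDerivAt_zero ordConnected_univ (φ := fun s => z (2 * T - s) + z s)
    (fun s _ => (((hz (2 * T - s)).comp_const_sub (2 * T) s).fun_add (hz s)).congr_deriv (by
      rw [(h.reflect_neck s).1, neg_add_cancel])) (mem_univ s) (mem_univ T)
  rw [show 2 * T - T = T by ring] at this
  linarith

theorem isDelaunayType (hg : IsEllipticWeingartenFunction g α)
    (hb : Tendsto (fun t : ℝ => (g t : EReal)) atTop (𝓝 b)) (hB : IsBranch g α b σ u₀ M K)
    (h : IsPeriodicOrbit u₀ (fun u => u * M u) K x₀ x₁ T x p) (h₀₁ : x₀ < x₁)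
    (hz : ∀ s, HasDerivAt z (σ * (x s * M (x s))) s) (hne : z (2 * T) ≠ z 0) :
    (ProfileCurve.mk univ x z).IsDelaunayType g α x₀ where
  weingarten := (ProfileCurve.isRotationalWeingarten_of_orbit (γ := ⟨univ, x, z⟩) hg hb hB
    isOpen_univ ordConnected_univ univ_nonempty h.orbit fun s _ => hz s).1
  complete := rfl
  periodic := ⟨2 * T, z (2 * T) - z 0, by linarith [h.bulge.pos], sub_ne_zero.2 hne,
    fun s => ⟨(h.periodic s).1, h.translate_height (H := fun u => u * M u) hz s⟩⟩
  neck_pos := hB.nonneg.trans_lt (h.x_neck ▸ h.orbit.lt T (mem_univ T))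
  neck := ⟨⟨T, h.x_neck⟩, by rintro _ ⟨s, rfl⟩; exact (h.mem_Icc s).1⟩
  bulge := ⟨x₁, h₀₁, ⟨0, h.bulge.x_zero⟩, by rintro _ ⟨s, rfl⟩; exact (h.mem_Icc s).2⟩

theorem exists_height {H : ℝ → ℝ} (h : IsPeriodicOrbit u₀ H K x₀ x₁ T x p) (σ : ℝ) :
    ∃ z : ℝ → ℝ, z 0 = 0 ∧ ∀ s, HasDerivAt z (σ * H (x s)) s :=
  Continuous.exists_primitive <| continuous_const.mul <|
    continuousOn_univ.1 <| h.potential.continuousOn.comp h.continuous_x.continuousOn h.orbit.lt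

theorem isOpenPieceOf (hg : IsEllipticWeingartenFunction g α)
    (hb : Tendsto (fun t : ℝ => (g t : EReal)) atTop (𝓝 b)) (hB : IsBranch g α b σ u₀ M K)
    (h : IsPeriodicOrbit u₀ (fun u => u * M u) K x₀ x₁ T x p)
    (hz : ∀ s, HasDerivAt z (σ * (x s * M (x s))) s)
    (hmem : ∀ u > u₀, |u * M u| ≤ 1 → u ∈ Icc x₀ x₁) {γ : ProfileCurve}
    (hr : γ.IsRotationalWeingarten g α) (hγ : γ.Follows σ u₀ M) :
    γ.IsOpenPieceOf ⟨univ, x, z⟩ := by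
  have horb := hγ.orbitOn hg hb hB hr
  obtain ⟨t, ht⟩ := hr.nonempty_interior
  obtain ⟨c, hc⟩ := h.exists_shift isOpen_interior hr.interior_ordConnected horb ht
    (hmem _ (horb.lt t ht) (horb.abs_le_one ht))
  exact ProfileCurve.Follows.isOpenPieceOf (δ := ⟨univ, x, z⟩) (fun s _ => hz s) hγ hB hr
    fun s hs => ⟨mem_univ _, hc s hs⟩

end IsPeriodicOrbit

/-- Positivity of `H` makes `σ z` strictly increasing along the whole curve; this gives
embeddedness, a nonzero period and `z' ≠ 0` at once. -/
theorem IsUndularBranch.exists_specialUnduloid (hg : IsEllipticWeingartenFunction g α)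
    (hb : Tendsto (fun t : ℝ => (g t : EReal)) atTop (𝓝 b)) (h : IsUndularBranch g α b σ u₀ M K)
    {v x₀ : ℝ} (hv : u₀ < v) (hKv : K v = 0) (h1 : v * M v < 1) (h₀ : u₀ < x₀) (h₀v : x₀ < v)
    (hx₀ : x₀ * M x₀ = 1) :
    ∃ δ : ProfileCurve, δ.IsSpecialUnduloid g α x₀ ∧ ∀ γ : ProfileCurve,
      γ.IsRotationalWeingarten g α → γ.Follows σ u₀ M → γ.IsOpenPieceOf δ := by
  obtain ⟨x₁, T, x, p, hx, h₀₁, hmem⟩ := h.exists_periodicOrbit hv hKv h1 h₀ h₀v hx₀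
  obtain ⟨z, hz0, hz⟩ := hx.exists_height σ
  have hpos : ∀ s, 0 < x s * M (x s) := fun s => h.potential_pos (hx.orbit.lt s (mem_univ s))
  have hmono : StrictMono fun s => σ * z s := strictMono_of_deriv_pos fun s => by
    rw [((hz s).const_mul σ).deriv, ← mul_assoc, h.sign_mul_self, one_mul]
    exact hpos s
  have hinj : Function.Injective z := fun s t hst => hmono.injective (by simp only [hst])
  refine ⟨⟨univ, x, z⟩, ⟨hx.isDelaunayType hg hb h.toIsBranch h₀₁ hz fun he => ?_, fun s _ => ?_,
    fun s t hst => hinj (Prod.ext_iff.1 hst).2⟩,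
    fun γ hr hγ => hx.isOpenPieceOf hg hb h.toIsBranch hz hmem hr hγ⟩
  · have := hinj he
    linarith [hx.bulge.pos]
  · rw [(hz s).deriv]
    exact mul_ne_zero h.sign_ne_zero (hpos s).ne'

/-- Along an orbit of a nodal branch the height stays positive as long as the curve approaches the
axis. -/
theorem IsNodalBranch.exists_le_height_add (h : IsNodalBranch g α b σ u₀ M K) {v x₁ a : ℝ}
    {x p Z : ℝ → ℝ} (hv : u₀ < v) (hMv : M v = 0)
    (hx : OrbitOn u₀ (fun u => u * M u) K (Ioo (-a) a) x p) (hx0 : x 0 = x₁) (hp0 : p 0 = 0)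
    (hvx : v < x₁) (hZ0 : Z 0 = 0) (hZ : ∀ s ∈ Ioo (-a) a, HasDerivAt Z (x s * M (x s)) s) {s : ℝ}
    (hs : s ∈ Ioo 0 a) : ∃ c > 0, ∀ t ∈ Ico s a, c ≤ Z t + p t / K v := by
  have hK := h.deriv_pos hv
  -- The corrected height has derivative `H (1 - K / K v)`, which is never negative: `K` is
  -- decreasing, so `M` and `1 - K / K v` change sign together at `v`. Wherever `p ≤ 0` the height
  -- is then at least as large as this quantity.
  have hd : ∀ t ∈ Ioo (-a) a, HasDerivAt (fun t => Z t + p t / K v)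
      (x t * M (x t) * (1 - K (x t) / K v)) t := fun t ht =>
    ((hZ t ht).fun_add ((hx.hasDerivAt_p t ht).div_const (K v))).congr_deriv (by ring)
  have hpos : ∀ u > u₀, 0 < u := fun u hu => h.nonneg.trans_lt hu
  have hnn : ∀ u > u₀, 0 ≤ u * M u * (1 - K u / K v) := fun u hu => by
    rcases le_or_gt v u with h1 | h1
    · have h2 : 0 ≤ M u := hMv ▸ h.strictMonoOn.monotoneOn hv hu h1
      have h3 : K u / K v ≤ 1 := (div_le_one hK).2 (h.strictAntiOn.antitoneOn hv hu h1)
      exact mul_nonneg (mul_nonneg (hpos u hu).le h2) (by linarith)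
    · have h2 : M u ≤ 0 := hMv ▸ (h.strictMonoOn hu hv h1).le
      have h3 : 1 ≤ K u / K v := (one_le_div hK).2 (h.strictAntiOn hu hv h1).le
      exact mul_nonneg_of_nonpos_of_nonpos (mul_nonpos_of_nonneg_of_nonpos (hpos u hu).le h2)
        (by linarith)
  have ha := hs.1.trans hs.2
  have hmem : ∀ t ∈ Ico 0 a, t ∈ Ioo (-a) a := fun t ht => ⟨by linarith [ht.1], ht.2⟩
  have hmono : MonotoneOn (fun t => Z t + p t / K v) (Ico 0 a) :=
    monotoneOn_of_deriv_nonneg (convex_Ico 0 a)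
      (fun t ht => (hd t (hmem t ht)).continuousAt.continuousWithinAt)
      (fun t ht => (hd t (hmem t (interior_subset ht))).differentiableAt.differentiableWithinAt)
      fun t ht => by
        have ht := hmem t (interior_subset ht)
        rw [(hd t ht).deriv]
        exact hnn _ (hx.lt t ht)
  have h0 : (0 : ℝ) ∈ Ioo (-a) a := hmem 0 ⟨le_rfl, ha⟩
  have hstrict : 0 < x 0 * M (x 0) * (1 - K (x 0) / K v) := by
    rw [hx0]
    have h1 := hv.trans hvx
    have h2 : 0 < M x₁ := hMv ▸ h.strictMonoOn hv h1 hvx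
    have h3 : K x₁ / K v < 1 := (div_lt_one hK).2 (h.strictAntiOn hv h1 hvx)
    exact mul_pos (mul_pos (hpos _ h1) h2) (by linarith)
  have hev := HasDerivAt.eventually_neg_right (hd 0 h0).fun_neg (by simp [hZ0, hp0])
    (neg_lt_zero.2 hstrict)
  obtain ⟨t, ht, ht'⟩ := (hev.and (Ioo_mem_nhdsGT hs.1)).exists
  exact ⟨_, neg_lt_zero.1 ht, fun r hr => hmono ⟨ht'.1.le, ht'.2.trans hs.2⟩
    ⟨hs.1.le.trans hr.1, hr.2⟩ (ht'.2.le.trans hr.1)⟩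

theorem IsNodalBranch.exists_specialNodoid (hg : IsEllipticWeingartenFunction g α)
    (hb : Tendsto (fun t : ℝ => (g t : EReal)) atTop (𝓝 b)) (h : IsNodalBranch g α b σ u₀ M K)
    {x₀ : ℝ} (h₀ : u₀ < x₀) (hx₀ : x₀ * M x₀ = -1) :
    ∃ δ : ProfileCurve, δ.IsSpecialNodoid g α x₀ ∧ ∀ γ : ProfileCurve,
      γ.IsRotationalWeingarten g α → γ.Follows σ u₀ M → γ.IsOpenPieceOf δ := by
  obtain ⟨x₁, T, x, p, hx, h₀₁, hmem⟩ := h.exists_periodicOrbit h₀ hx₀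
  obtain ⟨v, hv, hMv⟩ := h.exists_zero
  obtain ⟨z, hz0, hz⟩ := hx.exists_height σ
  have hT := hx.bulge.pos
  have hvm : v ∈ Icc x₀ x₁ := hmem v hv (by simp [hMv])
  have hx₁ : |x₁ * M x₁| = 1 := by
    have := hx.orbit.energy 0 (mem_univ 0)
    rw [hx.bulge.p_zero, hx.bulge.x_zero] at this
    rw [← pow_eq_one_iff_of_nonneg (abs_nonneg _) two_ne_zero, sq_abs]
    linarith
  have hvx : v < x₁ := lt_of_le_of_ne hvm.2 fun e => by simp [← e, hMv] at hx₁
  have hZ : ∀ s, HasDerivAt (fun s => σ * z s) (x s * M (x s)) s := fun s =>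
    ((hz s).const_mul σ).congr_deriv (by rw [← mul_assoc, h.sign_mul_self, one_mul])
  -- At moments of rest the correction `p / K v` vanishes and the height itself is positive; this is
  -- used at the neck `T` and at the next bulge `2 * T`.
  have key : ∀ s > 0, p s = 0 → 0 < σ * z s := fun s hs hps => by
    obtain ⟨c, hc, hle⟩ := h.exists_le_height_add (a := s + 1) hv hMv (hx.orbit.mono (subset_univ _)) hx.bulge.x_zero
      hx.bulge.p_zero hvx (Z := fun s => σ * z s) (by simp [hz0]) (fun t _ => hZ t)
      ⟨hs, lt_add_one s⟩
    simpa [hps] using hc.trans_le (hle s ⟨le_rfl, lt_add_one s⟩)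
  have hp2 : p (2 * T) = 0 := by simpa [hx.bulge.p_zero] using (hx.periodic 0).2
  refine ⟨⟨univ, x, z⟩, ⟨hx.isDelaunayType hg hb h.toIsBranch h₀₁ hz fun he => ?_, ?_,
    fun hinj => ?_⟩, fun γ hr hγ => hx.isOpenPieceOf hg hb h.toIsBranch hz hmem hr hγ⟩
  · have := key (2 * T) (by linarith) hp2
    rw [he, hz0, mul_zero] at this
    exact lt_irrefl _ this
  · obtain ⟨s, hs, -⟩ := hx.exists_state (v := 1) hvm (by simp [hMv])
    refine ⟨s, mem_univ s, ?_⟩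
    rw [(hz s).deriv, hs, hMv, mul_zero, mul_zero]
  · have hT0 := key T hT hx.p_neck
    -- At the neck the curve runs downwards, yet at `2 * T` the height is twice that of the neck. So
    -- the neck height is attained again at some `s` between, and reflection in the neck gives a
    -- second parameter with the same point.
    have hd : HasDerivAt (fun s => σ * z s - σ * z T) (-1) T :=
      ((hZ T).sub_const _).congr_deriv (by rw [hx.x_neck, hx₀])
    have hev := HasDerivAt.eventually_neg_right hd (sub_self _) (by norm_num)
    obtain ⟨r, hr1, hr2⟩ := (hev.and (Ioo_mem_nhdsGT (show T < 2 * T by linarith))).exists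
    have hzc : Continuous z := continuous_iff_continuousAt.2 fun s => (hz s).continuousAt
    have h2T := hx.reflect_height hz (2 * T)
    rw [sub_self, hz0, zero_add] at h2T
    obtain ⟨s, hs, hs'⟩ := intermediate_value_Icc hr2.2.le
      (f := fun s => σ * z s) (by fun_prop) (a := r) (b := 2 * T) (show σ * z T ∈ _ from
        ⟨by linarith, by rw [h2T]; linarith⟩)
    have hs' : z s = z T := mul_left_cancel₀ h.sign_ne_zero hs'
    have he := hinj (a₁ := 2 * T - s) (a₂ := s)
      (Prod.ext (hx.reflect_neck s).1 (by linarith [hx.reflect_height hz s] : z (2 * T - s) = z s))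
    linarith [hr2.1, hs.1]

end

/-! ### Surfaces with two singular ends -/

/-- Extend on `[0, a]` by the one-sided limit, continue constantly, and compose with `|s|`. It
supplies the continuity up to the singular ends. -/
theorem exists_even_continuous_extension {φ : ℝ → ℝ} {a L : ℝ} (ha : 0 < a)
    (hc : ContinuousOn φ (Ioo (-a) a)) (heven : ∀ s ∈ Ioo (-a) a, φ (-s) = φ s)
    (hL : Tendsto φ (𝓝[<] a) (𝓝 L)) :
    ∃ ψ : ℝ → ℝ, Continuous ψ ∧ (∀ s, ψ (-s) = ψ s) ∧ EqOn ψ φ (Ioo (-a) a) ∧ ψ a = L := by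
  have hsub : Ioo 0 a ⊆ Ioo (-a) a := Ioo_subset_Ioo_left (by linarith)
  have h0 : (0 : ℝ) ∈ Ioo (-a) a := ⟨by linarith, ha⟩
  have hφ0 : Tendsto φ (𝓝[>] 0) (𝓝 (φ 0)) :=
    ((hc.continuousAt (Ioo_mem_nhds h0.1 h0.2)).tendsto).mono_left nhdsWithin_le_nhds
  have hcont : ContinuousOn (extendFrom (Ioo 0 a) φ) (Icc 0 a) :=
    continuousOn_Icc_extendFrom_Ioo (hc.mono hsub) hφ0 hL
  have hext : Continuous (IccExtend ha.le ((Icc 0 a).domRestrict (extendFrom (Ioo 0 a) φ))) :=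
    (continuousOn_iff_continuous_domRestrict.1 hcont).Icc_extend'
  have happ : ∀ s ∈ Icc 0 a, IccExtend ha.le ((Icc 0 a).domRestrict (extendFrom (Ioo 0 a) φ)) s =
      extendFrom (Ioo 0 a) φ s := fun s hs => IccExtend_of_mem _ _ hs
  refine ⟨fun s => IccExtend ha.le ((Icc 0 a).domRestrict (extendFrom (Ioo 0 a) φ)) |s|,
    hext.comp continuous_abs, fun s => by simp only [abs_neg], fun s hs => ?_, ?_⟩
  · have h1 : |s| < a := abs_lt.2 hs
    have h2 : φ |s| = φ s := by
      rcases abs_choice s with h | h <;> rw [h]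
      exact heven s hs
    simp only
    rw [happ _ ⟨abs_nonneg s, h1.le⟩, ← h2]
    rcases (abs_nonneg s).eq_or_lt with h3 | h3
    · rw [← h3]
      exact eq_lim_at_left_extendFrom_Ioo ha hφ0
    · exact extendFrom_extends (hc.mono hsub) |s| ⟨h3, h1⟩
  · simp only [abs_of_pos ha]
    rw [happ a ⟨ha.le, le_rfl⟩]
    exact eq_lim_at_right_extendFrom_Ioo ha hL

section

variable {g : ℝ → ℝ} {α : ℝ} {b : EReal} {σ u₀ : ℝ} {M K : ℝ → ℝ}

theorem IsTerminatingOrbit.tendsto_p {H : ℝ → ℝ} {x₁ a l : ℝ} {x p : ℝ → ℝ}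
    (h : IsTerminatingOrbit u₀ H K x₁ a x p) (hl : Tendsto H (𝓝[>] u₀) (𝓝 l)) :
    Tendsto p (𝓝[<] a) (𝓝 (-√(1 - l ^ 2))) := by
  have h1 : Tendsto (fun s => -√(1 - H (x s) ^ 2)) (𝓝[<] a) (𝓝 (-√(1 - l ^ 2))) :=
    (((hl.comp h.tendsto_right).pow 2).const_sub 1).sqrt.neg
  refine h1.congr' ?_
  filter_upwards [Ioo_mem_nhdsLT h.pos] with s hs
  exact (h.orbit.eq_neg_sqrt ⟨by linarith [hs.1, h.pos], hs.2⟩ (h.bulge.p_neg s hs).le).symm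

namespace ProfileCurve

theorem Follows.blow_up (hg : IsEllipticWeingartenFunction g α)
    (hb : Tendsto (fun t : ℝ => (g t : EReal)) atTop (𝓝 b)) {γ : ProfileCurve}
    (h : γ.Follows σ u₀ M) (hB : IsBranch g α b σ u₀ M K) (hr : γ.IsRotationalWeingarten g α)
    {l : Filter ℝ} (hI : interior γ.I ∈ l) (hx : Tendsto γ.x l (𝓝[>] u₀)) (C : ℝ) :
    ∀ᶠ s in l, ∃ k₁ k₂ : ℝ,
      HasPrincipalCurvatures γ.param γ.normal (s, 0) k₁ k₂ ∧ C < max |k₁| |k₂| := by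
  filter_upwards [hI, (hB.blow_up.comp hx).eventually (eventually_gt_atTop C)] with s hs hC
  exact ⟨_, _, (h.hasPrincipalCurvatures_iff hg hb hB hr hs).2 (Or.inr ⟨rfl, rfl⟩), by
    rwa [hB.abs_sign_mul, hB.abs_sign_mul]⟩

end ProfileCurve

/-- Injectivity up to the ends: `x` is even and strictly decreasing in `|s|`, so two parameters with
the same point can only be `s` and `-s`, whose heights are opposite. Hence the requirement `hpos` of
positive height for `s > 0`, verified differently on the two kinds of branch. -/
theorem IsTerminatingOrbit.exists_profile (hg : IsEllipticWeingartenFunction g α)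
    (hb : Tendsto (fun t : ℝ => (g t : EReal)) atTop (𝓝 b)) (hB : IsBranch g α b σ u₀ M K)
    {x₁ a l : ℝ} {x p : ℝ → ℝ} (h : IsTerminatingOrbit u₀ (fun u => u * M u) K x₁ a x p)
    (hl : Tendsto (fun u => u * M u) (𝓝[>] u₀) (𝓝 l))
    (hpos : ∀ Z : ℝ → ℝ, Continuous Z → Z 0 = 0 →
      (∀ s ∈ Ioo (-a) a, HasDerivAt Z (x s * M (x s)) s) → ∀ s ∈ Ioc 0 a, 0 < Z s) :
    ∃ δ : ProfileCurve, δ.HasTwoSingularEnds g α a u₀ ∧ δ.HasLimitAngles a √(1 - l ^ 2) ∧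
      δ.Follows σ u₀ M ∧ EqOn δ.x x (Ioo (-a) a) ∧
      ∀ s ∈ Ioo (-a) a, HasDerivAt δ.z (σ * (δ.x s * M (δ.x s))) s := by
  have ha := h.pos
  have hright := tendsto_nhdsWithin_iff.1 h.tendsto_right
  obtain ⟨X, hXc, hXe, hX, hXa⟩ := exists_even_continuous_extension ha h.orbit.continuousOn_x
    (fun s hs => (h.even hs).1) hright.1
  -- The slope `z'` also extends continuously and evenly, because `H` converges at `u₀`; its
  -- primitive is an odd height function defined on the whole line.
  obtain ⟨q, hqc, hqe, hq, -⟩ := exists_even_continuous_extension ha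
    (φ := fun s => x s * M (x s)) (h.potential.continuousOn.comp h.orbit.continuousOn_x h.orbit.lt)
    (fun s hs => by rw [(h.even hs).1]) (hl.comp h.tendsto_right)
  obtain ⟨z, hz0, hz⟩ := hqc.exists_primitive
  have hzc : Continuous z := continuous_iff_continuousAt.2 fun s => (hz s).continuousAt
  have hzodd : ∀ s, z (-s) = -z s := fun s => by
    have := isOpen_univ.eq_of_hasDerivAt_zero ordConnected_univ (φ := fun s => z (0 - s) + z s)
      (fun s _ => (((hz (0 - s)).comp_const_sub 0 s).fun_add (hz s)).congr_deriv (by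
        rw [zero_sub, hqe, neg_add_cancel])) (mem_univ s) (mem_univ 0)
    simp only [zero_sub, neg_zero, hz0, add_zero] at this
    linarith
  have hzd : ∀ s ∈ Ioo (-a) a, HasDerivAt z (x s * M (x s)) s := fun s hs =>
    (hz s).congr_deriv (hq hs)
  have hzpos := hpos z hzc hz0 hzd
  have hσz : ∀ s ∈ Ioo (-a) a, HasDerivAt (fun s => σ * z s) (σ * (X s * M (X s))) s :=
    fun s hs => by rw [hX hs]; exact (hzd s hs).const_mul σ
  have hXx : ∀ s ∈ Ioo (-a) a, X =ᶠ[𝓝 s] x := fun s hs =>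
    hX.eventuallyEq_of_mem (Ioo_mem_nhds hs.1 hs.2)
  have horb : OrbitOn u₀ (fun u => u * M u) K (Ioo (-a) a) X p :=
    ⟨fun s hs => by rw [hX hs]; exact h.orbit.lt s hs,
      fun s hs => (h.orbit.hasDerivAt_x s hs).congr_of_eventuallyEq (hXx s hs),
      fun s hs => by rw [hX hs]; exact h.orbit.hasDerivAt_p s hs,
      fun s hs => by rw [hX hs]; exact h.orbit.energy s hs⟩
  obtain ⟨hr, hfol⟩ := ProfileCurve.isRotationalWeingarten_of_orbit
    (γ := ⟨Ioo (-a) a, X, fun s => σ * z s⟩) hg hb hB isOpen_Ioo ordConnected_Ioo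
    (nonempty_Ioo.2 (by linarith)) horb hσz
  have hmemR : Ioo (-a) a ∈ 𝓝[<] a := Ioo_mem_nhdsLT (by linarith)
  have hmemL : Ioo (-a) a ∈ 𝓝[>] (-a) := Ioo_mem_nhdsGT (by linarith)
  have hXR : X =ᶠ[𝓝[<] a] x := hX.eventuallyEq_of_mem hmemR
  have hanti : StrictAntiOn X (Icc 0 a) := by
    have hmem : ∀ s, 0 ≤ s → s < a → s ∈ Ioo (-a) a := fun s h1 h2 => ⟨by linarith, h2⟩
    intro s hs t ht hst
    have hs' := hmem s hs.1 (hst.trans_le ht.2)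
    rcases ht.2.eq_or_lt with rfl | hta
    · rw [hXa]; exact horb.lt s hs'
    · rw [hX hs', hX (hmem t ht.1 hta)]
      exact h.strictAntiOn ⟨hs.1, hs'.2⟩ ⟨ht.1, hta⟩ hst
  refine ⟨⟨Ioo (-a) a, X, fun s => σ * z s⟩, ⟨hr, ha, rfl, fun s _ => hXe s, fun s _ => ?_,
    hXc.continuousOn, (hzc.const_smul σ).continuousOn, fun s hs t ht hst => ?_, hXa,
    hfol.blow_up hg hb hB hr (by simpa using hmemR) (h.tendsto_right.congr' hXR.symm)⟩,
    ⟨?_, ?_⟩, hfol, hX, hσz⟩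
  · simp only [hzodd]; ring
  · obtain ⟨h1, h2⟩ := Prod.ext_iff.1 hst
    have h2 : z s = z t := mul_left_cancel₀ hB.sign_ne_zero h2
    have habs : ∀ s, X |s| = X s := fun s => by
      rcases abs_choice s with h | h <;> rw [h]
      exact hXe s
    have habs' : |s| = |t| := hanti.injOn ⟨abs_nonneg s, abs_le.2 hs⟩
      ⟨abs_nonneg t, abs_le.2 ht⟩ (by rw [habs, habs]; exact h1)
    rcases abs_eq_abs.1 habs' with h3 | h3
    · exact h3
    · rw [h3, hzodd] at h2
      have hz0' : z t = 0 := by linarith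
      rcases lt_trichotomy t 0 with h4 | h4 | h4
      · have := hzpos (-t) ⟨by linarith, by linarith [ht.1]⟩
        rw [hzodd, hz0', neg_zero] at this
        exact absurd this (lt_irrefl _)
      · rw [h3, h4, neg_zero]
      · exact absurd (hz0' ▸ hzpos t ⟨h4, ht.2⟩) (lt_irrefl _)
  · have h1 : Tendsto (fun s => -p (-s)) (𝓝[>] (-a)) (𝓝 (- -√(1 - l ^ 2))) :=
      ((h.tendsto_p hl).comp (by simpa using tendsto_neg_nhdsGT_neg (a := a))).neg
    rw [neg_neg] at h1
    refine h1.congr' ?_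
    filter_upwards [hmemL] with s hs
    have : (ProfileCurve.mk (Ioo (-a) a) X fun s => σ * z s).normal (s, 0) 2 = deriv X s := rfl
    rw [this, (horb.hasDerivAt_x s hs).deriv, (h.even hs).2, neg_neg]
  · refine (h.tendsto_p hl).congr' ?_
    filter_upwards [hmemR] with s hs
    exact (horb.hasDerivAt_x s hs).deriv.symm

theorem IsTerminatingOrbit.isOpenPieceOf (hg : IsEllipticWeingartenFunction g α)
    (hb : Tendsto (fun t : ℝ => (g t : EReal)) atTop (𝓝 b)) (hB : IsBranch g α b σ u₀ M K)
    {x₁ a : ℝ} {x p : ℝ → ℝ} (h : IsTerminatingOrbit u₀ (fun u => u * M u) K x₁ a x p)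
    (hle : ∀ u > u₀, |u * M u| ≤ 1 → u ≤ x₁) {γ δ : ProfileCurve} (hδ : δ.I = Ioo (-a) a)
    (hδx : EqOn δ.x x (Ioo (-a) a))
    (hδz : ∀ s ∈ Ioo (-a) a, HasDerivAt δ.z (σ * (δ.x s * M (δ.x s))) s)
    (hr : γ.IsRotationalWeingarten g α) (hγ : γ.Follows σ u₀ M) : γ.IsOpenPieceOf δ := by
  have horb := hγ.orbitOn hg hb hB hr
  obtain ⟨t, ht⟩ := hr.nonempty_interior
  obtain ⟨c, hc⟩ := h.exists_shift isOpen_interior hr.interior_ordConnected horb ht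
    (hle _ (horb.lt t ht) (horb.abs_le_one ht))
  refine ProfileCurve.Follows.isOpenPieceOf (c := c) (by rwa [hδ]) hγ hB hr fun s hs => ?_
  rw [hδ, hδx (hc s hs).1]
  exact hc s hs

theorem IsUndularBranch.exists_singular_ends (hg : IsEllipticWeingartenFunction g α)
    (hb : Tendsto (fun t : ℝ => (g t : EReal)) atTop (𝓝 b)) (h : IsUndularBranch g α b σ u₀ M K)
    {l : ℝ} (hl : Tendsto (fun u => u * M u) (𝓝[>] u₀) (𝓝 l)) (hl1 : l ≤ 1) :
    ∃ (δ : ProfileCurve) (a : ℝ), δ.HasTwoSingularEnds g α a u₀ ∧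
      δ.HasLimitAngles a √(1 - l ^ 2) ∧ δ.NegativelyCurvedNearEnds a ∧ δ.IsUnduloidType ∧
      ∀ γ : ProfileCurve, γ.IsRotationalWeingarten g α → γ.Follows σ u₀ M →
        γ.IsOpenPieceOf δ := by
  obtain ⟨x₁, a, x, p, hx, hle⟩ := h.exists_terminatingOrbit hl hl1
  obtain ⟨δ, hδ, hang, hfol, hδx, hδz⟩ := hx.exists_profile hg hb h.toIsBranch hl
    fun Z hZc hZ0 hZ s hs => by
      have hmono : StrictMonoOn Z (Icc (-a) a) := strictMonoOn_of_deriv_pos (convex_Icc _ _)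
        hZc.continuousOn fun t ht => by
          rw [interior_Icc] at ht
          rw [(hZ t ht).deriv]
          exact h.potential_pos (hx.orbit.lt t ht)
      rw [← hZ0]
      exact hmono ⟨by linarith [hs.1, hs.2], hx.pos.le⟩ ⟨by linarith [hs.1, hs.2], hs.2⟩ hs.1
  have hlt : ∀ s ∈ Ioo (-a) a, u₀ < δ.x s := fun s hs => by rw [hδx hs]; exact hx.orbit.lt s hs
  refine ⟨δ, a, hδ, hang, ?_, fun s hs => ?_, fun γ hr hγ =>
    hx.isOpenPieceOf hg hb h.toIsBranch hle hδ.domain hδx hδz hr hγ⟩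
  · have hmem : Ioo (-a) a ∈ 𝓝[<] a := Ioo_mem_nhdsLT (by linarith [hx.pos])
    filter_upwards [hmem, hx.tendsto_right.eventually h.eventually_deriv_neg] with s hs hK
    refine ⟨_, _, (hfol.hasPrincipalCurvatures_iff hg hb h.toIsBranch hδ.weingarten (by
      rwa [hδ.domain, isOpen_Ioo.interior_eq])).2 (Or.inl ⟨rfl, rfl⟩), ?_⟩
    rw [← hδx hs] at hK
    have := mul_neg_of_neg_of_pos hK (h.pos _ (hlt s hs))
    calc σ * K (δ.x s) * (σ * M (δ.x s)) = K (δ.x s) * M (δ.x s) := by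
          linear_combination K (δ.x s) * M (δ.x s) * h.sign_mul_self
      _ < 0 := this
  · rw [hδ.domain] at hs
    rw [(hδz s hs).deriv]
    exact mul_ne_zero h.sign_ne_zero (h.potential_pos (hlt s hs)).ne'

theorem IsNodalBranch.exists_singular_ends (hg : IsEllipticWeingartenFunction g α)
    (hb : Tendsto (fun t : ℝ => (g t : EReal)) atTop (𝓝 b)) (h : IsNodalBranch g α b σ u₀ M K)
    {l : ℝ} (hl : Tendsto (fun u => u * M u) (𝓝[>] u₀) (𝓝 l)) (hl1 : -1 ≤ l) :
    ∃ (δ : ProfileCurve) (a : ℝ), δ.HasTwoSingularEnds g α a u₀ ∧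
      δ.HasLimitAngles a √(1 - l ^ 2) ∧ δ.IsNodoidType ∧
      ∀ γ : ProfileCurve, γ.IsRotationalWeingarten g α → γ.Follows σ u₀ M →
        γ.IsOpenPieceOf δ := by
  obtain ⟨x₁, a, x, p, hx, hle⟩ := h.exists_terminatingOrbit hl hl1
  obtain ⟨v, hv, hMv⟩ := h.exists_zero
  have h0 : (0 : ℝ) ∈ Ioo (-a) a := ⟨by linarith [hx.pos], hx.pos⟩
  have hvx : v < x₁ := lt_of_le_of_ne (hle v hv (by simp [hMv])) fun e => by
    have := hx.orbit.energy 0 h0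
    rw [hx.bulge.p_zero, hx.bulge.x_zero, ← e, hMv] at this
    norm_num at this
  obtain ⟨δ, hδ, hang, hfol, hδx, hδz⟩ := hx.exists_profile hg hb h.toIsBranch hl
    fun Z hZc hZ0 hZ s hs => by
      have hK := h.deriv_pos hv
      -- During the descent `p < 0`, so the height exceeds the corrected height and keeps a positive
      -- lower bound; the bound persists in the limit at `s = a`.
      have key : ∀ s ∈ Ioo 0 a, ∃ c > 0, ∀ t ∈ Ico s a, c ≤ Z t := fun s hs => by
        obtain ⟨c, hc, hcle⟩ := h.exists_le_height_add hv hMv hx.orbit hx.bulge.x_zero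
          hx.bulge.p_zero hvx hZ0 hZ hs
        refine ⟨c, hc, fun t ht => (hcle t ht).trans ?_⟩
        have := div_neg_of_neg_of_pos (hx.bulge.p_neg t ⟨hs.1.trans_le ht.1, ht.2⟩) hK
        linarith
      rcases hs.2.eq_or_lt with rfl | hsa
      · obtain ⟨c, hc, hcle⟩ := key (s / 2) ⟨by linarith [hs.1], by linarith [hs.1]⟩
        refine hc.trans_le (ge_of_tendsto (hZc.continuousAt.tendsto.mono_left
          (nhdsWithin_le_nhds (s := Iio s))) ?_)
        filter_upwards [Ioo_mem_nhdsLT (show s / 2 < s by linarith [hs.1])] with t ht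
        exact hcle t ⟨ht.1.le, ht.2⟩
      · obtain ⟨c, hc, hcle⟩ := key s ⟨hs.1, hsa⟩
        exact hc.trans_le (hcle s ⟨le_rfl, hsa⟩)
  obtain ⟨s, hs, hsv, -⟩ := hx.exists_state (v := 1) ⟨hv, hvx.le⟩ (by simp [hMv])
  refine ⟨δ, a, hδ, hang, ⟨s, by rwa [hδ.domain], ?_⟩, fun γ hr hγ =>
    hx.isOpenPieceOf hg hb h.toIsBranch hle hδ.domain hδx hδz hr hγ⟩
  rw [(hδz s hs).deriv, hδx hs, hsv, hMv, mul_zero, mul_zero]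

end

/-! ### Surfaces with two singular ends follow a branch with finite limit -/

namespace ProfileCurve.HasTwoSingularEnds

variable {g : ℝ → ℝ} {α : ℝ} {b : EReal} {σ u₀ : ℝ} {M K : ℝ → ℝ} {δ : ProfileCurve} {a d : ℝ}

theorem interior_eq (hδ : δ.HasTwoSingularEnds g α a d) : interior δ.I = Ioo (-a) a := by
  rw [hδ.domain, isOpen_Ioo.interior_eq]

theorem mem_nhdsLT (hδ : δ.HasTwoSingularEnds g α a d) : Ioo (-a) a ∈ 𝓝[<] a :=
  Ioo_mem_nhdsLT (by linarith [hδ.pos])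

theorem not_umbilical (hg : IsEllipticWeingartenFunction g α)
    (hb : Tendsto (fun t : ℝ => (g t : EReal)) atTop (𝓝 b)) (hδ : δ.HasTwoSingularEnds g α a d) :
    ¬ ∀ s ∈ interior δ.I, deriv δ.z s / δ.x s = α := by
  intro h
  obtain ⟨s, ⟨k₁, k₂, hk, hlt⟩, hs⟩ := ((hδ.blow_up |α|).and (eventually_mem_set.2 hδ.mem_nhdsLT)).exists
  replace hs : s ∈ interior δ.I := by rwa [hδ.interior_eq]
  rw [IsRotationalWeingarten.hasPrincipalCurvatures_iff hg hb hδ.weingarten hs, h s hs,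
    hg.f_center] at hk
  rcases hk with ⟨rfl, rfl⟩ | ⟨rfl, rfl⟩ <;> simp at hlt

theorem tendsto_x (hδ : δ.HasTwoSingularEnds g α a d) : Tendsto δ.x (𝓝[<] a) (𝓝 d) := by
  have ha := hδ.pos
  have := hδ.continuousOn_x a ⟨by linarith, le_rfl⟩
  rw [ContinuousWithinAt, hδ.dist_axis] at this
  exact this.mono_left (nhdsWithin_le_of_mem (mem_of_superset hδ.mem_nhdsLT Ioo_subset_Icc_self))

/-- If the ends stayed at distance greater than `u₀`, the curvatures would be bounded there, against
the blow-up. -/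
theorem dist_eq (hg : IsEllipticWeingartenFunction g α)
    (hb : Tendsto (fun t : ℝ => (g t : EReal)) atTop (𝓝 b)) (hδ : δ.HasTwoSingularEnds g α a d)
    (h : δ.Follows σ u₀ M) (hB : IsBranch g α b σ u₀ M K) : d = u₀ := by
  have hlt : ∀ s ∈ Ioo (-a) a, u₀ < δ.x s := fun s hs => h.lt s (by rwa [hδ.interior_eq])
  refine le_antisymm (not_lt.1 fun hcon => ?_) (ge_of_tendsto hδ.tendsto_x ?_)
  · obtain ⟨u₁, h1, h2⟩ := exists_between hcon
    obtain ⟨C, hC⟩ := hB.bounded u₁ h1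
    obtain ⟨s, ⟨k₁, k₂, hk, hltC⟩, hs, hsu⟩ := ((hδ.blow_up C).and
      ((eventually_mem_set.2 hδ.mem_nhdsLT).and (hδ.tendsto_x.eventually (lt_mem_nhds h2)))).exists
    replace hs : s ∈ interior δ.I := by rwa [hδ.interior_eq]
    have := hC _ hsu.le
    rw [← hB.abs_sign_mul (M _), ← hB.abs_sign_mul (K _)] at this
    rcases (h.hasPrincipalCurvatures_iff hg hb hB hδ.weingarten hs).1 hk with ⟨rfl, rfl⟩ | ⟨rfl, rfl⟩
    · rw [max_comm] at this; linarith
    · linarith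
  · filter_upwards [hδ.mem_nhdsLT] with s hs using (hlt s hs).le

theorem tendsto_x_right (hδ : δ.HasTwoSingularEnds g α a u₀) (h : δ.Follows σ u₀ M) :
    Tendsto δ.x (𝓝[<] a) (𝓝[>] u₀) := by
  refine tendsto_nhdsWithin_iff.2 ⟨hδ.tendsto_x, ?_⟩
  filter_upwards [hδ.mem_nhdsLT] with s hs
  exact h.lt s (by rwa [hδ.interior_eq])

theorem exists_eq (hδ : δ.HasTwoSingularEnds g α a u₀) {u : ℝ} (hu : u₀ < u)
    (hu0 : u ≤ δ.x 0) : ∃ s ∈ Ioo (-a) a, δ.x s = u := by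
  have ha := hδ.pos
  obtain ⟨s, hs, hsu⟩ := intermediate_value_Icc' ha.le
    (hδ.continuousOn_x.mono (Icc_subset_Icc_left (by linarith))) ⟨by rw [hδ.dist_axis]; exact hu.le, hu0⟩
  refine ⟨s, ⟨by linarith [hs.1], lt_of_le_of_ne hs.2 fun e => ?_⟩, hsu⟩
  rw [e, hδ.dist_axis] at hsu
  exact hu.ne hsu

theorem abs_potential_le (hg : IsEllipticWeingartenFunction g α)
    (hb : Tendsto (fun t : ℝ => (g t : EReal)) atTop (𝓝 b)) (hδ : δ.HasTwoSingularEnds g α a u₀)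
    (h : δ.Follows σ u₀ M) (hB : IsBranch g α b σ u₀ M K) {u : ℝ} (hu : u₀ < u)
    (hu0 : u ≤ δ.x 0) : |u * M u| ≤ 1 := by
  obtain ⟨s, hs, rfl⟩ := hδ.exists_eq hu hu0
  exact (h.orbitOn hg hb hB hδ.weingarten).abs_le_one (by rwa [hδ.interior_eq])

theorem lt_bulge (hδ : δ.HasTwoSingularEnds g α a u₀) (h : δ.Follows σ u₀ M) : u₀ < δ.x 0 :=
  h.lt 0 (by rw [hδ.interior_eq]; exact ⟨by linarith [hδ.pos], hδ.pos⟩)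

/-- Evenness of `x` gives `x'(0) = 0`, so the middle of the curve is a turning point. -/
theorem sq_potential_bulge (hg : IsEllipticWeingartenFunction g α)
    (hb : Tendsto (fun t : ℝ => (g t : EReal)) atTop (𝓝 b)) (hδ : δ.HasTwoSingularEnds g α a u₀)
    (h : δ.Follows σ u₀ M) (hB : IsBranch g α b σ u₀ M K) : (δ.x 0 * M (δ.x 0)) ^ 2 = 1 := by
  have ha := hδ.pos
  have h0 : (0 : ℝ) ∈ Ioo (-a) a := ⟨by linarith, ha⟩
  have h0' : (0 : ℝ) ∈ interior δ.I := by rwa [hδ.interior_eq]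
  have horb := h.orbitOn hg hb hB hδ.weingarten
  have hd := horb.hasDerivAt_x 0 h0'
  have hd' : HasDerivAt δ.x (-deriv δ.x 0) 0 := by
    have h1 : HasDerivAt (fun s => δ.x (0 - s)) (-deriv δ.x 0) 0 :=
      HasDerivAt.comp_const_sub 0 0 (by rwa [sub_zero])
    refine h1.congr_of_eventuallyEq ?_
    filter_upwards [Ioo_mem_nhds h0.1 h0.2] with s hs
    rw [zero_sub, hδ.symm_x s (Ioo_subset_Icc_self hs)]
  have h2 := horb.energy 0 h0'
  have h3 : deriv δ.x 0 = 0 := by linarith [hd.unique hd']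
  rw [h3] at h2
  linarith

/-- The curve sweeps out all distances between `u₀` and `x 0`, so `|H| ≤ 1` near `u₀`. This excludes
the cylinder, where `H ≤ 1` at one point only, and a neck, below which `H > 1`. -/
theorem exists_limit_of_isUndularBranch (hg : IsEllipticWeingartenFunction g α)
    (hb : Tendsto (fun t : ℝ => (g t : EReal)) atTop (𝓝 b)) (hδ : δ.HasTwoSingularEnds g α a u₀)
    (h : δ.Follows σ u₀ M) (hB : IsUndularBranch g α b σ u₀ M K) :
    ∃ l ≤ 1, Tendsto (fun u => u * M u) (𝓝[>] u₀) (𝓝 l) := by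
  obtain ⟨v, hv, hKv⟩ := hB.exists_critical
  have hlt := hδ.lt_bulge h
  have hle : ∀ u, u₀ < u → u ≤ δ.x 0 → |u * M u| ≤ 1 := fun u =>
    hδ.abs_potential_le hg hb h hB.toIsBranch
  rcases hB.trichotomy hlt (hle _ hlt le_rfl) hv hKv with ⟨-, h1⟩ | ⟨-, x₀, hx₀, hx₀v, he⟩ | h1
  · obtain ⟨u, hu, hu0⟩ := exists_between hlt
    have := h1 u hu (hle u hu hu0.le)
    rw [← h1 _ hlt (hle _ hlt le_rfl)] at this
    exact absurd this hu0.ne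
  · obtain ⟨u, hu, hu0⟩ := exists_between (lt_min hx₀ hlt)
    have h2 := hle u hu (hu0.le.trans (min_le_right _ _))
    have hux := hu0.trans_le (min_le_left _ _)
    have := hB.strictAntiOn_potential hv hKv ⟨hu, (hux.trans hx₀v).le⟩ ⟨hx₀, hx₀v.le⟩ hux
    simp only [he] at this
    linarith [le_abs_self (u * M u)]
  · exact h1

theorem not_isNodoidType (hδ : δ.HasTwoSingularEnds g α a u₀) (h : δ.Follows σ u₀ M)
    (hB : IsUndularBranch g α b σ u₀ M K) : ¬ δ.IsNodoidType := by
  rintro ⟨s, hs, hz⟩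
  rw [hδ.domain, ← hδ.interior_eq] at hs
  rw [h.deriv_z s hs] at hz
  exact mul_ne_zero hB.sign_ne_zero (hB.potential_pos (h.lt s hs)).ne' hz

/-- Near `u₀` one has `H ≥ -1`, and `H` is increasing, so `H > -1` on the curve: the turning point
at `0` is the bulge and there is no neck. The zero of `M` lies below the bulge, so the curve passes
through it. -/
theorem exists_limit_of_isNodalBranch (hg : IsEllipticWeingartenFunction g α)
    (hb : Tendsto (fun t : ℝ => (g t : EReal)) atTop (𝓝 b)) (hδ : δ.HasTwoSingularEnds g α a u₀)
    (h : δ.Follows σ u₀ M) (hB : IsNodalBranch g α b σ u₀ M K) :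
    (∃ l ≥ -1, Tendsto (fun u => u * M u) (𝓝[>] u₀) (𝓝 l)) ∧ ¬ δ.IsUnduloidType := by
  have hmono := hB.strictMonoOn_potential
  have hlt := hδ.lt_bulge h
  have hle : ∀ u, u₀ < u → u ≤ δ.x 0 → |u * M u| ≤ 1 := fun u =>
    hδ.abs_potential_le hg hb h hB.toIsBranch
  have hgt : ∀ u, u₀ < u → u ≤ δ.x 0 → -1 < u * M u := fun u hu hu0 => by
    obtain ⟨w, hw, hwu⟩ := exists_between hu
    exact (abs_le.1 (hle w hw (hwu.le.trans hu0))).1.trans_lt (hmono hw hu hwu)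
  have h1 : δ.x 0 * M (δ.x 0) = 1 := by
    rcases sq_eq_one_iff.1 (hδ.sq_potential_bulge hg hb h hB.toIsBranch) with h1 | h1
    · exact h1
    · exact absurd h1 (hgt _ hlt le_rfl).ne'
  refine ⟨hB.dichotomy.resolve_left ?_, fun hun => ?_⟩
  · rintro ⟨x₀, hx₀, he⟩
    have : x₀ < δ.x 0 := (hmono.lt_iff_lt hx₀ hlt).1 (by simp only [he, h1]; norm_num)
    exact (hgt x₀ hx₀ this.le).ne' he
  · obtain ⟨v, hv, hMv⟩ := hB.exists_zero
    have hv0 : v < δ.x 0 := (hmono.lt_iff_lt hv hlt).1 (by simp only [hMv, h1]; norm_num)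
    obtain ⟨s, hs, hsv⟩ := hδ.exists_eq hv hv0.le
    refine hun s (by rwa [hδ.domain]) ?_
    rw [h.deriv_z s (by rwa [hδ.interior_eq]), hsv, hMv, mul_zero, mul_zero]

/-- Energy in the limit reads `ν² + l² = 1`, and `l ≠ 0` gives `|ν| < 1`. A negative `ν` would make
`x` increase towards `u₀`, which is below all its values. -/
theorem limit_angle (hg : IsEllipticWeingartenFunction g α)
    (hb : Tendsto (fun t : ℝ => (g t : EReal)) atTop (𝓝 b)) (hδ : δ.HasTwoSingularEnds g α a u₀)
    (h : δ.Follows σ u₀ M) (hB : IsBranch g α b σ u₀ M K) {l ν : ℝ}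
    (hl : Tendsto (fun u => u * M u) (𝓝[>] u₀) (𝓝 l)) (hl0 : l ≠ 0)
    (hν : δ.HasLimitAngles a ν) : ν ∈ Ico (0 : ℝ) 1 := by
  have horb := h.orbitOn hg hb hB hδ.weingarten
  rw [hδ.interior_eq] at horb
  have hp : Tendsto (deriv δ.x) (𝓝[<] a) (𝓝 (-ν)) := hν.2
  have hE : ν ^ 2 + l ^ 2 = 1 := by
    have h1 : Tendsto (fun s => deriv δ.x s ^ 2 + (δ.x s * M (δ.x s)) ^ 2) (𝓝[<] a)
        (𝓝 ((-ν) ^ 2 + l ^ 2)) := (hp.pow 2).add ((hl.comp (hδ.tendsto_x_right h)).pow 2)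
    rw [neg_sq] at h1
    refine tendsto_nhds_unique_of_eventuallyEq h1 tendsto_const_nhds ?_
    filter_upwards [hδ.mem_nhdsLT] with s hs using horb.energy s hs
  have hl2 : 0 < l ^ 2 := by positivity
  refine ⟨not_lt.1 fun hneg => ?_, by nlinarith⟩
  obtain ⟨c, hc, hcp⟩ := (mem_nhdsLT_iff_exists_Ioo_subset).1
    (inter_mem hδ.mem_nhdsLT (hp.eventually (lt_mem_nhds (neg_pos.2 hneg))))
  obtain ⟨t, hct, hta⟩ := exists_between (show c < a from hc)
  have hmono : StrictMonoOn δ.x (Ico t a) := by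
    refine strictMonoOn_of_deriv_pos (convex_Ico _ _) (horb.continuousOn_x.mono fun s hs =>
      (hcp ⟨hct.trans_le hs.1, hs.2⟩).1) fun s hs => ?_
    rw [interior_Ico] at hs
    exact (hcp ⟨hct.trans hs.1, hs.2⟩).2
  have h2 : δ.x t ≤ u₀ := by
    refine ge_of_tendsto hδ.tendsto_x ?_
    filter_upwards [Ioo_mem_nhdsLT hta] with s hs
    exact (hmono ⟨le_rfl, hta⟩ ⟨hs.1.le, hs.2⟩ hs.1).le
  exact absurd (horb.lt t (hcp ⟨hct, hta⟩).1) (not_lt.2 h2)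

end ProfileCurve.HasTwoSingularEnds

/-! ### The function `𝒢` and the behaviour of the branches at the lower end -/

theorem IsWeingartenPrimitive.add_const {g : ℝ → ℝ} {α : ℝ} {b : EReal} {F : ℝ → ℝ}
    (hF : IsWeingartenPrimitive g α b F) (c : ℝ) :
    IsWeingartenPrimitive g α b fun t => F t + c :=
  fun t hbt ht => (hF t hbt ht).add_const c

/-- Two primitives differ by a constant on the interval `J`, so the limit is only multiplied by a
positive factor. -/
theorem IsWeingartenPrimitive.exists_tendsto {g : ℝ → ℝ} {α : ℝ} {b : EReal} {F F' : ℝ → ℝ}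
    (hF : IsWeingartenPrimitive g α b F) (hF' : IsWeingartenPrimitive g α b F') {J : Set ℝ}
    (hJo : IsOpen J) (hJc : J.OrdConnected) (hJ : ∀ t ∈ J, b < (t : EReal) ∧ t ≠ α) {l : Filter ℝ}
    [l.NeBot] (hl : J ∈ l) {L : ℝ} (hL : Tendsto (weingartenG F) l (𝓝 L)) :
    ∃ L', Tendsto (weingartenG F') l (𝓝 L') := by
  obtain ⟨t₀, ht₀⟩ := Filter.nonempty_of_mem hl
  refine ⟨_, (hL.mul_const (Real.exp (F' t₀ - F t₀))).congr' ?_⟩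
  filter_upwards [hl] with t ht
  have := hJo.eq_of_hasDerivAt_zero hJc (φ := fun t => F' t - F t) (fun s hs =>
    ((hF' s (hJ s hs).1 (hJ s hs).2).fun_sub (hF s (hJ s hs).1 (hJ s hs).2)).congr_deriv
      (sub_self _)) ht₀ ht
  rw [this, weingartenG, weingartenG, mul_assoc, ← Real.exp_add, add_sub_cancel]

namespace IsSideInverse

variable {f : ℝ → ℝ} {J : Set ℝ} {F : ℝ → ℝ} {u₀ : ℝ} {Λ : ℝ → ℝ} {σ : ℝ}

/-- Changing the constant of integration: the same curvatures occur at distances multiplied by `c`.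
This is not a homothety, which would change the curvatures; accordingly the limit of `u Λ(u)` is
multiplied by `c`. -/
theorem rescale (h : IsSideInverse f J F u₀ Λ) {c : ℝ} (hc : 0 < c) :
    IsSideInverse f J (fun t => F t + Real.log c) (c * u₀) (fun u => Λ (u / c)) := by
  have hlt : ∀ u, c * u₀ < u → u₀ < u / c := fun u hu => by rwa [lt_div_iff₀' hc]
  have hexp : ∀ t, Real.exp (F t + Real.log c) = c * Real.exp (F t) := fun t => by
    rw [Real.exp_add, Real.exp_log hc, mul_comm]
  refine ⟨mul_nonneg hc.le h.nonneg, fun u hu => h.mem _ (hlt u hu), fun u hu => ?_,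
    fun t ht => ?_, fun t ht => ?_, fun u hu => ?_⟩
  · rw [hexp, h.exp_apply _ (hlt u hu), mul_div_cancel₀ _ hc.ne']
  · rw [hexp]
    exact mul_lt_mul_of_pos_left (h.lt_exp t ht) hc
  · rw [hexp, mul_div_cancel_left₀ _ hc.ne']
    exact h.apply_exp t ht
  · refine ((h.deriv _ (hlt u hu)).comp u ((hasStrictDerivAt_id u).div_const c)).congr_deriv ?_
    have : u ≠ 0 := by
      have := (mul_nonneg hc.le h.nonneg).trans_lt hu
      exact this.ne'
    field_simp

theorem tendsto_rescale {c : ℝ} (hc : 0 < c) {l : ℝ}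
    (hl : Tendsto (fun u => u * (σ * Λ u)) (𝓝[>] u₀) (𝓝 l)) :
    Tendsto (fun u => u * (σ * Λ (u / c))) (𝓝[>] (c * u₀)) (𝓝 (c * l)) := by
  have h1 : Tendsto (fun u => u / c) (𝓝[>] (c * u₀)) (𝓝[>] u₀) := by
    refine tendsto_nhdsWithin_iff.2 ⟨?_, ?_⟩
    · have : Tendsto (fun u => u / c) (𝓝 (c * u₀)) (𝓝 (c * u₀ / c)) :=
        (continuous_id.div_const c).tendsto _
      rw [mul_div_cancel_left₀ _ hc.ne'] at this
      exact this.mono_left nhdsWithin_le_nhds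
    · filter_upwards [self_mem_nhdsWithin] with u hu
      exact (lt_div_iff₀' hc).2 hu
  refine ((hl.comp h1).const_mul c).congr fun u => ?_
  simp only [Function.comp]
  field_simp

/-- Under the substitution `u = exp(F(t))`, `t = Λ(u)`, the product `u Λ(u)` is `𝒢(t)`. -/
theorem tendsto_potential_iff (h : IsSideInverse f J F u₀ Λ) {l : Filter ℝ} (hJ : J ∈ l)
    (hΛ : Tendsto Λ (𝓝[>] u₀) l) (hexp : Tendsto (fun t => Real.exp (F t)) l (𝓝[>] u₀))
    (hσ : σ * σ = 1) {L : ℝ} :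
    Tendsto (fun u => u * (σ * Λ u)) (𝓝[>] u₀) (𝓝 (σ * L)) ↔
      Tendsto (weingartenG F) l (𝓝 L) := by
  constructor <;> intro hL
  · have := (hL.comp hexp).const_mul σ
    rw [← mul_assoc, hσ, one_mul] at this
    refine this.congr' ?_
    filter_upwards [hJ] with t ht
    simp only [Function.comp, h.apply_exp t ht, weingartenG]
    linear_combination t * Real.exp (F t) * hσ
  · refine ((hL.comp hΛ).const_mul σ).congr' ?_
    filter_upwards [self_mem_nhdsWithin] with u hu
    simp only [Function.comp, weingartenG, h.exp_apply u hu]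
    ring

/-- With `|Λ| → ∞`, the product `u Λ(u)` can only stay finite if `u` tends to `0`. -/
theorem eq_zero_of_tendsto (h : IsSideInverse f J F u₀ Λ)
    (hΛ : Tendsto (fun u => |Λ u|) (𝓝[>] u₀) atTop) (hσ : σ * σ = 1) {l : ℝ}
    (hl : Tendsto (fun u => u * (σ * Λ u)) (𝓝[>] u₀) (𝓝 l)) : u₀ = 0 := by
  by_contra hne
  have hpos : 0 < u₀ := lt_of_le_of_ne h.nonneg (Ne.symm hne)
  have hid : Tendsto (fun u : ℝ => u) (𝓝[>] u₀) (𝓝 u₀) := tendsto_id.mono_left nhdsWithin_le_nhds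
  refine not_tendsto_nhds_of_tendsto_atTop (hid.pos_mul_atTop hpos hΛ) |l| (hl.abs.congr' ?_)
  have hσ' : |σ| = 1 := by
    rcases mul_self_eq_one_iff.1 hσ with rfl | rfl <;> norm_num
  filter_upwards [self_mem_nhdsWithin] with u hu
  rw [abs_mul, abs_mul, hσ', one_mul, abs_of_pos (hpos.trans hu)]

variable {g : ℝ → ℝ} {α : ℝ} {b : EReal}

theorem right_tendsto_abs (hg : IsEllipticWeingartenFunction g α)
    (hb : Tendsto (fun t : ℝ => (g t : EReal)) atTop (𝓝 b)) (hF : IsWeingartenPrimitive g α b F)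
    (h : IsSideInverse (weingartenF g α) (Ioi α) F u₀ Λ) :
    Tendsto (fun u => |Λ u|) (𝓝[>] u₀) atTop :=
  tendsto_abs_atTop_atTop.comp (right_tendsto_atTop hg hb hF h)

theorem left_tendsto_abs (hg : IsEllipticWeingartenFunction g α)
    (hb : Tendsto (fun t : ℝ => (g t : EReal)) atTop (𝓝 b)) (hF : IsWeingartenPrimitive g α b F)
    (h : IsSideInverse (weingartenF g α) ({t : ℝ | b < (t : EReal)} ∩ Iio α) F u₀ Λ)
    (hbot : b = ⊥) : Tendsto (fun u => |Λ u|) (𝓝[>] u₀) atTop :=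
  tendsto_abs_atBot_atTop.comp (left_tendsto_atBot hg hb hF h hbot)

theorem right_tendsto_iff (hg : IsEllipticWeingartenFunction g α)
    (hb : Tendsto (fun t : ℝ => (g t : EReal)) atTop (𝓝 b)) (hF : IsWeingartenPrimitive g α b F)
    (h : IsSideInverse (weingartenF g α) (Ioi α) F u₀ Λ) (hσ : σ * σ = 1) {L : ℝ} :
    Tendsto (fun u => u * (σ * Λ u)) (𝓝[>] u₀) (𝓝 (σ * L)) ↔
      Tendsto (weingartenG F) atTop (𝓝 L) :=
  h.tendsto_potential_iff (Ioi_mem_atTop α) (right_tendsto_atTop hg hb hF h)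
    (right_tendsto_exp hg hb hF h) hσ

theorem left_mem_atBot (hbot : b = ⊥) : {t : ℝ | b < (t : EReal)} ∩ Iio α ∈ atBot := by
  filter_upwards [eventually_lt_atBot α] with t ht
  exact ⟨by rw [mem_ofPred_eq, hbot]; exact EReal.bot_lt_coe t, ht⟩

theorem left_tendsto_iff (hg : IsEllipticWeingartenFunction g α)
    (hb : Tendsto (fun t : ℝ => (g t : EReal)) atTop (𝓝 b)) (hF : IsWeingartenPrimitive g α b F)
    (h : IsSideInverse (weingartenF g α) ({t : ℝ | b < (t : EReal)} ∩ Iio α) F u₀ Λ)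
    (hbot : b = ⊥) (hσ : σ * σ = 1) {L : ℝ} :
    Tendsto (fun u => u * (σ * Λ u)) (𝓝[>] u₀) (𝓝 (σ * L)) ↔
      Tendsto (weingartenG F) atBot (𝓝 L) :=
  h.tendsto_potential_iff (left_mem_atBot hbot) (left_tendsto_atBot hg hb hF h hbot)
    (left_tendsto_exp hg hb hF h hbot) hσ

theorem right_exists_limit (hg : IsEllipticWeingartenFunction g α)
    (hb : Tendsto (fun t : ℝ => (g t : EReal)) atTop (𝓝 b)) (hF : IsWeingartenPrimitive g α b F)
    (h : IsSideInverse (weingartenF g α) (Ioi α) F u₀ Λ) (hσ : σ * σ = 1) {l : ℝ}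
    (hl : Tendsto (fun u => u * (σ * Λ u)) (𝓝[>] u₀) (𝓝 l)) {F' : ℝ → ℝ}
    (hF' : IsWeingartenPrimitive g α b F') : ∃ L, Tendsto (weingartenG F') atTop (𝓝 L) := by
  refine hF.exists_tendsto hF' isOpen_Ioi ordConnected_Ioi (fun t ht =>
    ⟨(hg.lt_center hb).trans (EReal.coe_lt_coe_iff.2 ht), ne_of_gt ht⟩) (Ioi_mem_atTop α)
    ((right_tendsto_iff hg hb hF h hσ (L := σ * l)).1 ?_)
  rwa [← mul_assoc, hσ, one_mul]

theorem left_exists_limit (hg : IsEllipticWeingartenFunction g α)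
    (hb : Tendsto (fun t : ℝ => (g t : EReal)) atTop (𝓝 b)) (hF : IsWeingartenPrimitive g α b F)
    (h : IsSideInverse (weingartenF g α) ({t : ℝ | b < (t : EReal)} ∩ Iio α) F u₀ Λ)
    (hbot : b = ⊥) (hσ : σ * σ = 1) {l : ℝ}
    (hl : Tendsto (fun u => u * (σ * Λ u)) (𝓝[>] u₀) (𝓝 l)) {F' : ℝ → ℝ}
    (hF' : IsWeingartenPrimitive g α b F') : ∃ L, Tendsto (weingartenG F') atBot (𝓝 L) := by
  refine hF.exists_tendsto hF' ((IsEllipticWeingartenFunction.isOpen_domain b).inter isOpen_Iio)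
    ?_ (fun t ht => ⟨ht.1, ne_of_lt ht.2⟩) (left_mem_atBot hbot)
    ((left_tendsto_iff hg hb hF h hbot hσ (L := σ * l)).1 ?_)
  · refine OrdConnected.inter ⟨fun x hx y _ z hz => ?_⟩ ordConnected_Iio
    exact lt_of_lt_of_le (show b < (x : EReal) from hx) (EReal.coe_le_coe_iff.2 hz.1)
  · rwa [← mul_assoc, hσ, one_mul]

/-- If `b` is finite, then `b` is the limit curvature of the parallels. -/
theorem left_tendsto_potential (hg : IsEllipticWeingartenFunction g α)
    (hb : Tendsto (fun t : ℝ => (g t : EReal)) atTop (𝓝 b)) (hF : IsWeingartenPrimitive g α b F)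
    (h : IsSideInverse (weingartenF g α) ({t : ℝ | b < (t : EReal)} ∩ Iio α) F u₀ Λ) {β : ℝ}
    (hβ : b = (β : EReal)) :
    Tendsto (fun u => u * (σ * Λ u)) (𝓝[>] u₀) (𝓝 (σ * (β * u₀))) := by
  have hid : Tendsto (fun u : ℝ => u) (𝓝[>] u₀) (𝓝 u₀) := tendsto_id.mono_left nhdsWithin_le_nhds
  have := hid.mul ((left_tendsto_finite hg hb hF h hβ).const_mul σ)
  rwa [show u₀ * (σ * β) = σ * (β * u₀) by ring] at this

/-- Rescaling the surface adjusts the limit angle. -/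
theorem exists_rescale {f : ℝ → ℝ} (hF : IsWeingartenPrimitive g α b F)
    (h : IsSideInverse f J F 0 Λ) {l : ℝ}
    (hl : Tendsto (fun u => u * (σ * Λ u)) (𝓝[>] 0) (𝓝 l)) (hl0 : l ≠ 0) {ν : ℝ}
    (hν : ν ∈ Ico (0 : ℝ) 1) : ∃ F' Λ' l', IsWeingartenPrimitive g α b F' ∧
      IsSideInverse f J F' 0 Λ' ∧ Tendsto (fun u => u * (σ * Λ' u)) (𝓝[>] 0) (𝓝 l') ∧
      |l'| ≤ 1 ∧ √(1 - l' ^ 2) = ν := by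
  have hν2 : 0 < 1 - ν ^ 2 := by nlinarith [hν.1, hν.2]
  -- The factor that brings `|l|` to `√(1 - ν²)`; it is positive because `ν < 1`.
  have hc : 0 < √(1 - ν ^ 2) / |l| := div_pos (Real.sqrt_pos.2 hν2) (abs_pos.2 hl0)
  have hsq : (√(1 - ν ^ 2) / |l| * l) ^ 2 = 1 - ν ^ 2 := by
    rw [mul_pow, div_pow, Real.sq_sqrt hν2.le, sq_abs]
    field_simp
  have h1 := h.rescale hc
  have h2 := tendsto_rescale hc hl
  rw [mul_zero] at h1 h2
  refine ⟨_, _, _, hF.add_const _, h1, h2, ?_, ?_⟩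
  · rw [← sq_le_one_iff_abs_le_one, hsq]
    nlinarith [hν.1]
  · rw [hsq, sub_sub_cancel, Real.sqrt_sq hν.1]

end IsSideInverse

/-! ### Existence and classification -/

section

variable {g : ℝ → ℝ} {α : ℝ} {b : EReal} {σ : ℝ}

/-- In the extended reals `b * τ < -1` expresses `τ > -1/b` uniformly: for `b = -∞` the product is
`⊥` and the condition is void. -/
theorem mul_lt_neg_one_of_lt {l τ : ℝ} (hl : b < (l : EReal)) (hτ : 0 < τ) (h : τ * l = -1) :
    b * (τ : EReal) < -1 := by
  have hneg : (-1 : EReal) = ((-1 : ℝ) : EReal) := by simp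
  rw [hneg]
  induction b with
  | bot => rw [EReal.bot_mul_coe_of_pos hτ]; exact EReal.bot_lt_coe _
  | top => exact absurd hl (not_lt.2 le_top)
  | coe β =>
    rw [← EReal.coe_mul, EReal.coe_lt_coe_iff, ← h, mul_comm]
    exact mul_lt_mul_of_pos_left (EReal.coe_lt_coe_iff.1 hl) hτ

theorem neg_one_le_coe_mul {β d : ℝ} : -1 ≤ (β : EReal) * (d : EReal) ↔ -1 ≤ β * d := by
  have hneg : (-1 : EReal) = ((-1 : ℝ) : EReal) := by simp
  rw [hneg, ← EReal.coe_mul, EReal.coe_le_coe_iff]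

namespace ProfileCurve

variable {γ δ : ProfileCurve}

/-- The side of `α` on which the parallels' curvature stays and the sign of `α` give four cases: the
branch is undular when that side avoids `0` and nodal when it contains `0`. -/
theorem IsRotationalWeingarten.exists_branch (hg : IsEllipticWeingartenFunction g α)
    (hb : Tendsto (fun t : ℝ => (g t : EReal)) atTop (𝓝 b)) (hα : α ≠ 0) (hb0 : b < 0)
    (hr : γ.IsRotationalWeingarten g α)
    (hns : ¬ ∀ s ∈ interior γ.I, deriv γ.z s / γ.x s = α) :
    ∃ (F : ℝ → ℝ) (u₀ : ℝ) (Λ : ℝ → ℝ) (σ : ℝ) (J : Set ℝ), IsWeingartenPrimitive g α b F ∧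
      IsSideInverse (weingartenF g α) J F u₀ Λ ∧ γ.Follows σ u₀ (fun u => σ * Λ u) ∧
      ((IsUndularBranch g α b σ u₀ (fun u => σ * Λ u) (fun u => σ * weingartenF g α (Λ u)) ∧
          ((0 < α ∧ σ = 1 ∧ J = Ioi α) ∨
            (α < 0 ∧ σ = -1 ∧ J = {t : ℝ | b < (t : EReal)} ∩ Iio α))) ∨
        (IsNodalBranch g α b σ u₀ (fun u => σ * Λ u) (fun u => σ * weingartenF g α (Λ u)) ∧
          ((α < 0 ∧ σ = -1 ∧ J = Ioi α) ∨
            (0 < α ∧ σ = 1 ∧ J = {t : ℝ | b < (t : EReal)} ∩ Iio α)))) := by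
  obtain ⟨F, u₀, Λ, hF, hfol, hΛ | hΛ⟩ := hr.exists_follows hg hb hns <;>
    rcases hα.lt_or_gt with h | h
  · exact ⟨F, u₀, Λ, -1, _, hF, hΛ, hfol _ (by norm_num),
      Or.inr ⟨hΛ.right_isNodalBranch hg hb hF h, Or.inl ⟨h, rfl, rfl⟩⟩⟩
  · exact ⟨F, u₀, Λ, 1, _, hF, hΛ, hfol _ (by norm_num),
      Or.inl ⟨hΛ.right_isUndularBranch hg hb hb0 hF h, Or.inl ⟨h, rfl, rfl⟩⟩⟩
  · exact ⟨F, u₀, Λ, -1, _, hF, hΛ, hfol _ (by norm_num),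
      Or.inl ⟨hΛ.left_isUndularBranch hg hb hb0 hF h, Or.inr ⟨h, rfl, rfl⟩⟩⟩
  · exact ⟨F, u₀, Λ, 1, _, hF, hΛ, hfol _ (by norm_num),
      Or.inr ⟨hΛ.left_isNodalBranch hg hb hb0 hF h, Or.inr ⟨h, rfl, rfl⟩⟩⟩

theorem HasTwoSingularEnds.exists_branch (hg : IsEllipticWeingartenFunction g α)
    (hb : Tendsto (fun t : ℝ => (g t : EReal)) atTop (𝓝 b)) (hα : α ≠ 0) (hb0 : b < 0) {a d : ℝ}
    (hδ : δ.HasTwoSingularEnds g α a d) :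
    ∃ (F Λ : ℝ → ℝ) (σ l : ℝ) (J : Set ℝ), IsWeingartenPrimitive g α b F ∧
      IsSideInverse (weingartenF g α) J F d Λ ∧
      Tendsto (fun u => u * (σ * Λ u)) (𝓝[>] d) (𝓝 l) ∧
      (∀ ν, δ.HasLimitAngles a ν → ν ∈ Ico (0 : ℝ) 1) ∧
      ((¬ δ.IsNodoidType ∧ l ≤ 1 ∧ ((0 < α ∧ σ = 1 ∧ J = Ioi α) ∨
          (α < 0 ∧ σ = -1 ∧ J = {t : ℝ | b < (t : EReal)} ∩ Iio α))) ∨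
        (¬ δ.IsUnduloidType ∧ -1 ≤ l ∧ ((α < 0 ∧ σ = -1 ∧ J = Ioi α) ∨
          (0 < α ∧ σ = 1 ∧ J = {t : ℝ | b < (t : EReal)} ∩ Iio α)))) := by
  obtain ⟨F, u₀, Λ, σ, J, hF, hΛ, hfol, ⟨hB, hside⟩ | ⟨hB, hside⟩⟩ :=
    hδ.weingarten.exists_branch hg hb hα hb0 (hδ.not_umbilical hg hb) <;>
    obtain rfl := hδ.dist_eq hg hb hfol hB.toIsBranch
  · obtain ⟨l, hl1, hl⟩ := hδ.exists_limit_of_isUndularBranch hg hb hfol hB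
    exact ⟨F, Λ, σ, l, J, hF, hΛ, hl, fun ν =>
      hδ.limit_angle hg hb hfol hB.toIsBranch hl (hB.limit_pos hl).ne',
      Or.inl ⟨hδ.not_isNodoidType hfol hB, hl1, hside⟩⟩
  · obtain ⟨⟨l, hl1, hl⟩, hun⟩ := hδ.exists_limit_of_isNodalBranch hg hb hfol hB
    exact ⟨F, Λ, σ, l, J, hF, hΛ, hl, fun ν =>
      hδ.limit_angle hg hb hfol hB.toIsBranch hl (hB.limit_neg hl).ne,
      Or.inr ⟨hun, hl1, hside⟩⟩

end ProfileCurve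

namespace IsSideInverse

variable {F Λ : ℝ → ℝ} {d : ℝ}

theorem left_eq_bot (hg : IsEllipticWeingartenFunction g α)
    (hb : Tendsto (fun t : ℝ => (g t : EReal)) atTop (𝓝 b)) (hF : IsWeingartenPrimitive g α b F)
    (h : IsSideInverse (weingartenF g α) ({t : ℝ | b < (t : EReal)} ∩ Iio α) F 0 Λ) : b = ⊥ := by
  by_contra hbot
  exact lt_irrefl _ (left_pos hg hb hF h hbot)

/-- For `b = -∞` a finite limit would force `d = 0`, so `b` is finite and `Λ → b`. -/
theorem left_exists_limit_eq (hg : IsEllipticWeingartenFunction g α)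
    (hb : Tendsto (fun t : ℝ => (g t : EReal)) atTop (𝓝 b)) (hF : IsWeingartenPrimitive g α b F)
    (h : IsSideInverse (weingartenF g α) ({t : ℝ | b < (t : EReal)} ∩ Iio α) F d Λ) (hd : 0 < d)
    (hσ : σ * σ = 1) {l : ℝ} (hl : Tendsto (fun u => u * (σ * Λ u)) (𝓝[>] d) (𝓝 l)) :
    ∃ β : ℝ, b = (β : EReal) ∧ l = σ * (β * d) := by
  have hbot : b ≠ ⊥ := fun hbot =>
    hd.ne' (h.eq_zero_of_tendsto (left_tendsto_abs hg hb hF h hbot) hσ hl)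
  obtain ⟨β, hβ⟩ : ∃ β : ℝ, b = (β : EReal) :=
    ⟨b.toReal, (EReal.coe_toReal (hg.lt_center hb).ne_top hbot).symm⟩
  exact ⟨β, hβ, tendsto_nhds_unique hl (left_tendsto_potential hg hb hF h hβ)⟩

theorem exists_left_inverse_of_pos (hg : IsEllipticWeingartenFunction g α)
    (hb : Tendsto (fun t : ℝ => (g t : EReal)) atTop (𝓝 b)) (hd : 0 < d) {β : ℝ}
    (hβ : b = (β : EReal)) : ∃ F Λ, IsWeingartenPrimitive g α b F ∧
      IsSideInverse (weingartenF g α) ({t : ℝ | b < (t : EReal)} ∩ Iio α) F d Λ := by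
  obtain ⟨F, hF⟩ := hg.exists_primitive hb
  obtain ⟨u₀, Λ, h⟩ := hg.exists_left_inverse hb hF
  have hu₀ := left_pos hg hb hF h (by rw [hβ]; exact EReal.coe_ne_bot _)
  have := h.rescale (div_pos hd hu₀)
  rw [div_mul_cancel₀ _ hu₀.ne'] at this
  exact ⟨_, _, hF.add_const _, this⟩

end IsSideInverse

namespace ProfileCurve

variable {J : Set ℝ} {F Λ : ℝ → ℝ}

theorem exists_isPinchedUnduloid (hg : IsEllipticWeingartenFunction g α)
    (hb : Tendsto (fun t : ℝ => (g t : EReal)) atTop (𝓝 b))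
    (hbr : ∀ F u₀ Λ, IsWeingartenPrimitive g α b F → IsSideInverse (weingartenF g α) J F u₀ Λ →
      IsUndularBranch g α b σ u₀ (fun u => σ * Λ u) (fun u => σ * weingartenF g α (Λ u)))
    (hF : IsWeingartenPrimitive g α b F) (h : IsSideInverse (weingartenF g α) J F 0 Λ) {l : ℝ}
    (hl : Tendsto (fun u => u * (σ * Λ u)) (𝓝[>] 0) (𝓝 l)) {ν : ℝ} (hν : ν ∈ Ico (0 : ℝ) 1) :
    ∃ δ : ProfileCurve, δ.IsPinchedUnduloid g α ν := by
  obtain ⟨F', Λ', l', hF', h', hl', hl1, rfl⟩ :=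
    h.exists_rescale hF hl ((hbr _ _ _ hF h).limit_pos hl).ne' hν
  obtain ⟨δ, a, h1, h2, h3, h4, -⟩ :=
    (hbr _ _ _ hF' h').exists_singular_ends hg hb hl' (abs_le.1 hl1).2
  exact ⟨δ, a, h1, h2, h3, h4⟩

theorem exists_isPinchedNodoid (hg : IsEllipticWeingartenFunction g α)
    (hb : Tendsto (fun t : ℝ => (g t : EReal)) atTop (𝓝 b))
    (hbr : ∀ F u₀ Λ, IsWeingartenPrimitive g α b F → IsSideInverse (weingartenF g α) J F u₀ Λ →
      IsNodalBranch g α b σ u₀ (fun u => σ * Λ u) (fun u => σ * weingartenF g α (Λ u)))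
    (hF : IsWeingartenPrimitive g α b F) (h : IsSideInverse (weingartenF g α) J F 0 Λ) {l : ℝ}
    (hl : Tendsto (fun u => u * (σ * Λ u)) (𝓝[>] 0) (𝓝 l)) {ν : ℝ} (hν : ν ∈ Ico (0 : ℝ) 1) :
    ∃ δ : ProfileCurve, δ.IsPinchedNodoid g α ν := by
  obtain ⟨F', Λ', l', hF', h', hl', hl1, rfl⟩ :=
    h.exists_rescale hF hl ((hbr _ _ _ hF h).limit_neg hl).ne hν
  obtain ⟨δ, a, h1, h2, h3, -⟩ :=
    (hbr _ _ _ hF' h').exists_singular_ends hg hb hl' (abs_le.1 hl1).1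
  exact ⟨δ, a, h1, h2, h3⟩

/-- A given surface follows an undular branch with `u₀ = 0` and finite limit, which translates into
a limit of `𝒢`. Conversely such a limit forces `u₀ = 0`, and the constant of integration is tuned to
the angle `ν`. -/
theorem exists_isPinchedUnduloid_iff (hg : IsEllipticWeingartenFunction g α)
    (hb : Tendsto (fun t : ℝ => (g t : EReal)) atTop (𝓝 b)) (hα : α ≠ 0) (hb0 : b < 0)
    (hF : IsWeingartenPrimitive g α b F) (ν : ℝ) :
    (∃ δ : ProfileCurve, δ.IsPinchedUnduloid g α ν) ↔
      ν ∈ Ico (0 : ℝ) 1 ∧ (((∃ L : ℝ, Tendsto (weingartenG F) atTop (𝓝 L)) ∧ 0 < α) ∨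
        (b = ⊥ ∧ (∃ L : ℝ, Tendsto (weingartenG F) atBot (𝓝 L)) ∧ α < 0)) := by
  constructor
  · rintro ⟨δ, a, hδ, hang, -, hun⟩
    obtain ⟨F', Λ, σ, l, J, hF', hΛ, hl, hν, ⟨-, -, h⟩ | ⟨h, -⟩⟩ := hδ.exists_branch hg hb hα hb0
    · refine ⟨hν ν hang, ?_⟩
      rcases h with ⟨h, rfl, rfl⟩ | ⟨h, rfl, rfl⟩
      · exact Or.inl ⟨hΛ.right_exists_limit hg hb hF' (by norm_num) hl hF, h⟩
      · have hbot := hΛ.left_eq_bot hg hb hF'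
        exact Or.inr ⟨hbot, hΛ.left_exists_limit hg hb hF' hbot (by norm_num) hl hF, h⟩
    · exact absurd hun h
  · rintro ⟨hν, ⟨⟨L, hL⟩, h⟩ | ⟨hbot, ⟨L, hL⟩, h⟩⟩
    · obtain ⟨u₀, Λ, hΛ⟩ := hg.exists_right_inverse hb hF
      have hl := (hΛ.right_tendsto_iff hg hb hF (σ := 1) (by norm_num)).2 hL
      obtain rfl := hΛ.eq_zero_of_tendsto (hΛ.right_tendsto_abs hg hb hF) (by norm_num) hl
      exact exists_isPinchedUnduloid hg hb
        (fun F u₀ Λ hF hΛ => hΛ.right_isUndularBranch hg hb hb0 hF h) hF hΛ hl hν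
    · obtain ⟨u₀, Λ, hΛ⟩ := hg.exists_left_inverse hb hF
      have hl := (hΛ.left_tendsto_iff hg hb hF hbot (σ := -1) (by norm_num)).2 hL
      obtain rfl := hΛ.eq_zero_of_tendsto (hΛ.left_tendsto_abs hg hb hF hbot) (by norm_num) hl
      exact exists_isPinchedUnduloid hg hb
        (fun F u₀ Λ hF hΛ => hΛ.left_isUndularBranch hg hb hb0 hF h) hF hΛ hl hν

theorem exists_isPinchedNodoid_iff (hg : IsEllipticWeingartenFunction g α)
    (hb : Tendsto (fun t : ℝ => (g t : EReal)) atTop (𝓝 b)) (hα : α ≠ 0) (hb0 : b < 0)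
    (hF : IsWeingartenPrimitive g α b F) (ν : ℝ) :
    (∃ δ : ProfileCurve, δ.IsPinchedNodoid g α ν) ↔
      ν ∈ Ico (0 : ℝ) 1 ∧ (((∃ L : ℝ, Tendsto (weingartenG F) atTop (𝓝 L)) ∧ α < 0) ∨
        (b = ⊥ ∧ (∃ L : ℝ, Tendsto (weingartenG F) atBot (𝓝 L)) ∧ 0 < α)) := by
  constructor
  · rintro ⟨δ, a, hδ, hang, hno⟩
    obtain ⟨F', Λ, σ, l, J, hF', hΛ, hl, hν, ⟨h, -⟩ | ⟨-, -, h⟩⟩ := hδ.exists_branch hg hb hα hb0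
    · exact absurd hno h
    · refine ⟨hν ν hang, ?_⟩
      rcases h with ⟨h, rfl, rfl⟩ | ⟨h, rfl, rfl⟩
      · exact Or.inl ⟨hΛ.right_exists_limit hg hb hF' (by norm_num) hl hF, h⟩
      · have hbot := hΛ.left_eq_bot hg hb hF'
        exact Or.inr ⟨hbot, hΛ.left_exists_limit hg hb hF' hbot (by norm_num) hl hF, h⟩
  · rintro ⟨hν, ⟨⟨L, hL⟩, h⟩ | ⟨hbot, ⟨L, hL⟩, h⟩⟩
    · obtain ⟨u₀, Λ, hΛ⟩ := hg.exists_right_inverse hb hF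
      have hl := (hΛ.right_tendsto_iff hg hb hF (σ := -1) (by norm_num)).2 hL
      obtain rfl := hΛ.eq_zero_of_tendsto (hΛ.right_tendsto_abs hg hb hF) (by norm_num) hl
      exact exists_isPinchedNodoid hg hb
        (fun F u₀ Λ hF hΛ => hΛ.right_isNodalBranch hg hb hF h) hF hΛ hl hν
    · obtain ⟨u₀, Λ, hΛ⟩ := hg.exists_left_inverse hb hF
      have hl := (hΛ.left_tendsto_iff hg hb hF hbot (σ := 1) (by norm_num)).2 hL
      obtain rfl := hΛ.eq_zero_of_tendsto (hΛ.left_tendsto_abs hg hb hF hbot) (by norm_num) hl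
      exact exists_isPinchedNodoid hg hb
        (fun F u₀ Λ hF hΛ => hΛ.left_isNodalBranch hg hb hb0 hF h) hF hΛ hl hν

/-- With `σ = -1` the limit is `l = -b d`, so the condition `l ≤ 1` is `-1 ≤ b d`. The side above
`α` is impossible: there `Λ → ∞` and a finite limit means `d = 0`. -/
theorem exists_isSingularUnduloid_iff (hg : IsEllipticWeingartenFunction g α)
    (hb : Tendsto (fun t : ℝ => (g t : EReal)) atTop (𝓝 b)) (hα : α ≠ 0) (hb0 : b < 0) (d : ℝ) :
    (∃ δ : ProfileCurve, δ.IsSingularUnduloid g α d) ↔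
      0 < d ∧ -1 ≤ b * (d : EReal) ∧ b ≠ ⊥ ∧ α < 0 := by
  constructor
  · rintro ⟨δ, hd, a, hδ, -, hun⟩
    obtain ⟨F, Λ, σ, l, J, hF, hΛ, hl, -, ⟨-, hl1, h⟩ | ⟨h, -⟩⟩ := hδ.exists_branch hg hb hα hb0
    · rcases h with ⟨h, rfl, rfl⟩ | ⟨h, rfl, rfl⟩
      · exact absurd (hΛ.eq_zero_of_tendsto (hΛ.right_tendsto_abs hg hb hF) (by norm_num) hl) hd.ne'
      · obtain ⟨β, rfl, rfl⟩ := hΛ.left_exists_limit_eq hg hb hF hd (by norm_num) hl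
        exact ⟨hd, neg_one_le_coe_mul.2 (by linarith), EReal.coe_ne_bot _, h⟩
    · exact absurd hun h
  · rintro ⟨hd, hbd, hbot, h⟩
    obtain ⟨β, rfl⟩ : ∃ β : ℝ, b = (β : EReal) :=
      ⟨b.toReal, (EReal.coe_toReal (hg.lt_center hb).ne_top hbot).symm⟩
    obtain ⟨F, Λ, hF, hΛ⟩ := IsSideInverse.exists_left_inverse_of_pos hg hb hd rfl
    have hl := hΛ.left_tendsto_potential (σ := -1) hg hb hF rfl
    obtain ⟨δ, a, h1, -, h3, h4, -⟩ :=
      (hΛ.left_isUndularBranch hg hb hb0 hF h).exists_singular_ends hg hb hl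
        (by linarith [neg_one_le_coe_mul.1 hbd])
    exact ⟨δ, hd, a, h1, h3, h4⟩

theorem exists_isSingularNodoid_iff (hg : IsEllipticWeingartenFunction g α)
    (hb : Tendsto (fun t : ℝ => (g t : EReal)) atTop (𝓝 b)) (hα : α ≠ 0) (hb0 : b < 0) (d : ℝ) :
    (∃ δ : ProfileCurve, δ.IsSingularNodoid g α d) ↔
      0 < d ∧ -1 ≤ b * (d : EReal) ∧ b ≠ ⊥ ∧ 0 < α := by
  constructor
  · rintro ⟨δ, hd, a, hδ, hno⟩
    obtain ⟨F, Λ, σ, l, J, hF, hΛ, hl, -, ⟨h, -⟩ | ⟨-, hl1, h⟩⟩ := hδ.exists_branch hg hb hα hb0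
    · exact absurd hno h
    · rcases h with ⟨h, rfl, rfl⟩ | ⟨h, rfl, rfl⟩
      · exact absurd (hΛ.eq_zero_of_tendsto (hΛ.right_tendsto_abs hg hb hF) (by norm_num) hl) hd.ne'
      · obtain ⟨β, rfl, rfl⟩ := hΛ.left_exists_limit_eq hg hb hF hd (by norm_num) hl
        exact ⟨hd, neg_one_le_coe_mul.2 (by linarith), EReal.coe_ne_bot _, h⟩
  · rintro ⟨hd, hbd, hbot, h⟩
    obtain ⟨β, rfl⟩ : ∃ β : ℝ, b = (β : EReal) :=
      ⟨b.toReal, (EReal.coe_toReal (hg.lt_center hb).ne_top hbot).symm⟩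
    obtain ⟨F, Λ, hF, hΛ⟩ := IsSideInverse.exists_left_inverse_of_pos hg hb hd rfl
    have hl := hΛ.left_tendsto_potential (σ := 1) hg hb hF rfl
    obtain ⟨δ, a, h1, -, h3, -⟩ :=
      (hΛ.left_isNodalBranch hg hb hb0 hF h).exists_singular_ends hg hb hl
        (by linarith [neg_one_le_coe_mul.1 hbd])
    exact ⟨δ, hd, a, h1, h3⟩

/-- Energy confines the motion to `|H| ≤ 1`, here the single distance `v`. -/
theorem Follows.isOpenPieceOf_cylinder (hg : IsEllipticWeingartenFunction g α)
    (hb : Tendsto (fun t : ℝ => (g t : EReal)) atTop (𝓝 b)) {γ : ProfileCurve} {u₀ v : ℝ}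
    {M K : ℝ → ℝ} (h : γ.Follows σ u₀ M) (hB : IsUndularBranch g α b σ u₀ M K)
    (hr : γ.IsRotationalWeingarten g α) (hM : v * M v = 1) (hv : ∀ w > u₀, |w * M w| ≤ 1 → w = v)
    {ρ : ℝ} (hρ : ρ = σ * M v) (hMv : 0 < M v) : γ.IsOpenPieceOf (cylinder ρ) := by
  have hρ' : |ρ| = M v := by rw [hρ, hB.abs_sign_mul, abs_of_pos hMv]
  have hv' : 1 / |ρ| = v := by rw [hρ']; field_simp; linarith
  refine h.isOpenPieceOf (δ := cylinder ρ) (fun s _ => ?_) hB.toIsBranch hr (c := 0) fun s hs =>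
    ⟨mem_univ _, ?_⟩
  · have h1 : (cylinder ρ).x s = v := hv'
    rw [h1, hM, mul_one]
    have h2 : HasDerivAt (fun s : ℝ => ρ / |ρ| * s) (ρ / |ρ|) s := by
      simpa using (hasDerivAt_id s).const_mul (ρ / |ρ|)
    refine h2.congr_deriv ?_
    rw [hρ', hρ, mul_div_cancel_right₀ _ hMv.ne']
  · exact (hv _ (h.lt s hs) ((h.orbitOn hg hb hB.toIsBranch hr).abs_le_one hs)).trans hv'.symm

end ProfileCurve

end

theorem mainTheorem3 (g : ℝ → ℝ) (α : ℝ) (hg : IsEllipticWeingartenFunction g α) (b : EReal)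
    (hb : Tendsto (fun t : ℝ => (g t : EReal)) atTop (𝓝 b)) (hα : α ≠ 0) (hb0 : b < 0) :
    (∀ γ : ProfileCurve, γ.IsRotationalWeingarten g α →
      γ.IsOpenPieceOf (ProfileCurve.sphere α) ∨
      γ.IsOpenPieceOf (ProfileCurve.cylinder (weingartenF g α 0)) ∨
      (∃ (τ : ℝ) (δ : ProfileCurve), δ.IsSpecialUnduloid g α τ ∧ γ.IsOpenPieceOf δ ∧
        ((0 < α ∧ τ < 1 / weingartenF g α 0) ∨
          (α < 0 ∧ b * (τ : EReal) < -1 ∧ τ < -1 / weingartenF g α 0))) ∨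
      (∃ (τ : ℝ) (δ : ProfileCurve), δ.IsSpecialNodoid g α τ ∧ γ.IsOpenPieceOf δ ∧
        ((0 < α ∧ b * (τ : EReal) < -1) ∨ α < 0)) ∨
      (∃ (ν : ℝ) (δ : ProfileCurve), δ.IsPinchedUnduloid g α ν ∧ γ.IsOpenPieceOf δ) ∨
      (∃ (ν : ℝ) (δ : ProfileCurve), δ.IsPinchedNodoid g α ν ∧ γ.IsOpenPieceOf δ) ∨
      (∃ (d : ℝ) (δ : ProfileCurve), δ.IsSingularUnduloid g α d ∧ γ.IsOpenPieceOf δ) ∨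
      (∃ (d : ℝ) (δ : ProfileCurve), δ.IsSingularNodoid g α d ∧ γ.IsOpenPieceOf δ)) ∧
    (∀ F : ℝ → ℝ, IsWeingartenPrimitive g α b F →
      (∀ ν : ℝ, (∃ δ : ProfileCurve, δ.IsPinchedUnduloid g α ν) ↔
        ν ∈ Ico (0 : ℝ) 1 ∧
          (((∃ L : ℝ, Tendsto (weingartenG F) atTop (𝓝 L)) ∧ 0 < α) ∨
            (b = ⊥ ∧ (∃ L : ℝ, Tendsto (weingartenG F) atBot (𝓝 L)) ∧ α < 0))) ∧
      (∀ ν : ℝ, (∃ δ : ProfileCurve, δ.IsPinchedNodoid g α ν) ↔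
        ν ∈ Ico (0 : ℝ) 1 ∧
          (((∃ L : ℝ, Tendsto (weingartenG F) atTop (𝓝 L)) ∧ α < 0) ∨
            (b = ⊥ ∧ (∃ L : ℝ, Tendsto (weingartenG F) atBot (𝓝 L)) ∧ 0 < α)))) ∧
    (∀ d : ℝ, (∃ δ : ProfileCurve, δ.IsSingularUnduloid g α d) ↔
      0 < d ∧ -1 ≤ b * (d : EReal) ∧ b ≠ ⊥ ∧ α < 0) ∧
    (∀ d : ℝ, (∃ δ : ProfileCurve, δ.IsSingularNodoid g α d) ↔
      0 < d ∧ -1 ≤ b * (d : EReal) ∧ b ≠ ⊥ ∧ 0 < α) := by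
  refine ⟨fun γ hr => ?_, fun F hF =>
    ⟨ProfileCurve.exists_isPinchedUnduloid_iff hg hb hα hb0 hF,
      ProfileCurve.exists_isPinchedNodoid_iff hg hb hα hb0 hF⟩,
    ProfileCurve.exists_isSingularUnduloid_iff hg hb hα hb0,
    ProfileCurve.exists_isSingularNodoid_iff hg hb hα hb0⟩
  by_cases hns : ∀ s ∈ interior γ.I, deriv γ.z s / γ.x s = α
  · exact Or.inl (hr.isOpenPieceOf_sphere hg hb hα hns)
  refine Or.inr ?_
  obtain ⟨F, u₀, Λ, σ, J, hF, hΛ, hfol, ⟨hB, hside⟩ | ⟨hB, hside⟩⟩ :=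
    hr.exists_branch hg hb hα hb0 hns
  · obtain ⟨t, ht⟩ := hr.nonempty_interior
    obtain ⟨v, hv, hKv⟩ := hB.exists_critical
    have hMv := hB.pos v hv
    have hfM := hB.relation v hv
    rw [hKv, mul_zero] at hfM
    -- At the critical distance `f(σ M v) = 0`, so the involution identifies `σ M v` with `ρ =
    -- f(0)`.
    have hρ := hg.f_f hb (hB.range v hv)
    rw [hfM] at hρ
    rcases hB.trichotomy (hfol.lt t ht)
      ((hfol.orbitOn hg hb hB.toIsBranch hr).abs_le_one ht) hv hKv with
      ⟨h1, h2⟩ | ⟨h1, τ, hτ, hτv, hτ1⟩ | ⟨l, hl1, hl⟩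
    · exact Or.inl (hfol.isOpenPieceOf_cylinder hg hb hB hr h1 h2 hρ hMv)
    · obtain ⟨δ, hδ, hcap⟩ := hB.exists_specialUnduloid hg hb hv hKv h1 hτ hτv hτ1
      refine Or.inr (Or.inl ⟨τ, δ, hδ, hcap γ hr hfol, ?_⟩)
      -- `τ M v < v M v < 1` and `M v = |ρ|` give the upper bound `τ < 1/|ρ|`.
      have hlt := (mul_lt_mul_of_pos_right hτv hMv).trans h1
      have hτ0 := hB.nonneg.trans_lt hτ
      rcases hside with ⟨h, rfl, rfl⟩ | ⟨h, rfl, rfl⟩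
      · refine Or.inl ⟨h, ?_⟩
        rw [one_mul] at hρ
        rw [hρ, lt_div_iff₀ hMv]
        exact hlt
      · refine Or.inr ⟨h, mul_lt_neg_one_of_lt (hΛ.mem τ hτ).1 hτ0 (by linarith), ?_⟩
        rw [hρ, neg_one_mul, neg_div_neg_eq, lt_div_iff₀ hMv]
        exact hlt
    · obtain ⟨δ, a, h1, h2, h3, h4, hcap⟩ := hB.exists_singular_ends hg hb hl hl1
      -- The orbit ends at distance `u₀`: on the axis the surface is pinched, off the axis it is
      -- singular.
      rcases hB.nonneg.eq_or_lt with rfl | h0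
      · exact Or.inr (Or.inr (Or.inr (Or.inl ⟨_, δ, ⟨a, h1, h2, h3, h4⟩, hcap γ hr hfol⟩)))
      · exact Or.inr (Or.inr (Or.inr (Or.inr (Or.inr (Or.inl
          ⟨u₀, δ, ⟨h0, a, h1, h3, h4⟩, hcap γ hr hfol⟩)))))
  · rcases hB.dichotomy with ⟨τ, hτ, hτ1⟩ | ⟨l, hl1, hl⟩
    · obtain ⟨δ, hδ, hcap⟩ := hB.exists_specialNodoid hg hb hτ hτ1
      refine Or.inr (Or.inr (Or.inl ⟨τ, δ, hδ, hcap γ hr hfol, ?_⟩))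
      rcases hside with ⟨h, rfl, rfl⟩ | ⟨h, rfl, rfl⟩
      · exact Or.inr h
      · exact Or.inl ⟨h, mul_lt_neg_one_of_lt (hΛ.mem τ hτ).1 (hB.nonneg.trans_lt hτ)
          (by linarith)⟩
    · obtain ⟨δ, a, h1, h2, h3, hcap⟩ := hB.exists_singular_ends hg hb hl hl1
      rcases hB.nonneg.eq_or_lt with rfl | h0
      · exact Or.inr (Or.inr (Or.inr (Or.inr (Or.inl
          ⟨_, δ, ⟨a, h1, h2, h3⟩, hcap γ hr hfol⟩))))
      · exact Or.inr (Or.inr (Or.inr (Or.inr (Or.inr (Or.inr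
          ⟨u₀, δ, ⟨h0, a, h1, h3⟩, hcap γ hr hfol⟩)))))
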